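/- Let $\alpha>0$. Let $\mathcal M(\mathbb R^2)$ be the space of finite signed Radon measures on $\mathbb R^2$, and let $\mathcal G$ be the group of homeomorphisms of $\mathbb R^2$ that preserve Lebesgue measure. Let $$G^\alpha(x)=\frac1{2\pi}\Bigl(K_0\bigl(|x|/\alpha\bigr)+\ln|x|\Bigr),\qquad K^\alpha(x)=\nabla^\perp G^\alpha(x)=(-\partial_2G^\alpha,\partial_1G^\alpha)(x)\quad(x\neq0),\qquad K^\alpha(0)=0,$$ where $K_0(r)=\int_0^\infty e^{-r\cosh s}\,ds$ is the modified Bessel function of the second kind of order zero. For $q_0\in\mathcal M(\mathbb R^2)$, a global weak solution of $$\partial_t q+u\cdot\operatorname{grad}q=0,\qquad u=K^\alpha*q,\qquad q(0)=q_0$$ is a triple $(\eta,u,q)$ of maps $\eta,u:\mathbb R\times\mathbb R^2\to\mathbb R^2$ and $q:\mathbb R\to\mathcal M(\mathbb R^2)$ such that: $t\mapsto\int f\,dq(t)$ is continuous for every continuous $f$ vanishing at infinity; $q(0)=q_0$; $u(x,t)=\int K^\alpha(x-y)\,dq(t)(y)$ for all $x,t$; $$\int_{\mathbb R}\int_{\mathbb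 R^2}\bigl(\partial_t\phi+u\cdot\operatorname{grad}\phi\bigr)\,dq(t)\,dt=0\qquad\text{for all }\phi\in C_c^\infty(\mathbb R\times\mathbb R^2);$$ and $\eta$ is a flow map of $u$: $\eta(x,0)=x$ and $\partial_t\eta(x,t)=u(\eta(x,t),t)$ for all $x,t$. Then for every $q_0\in\mathcal M(\mathbb R^2)$ there exists exactly one global weak solution $(\eta^\alpha,u^\alpha,q)$. Moreover: 1. $\eta^\alpha\in C^1(\mathbb R;\mathcal G)$: each $\eta^\alpha(\cdot,t)$ lies in $\mathcal G$, and $t\mapsto\eta^\alpha(\cdot,t)-\eta^\alpha(\cdot,0)$ is a $C^1$ curve in the Banach space of bounded continuous vector fields with the supremum norm. 2. $u^\alpha\in C^0(\mathbb R;C^0_{\mathrm{div}}(\mathbb R^2,\mathbb R^2))$: each $u^\alpha(\cdot,t)$ is bounded, continuous and divergence-free in the sense of distributions, and $t\mapsto u^\alpha(\cdot,t)$ is continuous in the supremum norm. 3. $q\in C^0(\mathbb R;\mathcal M(\mathbb R^2))$ with respect to weak convergence of measures: $t\mapsto\int f\,dq(t)$ is continuous for every bounded continuous $f$. 4. The co-Adjoint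 action is conserved: $\operatorname{Ad}^*_{\eta^\alpha(\cdot,t)}(q(t))=q_0$ for all $t\in\mathbb R$, where $\operatorname{Ad}^*_\eta(q)=q\circ\eta$, i.e. $(q\circ\eta)(A)=q(\eta(A))$ for Borel sets $A$. 5. The weak co-adjoint action is conserved: $\operatorname{w-ad}^*_{u^\alpha}(q)=0$, where $\operatorname{w-ad}^*_u(q)$ is the distribution $\phi\mapsto\int_{\mathbb R}\int_{\mathbb R^2}(\partial_t\phi+u\cdot\operatorname{grad}\phi)\,dq(t)\,dt$, $\phi\in C_c^\infty(\mathbb R\times\mathbb R^2)$. -/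

import Mathlib

open MeasureTheory Set Filter Topology
open scoped ContDiff BoundedContinuousFunction ZeroAtInfty

noncomputable section

namespace EulerAlpha

/-- The Euclidean plane. -/
abbrev Plane : Type := EuclideanSpace ℝ (Fin 2)

/-- The space of (finite, signed) Radon measures on the plane. Every finite signed Borel measure
on the plane is regular, so no further condition is needed. -/
abbrev RadonMeasure : Type := SignedMeasure Plane

/-- The group of homeomorphisms of the plane that preserve Lebesgue measure. -/
abbrev MeasurePreservingHomeo : Type :=
  {η : Plane ≃ₜ Plane // MeasurePreserving η (volume : Measure Plane) volume}

/-- The modified Bessel function of the second kind of order zero, at `r > 0`. -/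
def besselK0 (r : ℝ) : ℝ := ∫ s in Ioi (0 : ℝ), Real.exp (-(r * Real.cosh s))

/-- The Green's function `(K₀(|x|/α) + ln |x|) / (2π)` of `(1 - α² Δ) Δ`, for `x ≠ 0`. -/
def greenFunction (α : ℝ) (x : Plane) : ℝ :=
  (besselK0 (‖x‖ / α) + Real.log ‖x‖) / (2 * Real.pi)

/-- The perpendicular gradient `∇^⊥ f = (-∂₂ f, ∂₁ f)`. -/
def perpGradient (f : Plane → ℝ) (x : Plane) : Plane :=
  !₂[-(gradient f x 1), gradient f x 0]

/-- The blob kernel `K^α = ∇^⊥ G^α` as a function of the difference of its two arguments,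
extended by continuity by the value `0` at the origin. -/
def blobKernel (α : ℝ) (x : Plane) : Plane :=
  if x = 0 then 0 else perpGradient (greenFunction α) x

/-- The convolution `K^α * q` of the blob kernel with a measure. -/
def blobVelocity (α : ℝ) (q : RadonMeasure) (x : Plane) : Plane :=
  ∫ᵛ y, blobKernel α (x - y) ∂<•q

/-- Smooth compactly supported real functions. -/
def IsTestFunction {F : Type*} [NormedAddCommGroup F] [NormedSpace ℝ F] (φ : F → ℝ) : Prop :=
  ContDiff ℝ ∞ φ ∧ HasCompactSupport φ

/-- A vector field is divergence-free in the sense of distributions. -/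
def IsDivergenceFree (v : Plane → Plane) : Prop :=
  ∀ φ : Plane → ℝ, IsTestFunction φ → ∫ x, fderiv ℝ φ x (v x) = 0

/-- The co-Adjoint action `Ad*_η(q) = q ∘ η`, that is, `(q ∘ η)(A) = q(η(A))`. -/
def coAdjoint (η : MeasurePreservingHomeo) (q : RadonMeasure) : RadonMeasure :=
  VectorMeasure.map q η.1.symm

/-- The weak co-adjoint action `w-ad*_u(q)`, the distribution on space-time
`φ ↦ ∫_ℝ ∫_{ℝ²} (∂ₜφ + u · grad φ) dq(t) dt`. -/
def weakCoadjoint (u : ℝ → Plane → Plane) (q : ℝ → RadonMeasure) (φ : ℝ × Plane → ℝ) : ℝ :=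
  ∫ t : ℝ, ∫ᵛ x, fderiv ℝ φ (t, x) (1, u t x) ∂<•(q t)

/-- `(η, u, q)` is a global weak solution, with initial datum `q₀`, of
`∂ₜ q + u · grad q = 0`, `u = K^α * q`, where `η` is the flow map of `u`.
Only weak-* continuity of `q` (as a curve in the dual of `C₀(ℝ²)`) is required, and `η` is only
required to solve the flow equation for every single particle. -/
structure IsWeakSolution (α : ℝ) (q₀ : RadonMeasure)
    (η : ℝ → Plane → Plane) (u : ℝ → Plane → Plane) (q : ℝ → RadonMeasure) : Prop where
  continuous_weakStar : ∀ f : C₀(Plane, ℝ), Continuous fun t => ∫ᵛ x, f x ∂<•(q t)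
  initial : q 0 = q₀
  velocity : ∀ t x, u t x = blobVelocity α (q t) x
  transport : ∀ φ : ℝ × Plane → ℝ, IsTestFunction φ → weakCoadjoint u q φ = 0
  flow_initial : ∀ x, η 0 x = x
  flow : ∀ t x, HasDerivAt (fun s => η s x) (u t (η t x)) t

/-- `η` is a `C¹` curve in the group of measure-preserving homeomorphisms, with respect to uniform
convergence on the plane: the displacement `η(t) - η(0)` is a `C¹` curve in the Banach space of
bounded continuous vector fields with the supremum norm. -/
def IsC1Curve (η : ℝ → MeasurePreservingHomeo) : Prop :=
  ∃ w : ℝ → (Plane →ᵇ Plane), ContDiff ℝ 1 w ∧ ∀ t x, (η t).1 x = (η 0).1 x + w t x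

/-- `q` is a continuous curve of measures with respect to weak convergence of measures, tested
against all bounded continuous functions. -/
def IsWeaklyContinuous (q : ℝ → RadonMeasure) : Prop :=
  ∀ f : Plane →ᵇ ℝ, Continuous fun t => ∫ᵛ x, f x ∂<•(q t)

end EulerAlpha

end

open EulerAlpha

noncomputable section

namespace EulerAlpha

/-! ### The modified Bessel functions -/

/-! The kernel is a radial profile times a rotated vector, `K^α(x) = ψ(|x|²) x^⊥` with `ψ(s) = (1 -
r K₁(r)) / (2π s)` and `r = √s / α`. Elementary bounds on `K₀` and `K₁` give `-A/s ≤ ψ'(s) ≤ 0`.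
Hence `K^α` is bounded, continuous and decays like `1/|x|`, but near the origin the estimates give
only a log-Lipschitz modulus. Cauchy–Lipschitz theory is therefore replaced by Osgood's.

The right notion is `IsOsgoodField`: for every `ε ≤ 1` the field is within `M ε` of a field with
Lipschitz constant `M (1 - log ε)`. A Grönwall inequality for this modulus (`norm_le_osgoodModulus`)
makes the solutions for the approximating fields a uniform Cauchy sequence. This gives global
existence, uniqueness and a flow of homeomorphisms in any Banach space, without compactness.

This theory is used twice. In the plane, it is applied to `K^α * q(t)` for a weak-* continuous curve
`q`. The approximating fields replace `|x|²` by `|x|² + ε²` in the profile; they are smooth with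
trace-free derivative, so their flows preserve area, and so does the limit flow
(`measurePreserving_flow`). In the space of bounded continuous displacements, it is applied to the
autonomous equation `W' = F(W)`, `F(w)(x) = ∫ K^α(x + w(x) - y - w(y)) dq₀(y)`
(`isOsgoodField_particleField`).

Existence: solve the displacement equation from `W(0) = 0`, let the particles be `x + W(t)(x)` and
let `q(t)` be the image of `q₀` under them. Conservation of the co-Adjoint action is then built in,
and the weak equation is the chain rule integrated in time.

Uniqueness: an arbitrary weak solution must first be shown to be `q₀` transported by its own flow
(`eq_map_flow`). A test function carried by the flow is constant in time when paired with `q(t)`,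
but it is not smooth, so it is mollified at scale `r`. The resulting commutator is of order `(1 -
log r)` times the oscillation of the carried function at scale `r`, and this tends to zero because
the flow has a Hölder-type modulus. Once `q` is transported by its flow, the displacement solves `W'
= F(W)` (`exists_displacement`), whose solution is unique. -/

/-- The modified Bessel function of the second kind of order one. -/
def besselK1 (r : ℝ) : ℝ := ∫ s in Ioi (0 : ℝ), Real.cosh s * Real.exp (-(r * Real.cosh s))

theorem tendsto_sinh_atTop : Tendsto Real.sinh atTop atTop :=
  tendsto_atTop_mono' _ ((eventually_ge_atTop 0).mono fun _ hx => Real.self_le_sinh_iff.2 hx)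
    tendsto_id

/-- With `sinh` in the exponent the integrand has an explicit antiderivative. Since `sinh < cosh`,
it dominates the integrand of `K₁` and yields `K₁(r) ≤ 1/r`. -/
theorem integrableOn_cosh_mul_exp_sinh {r : ℝ} (hr : 0 < r) :
    IntegrableOn (fun s => Real.cosh s * Real.exp (-(r * Real.sinh s))) (Ioi 0) ∧
    ∫ s in Ioi (0 : ℝ), Real.cosh s * Real.exp (-(r * Real.sinh s)) = 1 / r := by
  have hderiv : ∀ s ∈ Ici (0 : ℝ), HasDerivAt (fun s => -(Real.exp (-(r * Real.sinh s)) / r))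
      (Real.cosh s * Real.exp (-(r * Real.sinh s))) s := by
    intro s _
    have h := ((((Real.hasDerivAt_sinh s).const_mul r).neg.exp).div_const r).neg
    refine h.congr_deriv ?_
    simp only [Pi.neg_apply]
    field_simp
  have hlim : Tendsto (fun s => -(Real.exp (-(r * Real.sinh s)) / r)) atTop (𝓝 0) := by
    have h1 : Tendsto (fun s => r * Real.sinh s) atTop atTop :=
      (tendsto_sinh_atTop).const_mul_atTop hr
    have h2 := (Real.tendsto_exp_neg_atTop_nhds_zero.comp h1).div_const r
    simpa using h2.neg
  have hpos : ∀ s ∈ Ioi (0 : ℝ), 0 ≤ Real.cosh s * Real.exp (-(r * Real.sinh s)) :=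
    fun s _ => by positivity
  refine ⟨integrableOn_Ioi_deriv_of_nonneg' hderiv hpos hlim, ?_⟩
  rw [integral_Ioi_of_hasDerivAt_of_nonneg' hderiv hpos hlim]
  simp

theorem integrableOn_cosh_mul_exp {r : ℝ} (hr : 0 < r) :
    IntegrableOn (fun s => Real.cosh s * Real.exp (-(r * Real.cosh s))) (Ioi 0) := by
  refine Integrable.mono' (integrableOn_cosh_mul_exp_sinh hr).1
    (by fun_prop) (Eventually.of_forall fun s => ?_)
  rw [Real.norm_of_nonneg (by positivity)]
  gcongr
  exact (Real.sinh_lt_cosh s).le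

theorem integrableOn_exp_cosh {r : ℝ} (hr : 0 < r) :
    IntegrableOn (fun s => Real.exp (-(r * Real.cosh s))) (Ioi 0) := by
  refine Integrable.mono' (integrableOn_cosh_mul_exp hr)
    (by fun_prop) (Eventually.of_forall fun s => ?_)
  rw [Real.norm_of_nonneg (by positivity)]
  exact le_mul_of_one_le_left (by positivity) (Real.one_le_cosh s)

/-- This is `y ≤ exp y` at `y = r cosh s`. It trades a factor `cosh s` for half of the exponential
decay when the integrand contains `cosh²`. -/
theorem cosh_mul_exp_le {r : ℝ} (hr : 0 < r) (s : ℝ) :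
    Real.cosh s * Real.exp (-(r * Real.cosh s)) ≤ 1 / r := by
  have h1 : r * Real.cosh s ≤ Real.exp (r * Real.cosh s) := by
    linarith [Real.add_one_le_exp (r * Real.cosh s)]
  rw [Real.exp_neg, ← div_eq_mul_inv, div_le_div_iff₀ (Real.exp_pos _) hr]
  linarith

theorem integrableOn_cosh_sq_mul_exp {r : ℝ} (hr : 0 < r) :
    IntegrableOn (fun s => Real.cosh s ^ 2 * Real.exp (-(r * Real.cosh s))) (Ioi 0) := by
  refine Integrable.mono' ((integrableOn_cosh_mul_exp (half_pos hr)).const_mul (1 / (r / 2)))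
    (by fun_prop) (Eventually.of_forall fun s => ?_)
  rw [Real.norm_of_nonneg (by positivity)]
  have h := cosh_mul_exp_le (half_pos hr) s
  have h2 : Real.exp (-(r * Real.cosh s)) =
      Real.exp (-(r / 2 * Real.cosh s)) * Real.exp (-(r / 2 * Real.cosh s)) := by
    rw [← Real.exp_add]; ring_nf
  rw [h2]
  calc _ = (Real.cosh s * Real.exp (-(r / 2 * Real.cosh s))) *
        (Real.cosh s * Real.exp (-(r / 2 * Real.cosh s))) := by ring
    _ ≤ _ := by gcongr

theorem hasDerivAt_besselK0 {r : ℝ} (hr : 0 < r) : HasDerivAt besselK0 (-besselK1 r) r := by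
  have key := hasDerivAt_integral_of_dominated_loc_of_deriv_le
    (μ := volume.restrict (Ioi (0 : ℝ))) (x₀ := r) (s := Ioi (r / 2))
    (F := fun r s => Real.exp (-(r * Real.cosh s)))
    (F' := fun r s => -(Real.cosh s * Real.exp (-(r * Real.cosh s))))
    (bound := fun s => Real.cosh s * Real.exp (-(r / 2 * Real.cosh s)))
    (Ioi_mem_nhds (by linarith))
    (Eventually.of_forall fun x => by fun_prop) (integrableOn_exp_cosh hr)
    (by fun_prop)
    (Eventually.of_forall fun s x hx => by
      rw [norm_neg, Real.norm_of_nonneg (by positivity)]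
      have := Real.cosh_pos s
      gcongr
      exact (mem_Ioi.1 hx).le)
    (integrableOn_cosh_mul_exp (half_pos hr))
    (Eventually.of_forall fun s x hx => by
      have h := ((hasDerivAt_id x).mul_const (Real.cosh s)).neg.exp
      refine h.congr_deriv ?_
      simp
      ring)
  refine key.2.congr_deriv ?_
  rw [besselK1, integral_neg]

/-- Integrate the derivative of `sinh s · exp (-r cosh s)`, whose boundary values vanish, and use
`sinh² = cosh² - 1`. This is the recurrence behind the formula for `K₁'`. -/
theorem integral_cosh_sq_mul_exp {r : ℝ} (hr : 0 < r) :
    r * ∫ s in Ioi (0 : ℝ), Real.cosh s ^ 2 * Real.exp (-(r * Real.cosh s)) =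
      r * besselK0 r + besselK1 r := by
  have i0 := integrableOn_exp_cosh hr
  have i1 := integrableOn_cosh_mul_exp hr
  have i2 := integrableOn_cosh_sq_mul_exp hr
  have hderiv : ∀ s ∈ Ici (0 : ℝ), HasDerivAt (fun s => Real.sinh s * Real.exp (-(r * Real.cosh s)))
      (Real.cosh s * Real.exp (-(r * Real.cosh s)) -
        r * (Real.cosh s ^ 2 * Real.exp (-(r * Real.cosh s))) +
        r * Real.exp (-(r * Real.cosh s))) s := by
    intro s _
    have h := (Real.hasDerivAt_sinh s).mul ((Real.hasDerivAt_cosh s).const_mul r).neg.exp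
    refine h.congr_deriv ?_
    have := Real.cosh_sq s
    simp only [Pi.neg_apply]
    linear_combination (r * Real.exp (-(r * Real.cosh s))) * this
  have hlim : Tendsto (fun s => Real.sinh s * Real.exp (-(r * Real.cosh s))) atTop (𝓝 0) := by
    have h0 : Tendsto (fun y : ℝ => y * Real.exp (-(r * y))) atTop (𝓝 0) := by
      have := Real.tendsto_pow_mul_exp_neg_atTop_nhds_zero 1
      have h1 := (this.comp ((tendsto_id (α := ℝ)).const_mul_atTop hr)).const_mul (1 / r)
      simp only [mul_zero] at h1
      refine h1.congr fun y => ?_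
      simp only [Function.comp, id, pow_one]
      field_simp
    have hc : Tendsto Real.cosh atTop atTop :=
      tendsto_atTop_mono (fun s => (Real.sinh_lt_cosh s).le) tendsto_sinh_atTop
    refine squeeze_zero' ?_ ?_ (h0.comp hc)
    · filter_upwards [eventually_ge_atTop 0] with s hs
      have := Real.sinh_nonneg_iff.2 hs
      positivity
    · refine Eventually.of_forall fun s => ?_
      simp only [Function.comp]
      gcongr
      exact (Real.sinh_lt_cosh s).le
  have h := integral_Ioi_of_hasDerivAt_of_tendsto' hderiv
    ((i1.sub (i2.const_mul r)).add (i0.const_mul r)) hlim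
  simp only [Real.sinh_zero, zero_mul, sub_zero] at h
  have e := integral_add (i1.sub (i2.const_mul r)) (i0.const_mul r)
  have e' := integral_sub i1 (i2.const_mul r)
  simp only [Pi.sub_apply, integral_const_mul] at e e'
  unfold besselK0 besselK1
  linarith

theorem hasDerivAt_besselK1 {r : ℝ} (hr : 0 < r) :
    HasDerivAt besselK1 (-(besselK0 r + besselK1 r / r)) r := by
  have key := hasDerivAt_integral_of_dominated_loc_of_deriv_le
    (μ := volume.restrict (Ioi (0 : ℝ))) (x₀ := r) (s := Ioi (r / 2))
    (F := fun r s => Real.cosh s * Real.exp (-(r * Real.cosh s)))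
    (F' := fun r s => -(Real.cosh s ^ 2 * Real.exp (-(r * Real.cosh s))))
    (bound := fun s => Real.cosh s ^ 2 * Real.exp (-(r / 2 * Real.cosh s)))
    (Ioi_mem_nhds (by linarith))
    (Eventually.of_forall fun x => by fun_prop) (integrableOn_cosh_mul_exp hr)
    (by fun_prop)
    (Eventually.of_forall fun s x hx => by
      rw [norm_neg, Real.norm_of_nonneg (by positivity)]
      have := Real.cosh_pos s
      gcongr
      exact (mem_Ioi.1 hx).le)
    (integrableOn_cosh_sq_mul_exp (half_pos hr))
    (Eventually.of_forall fun s x hx => by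
      have h := (((hasDerivAt_id x).mul_const (Real.cosh s)).neg.exp).const_mul (Real.cosh s)
      refine h.congr_deriv ?_
      simp
      ring)
  refine key.2.congr_deriv ?_
  rw [integral_neg, neg_inj]
  have := integral_cosh_sq_mul_exp hr
  have h2 : besselK0 r + besselK1 r / r = (r * besselK0 r + besselK1 r) / r := by field_simp
  rw [h2, ← this, mul_div_cancel_left₀ _ hr.ne']

theorem besselK1_nonneg (r : ℝ) : 0 ≤ besselK1 r :=
  integral_nonneg fun s => by positivity

theorem besselK0_nonneg (r : ℝ) : 0 ≤ besselK0 r :=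
  integral_nonneg fun s => by positivity

theorem besselK1_le {r : ℝ} (hr : 0 < r) : besselK1 r ≤ 1 / r := by
  rw [← (integrableOn_cosh_mul_exp_sinh hr).2]
  refine integral_mono (integrableOn_cosh_mul_exp hr) (integrableOn_cosh_mul_exp_sinh hr).1
    fun s => ?_
  dsimp only
  gcongr
  exact (Real.sinh_lt_cosh s).le

theorem besselK0_le {r : ℝ} (hr : 0 < r) : besselK0 r ≤ 1 / r := by
  refine le_trans ?_ (besselK1_le hr)
  refine integral_mono (integrableOn_exp_cosh hr) (integrableOn_cosh_mul_exp hr) fun s => ?_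
  exact le_mul_of_one_le_left (by positivity) (Real.one_le_cosh s)

/-- Replacing the prefactor `cosh` by the smaller `sinh` makes the integrand an exact derivative. -/
theorem exp_neg_div_le_besselK1 {r : ℝ} (hr : 0 < r) : Real.exp (-r) / r ≤ besselK1 r := by
  have hderiv : ∀ s ∈ Ici (0 : ℝ), HasDerivAt (fun s => -(Real.exp (-(r * Real.cosh s)) / r))
      (Real.sinh s * Real.exp (-(r * Real.cosh s))) s := by
    intro s _
    have h := ((((Real.hasDerivAt_cosh s).const_mul r).neg.exp).div_const r).neg
    refine h.congr_deriv ?_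
    simp only [Pi.neg_apply]
    field_simp
  have hlim : Tendsto (fun s => -(Real.exp (-(r * Real.cosh s)) / r)) atTop (𝓝 0) := by
    have hc : Tendsto Real.cosh atTop atTop :=
      tendsto_atTop_mono (fun s => (Real.sinh_lt_cosh s).le) tendsto_sinh_atTop
    have h2 := (Real.tendsto_exp_neg_atTop_nhds_zero.comp (hc.const_mul_atTop hr)).div_const r
    simpa using h2.neg
  have hpos : ∀ s ∈ Ioi (0 : ℝ), 0 ≤ Real.sinh s * Real.exp (-(r * Real.cosh s)) :=
    fun s hs => mul_nonneg (Real.sinh_nonneg_iff.2 (le_of_lt hs)) (Real.exp_pos _).le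
  have hint := integral_Ioi_of_hasDerivAt_of_nonneg' hderiv hpos hlim
  have hint2 := integrableOn_Ioi_deriv_of_nonneg' hderiv hpos hlim
  have : Real.exp (-r) / r = ∫ s in Ioi (0 : ℝ), Real.sinh s * Real.exp (-(r * Real.cosh s)) := by
    rw [hint]; simp
  rw [this]
  refine integral_mono hint2 (integrableOn_cosh_mul_exp hr) fun s => ?_
  dsimp only
  gcongr
  exact (Real.sinh_lt_cosh s).le

/-! ### The radial profile of the blob kernel -/

/-- The circulation `1 - r K₁(r)` of the (normalized) blob in the disk of radius `r`. -/
def blobCirculation (r : ℝ) : ℝ := 1 - r * besselK1 r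

theorem hasDerivAt_blobCirculation {r : ℝ} (hr : 0 < r) :
    HasDerivAt blobCirculation (r * besselK0 r) r := by
  have h := ((hasDerivAt_id r).mul (hasDerivAt_besselK1 hr)).const_sub 1
  refine h.congr_deriv ?_
  simp only [id]
  field_simp
  ring

theorem blobCirculation_nonneg {r : ℝ} (hr : 0 < r) : 0 ≤ blobCirculation r := by
  have := besselK1_le hr
  rw [le_div_iff₀ hr] at this
  unfold blobCirculation
  linarith

theorem blobCirculation_le {r : ℝ} (hr : 0 < r) : blobCirculation r ≤ 1 - Real.exp (-r) := by
  have := exp_neg_div_le_besselK1 hr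
  rw [div_le_iff₀ hr] at this
  unfold blobCirculation
  linarith

theorem blobCirculation_le_one {r : ℝ} (hr : 0 < r) : blobCirculation r ≤ 1 := by
  linarith [blobCirculation_le hr, Real.exp_pos (-r)]

theorem blobCirculation_le_self {r : ℝ} (hr : 0 < r) : blobCirculation r ≤ r := by
  linarith [blobCirculation_le hr, Real.add_one_le_exp (-r)]

/-- This combination is the numerator of the derivative of the radial profile. The `K₀` terms
cancel, so its derivative has a sign and is bounded by `r` in absolute value. -/
theorem hasDerivAt_sq_mul_besselK0_sub {r : ℝ} (hr : 0 < r) :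
    HasDerivAt (fun r => r ^ 2 * besselK0 r - 2 * blobCirculation r) (-(r ^ 2 * besselK1 r)) r := by
  have h := ((hasDerivAt_pow 2 r).mul (hasDerivAt_besselK0 hr)).sub
    ((hasDerivAt_blobCirculation hr).const_mul 2)
  refine h.congr_deriv ?_
  simp
  ring

theorem tendsto_sq_mul_besselK0_sub :
    Tendsto (fun r => r ^ 2 * besselK0 r - 2 * blobCirculation r) (𝓝[>] 0) (𝓝 0) := by
  have hid : Tendsto (fun r : ℝ => r) (𝓝[>] 0) (𝓝 0) := tendsto_id.mono_left nhdsWithin_le_nhds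
  have h1 : Tendsto (fun r => r ^ 2 * besselK0 r) (𝓝[>] 0) (𝓝 0) := by
    refine squeeze_zero' ?_ ?_ hid
    · exact Eventually.of_forall fun r => mul_nonneg (sq_nonneg _) (besselK0_nonneg _)
    · filter_upwards [self_mem_nhdsWithin] with r hr
      have hr : 0 < r := hr
      have := besselK0_le hr
      rw [le_div_iff₀ hr] at this
      nlinarith
  have h2 : Tendsto blobCirculation (𝓝[>] 0) (𝓝 0) := by
    refine squeeze_zero' ?_ ?_ hid
    · filter_upwards [self_mem_nhdsWithin] with r hr using blobCirculation_nonneg hr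
    · filter_upwards [self_mem_nhdsWithin] with r hr using blobCirculation_le_self hr
  simpa using h1.sub (h2.const_mul 2)

/-- The function decreases on the positive axis and tends to `0` at `0⁺`. -/
theorem sq_mul_besselK0_sub_nonpos {r : ℝ} (hr : 0 < r) :
    r ^ 2 * besselK0 r - 2 * blobCirculation r ≤ 0 := by
  have hanti : AntitoneOn (fun r => r ^ 2 * besselK0 r - 2 * blobCirculation r) (Ioi 0) := by
    refine antitoneOn_of_hasDerivWithinAt_nonpos (convex_Ioi 0)
      (fun x hx => (hasDerivAt_sq_mul_besselK0_sub hx).continuousAt.continuousWithinAt)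
      (f' := fun r => -(r ^ 2 * besselK1 r)) ?_ ?_
    · intro x hx
      rw [interior_Ioi] at hx ⊢
      exact (hasDerivAt_sq_mul_besselK0_sub hx).hasDerivWithinAt
    · intro x _
      exact neg_nonpos.2 (mul_nonneg (sq_nonneg _) (besselK1_nonneg _))
  refine ge_of_tendsto tendsto_sq_mul_besselK0_sub ?_
  filter_upwards [Ioo_mem_nhdsGT hr] with w hw
  exact hanti hw.1 hr hw.2.le

/-- After adding `r²/2` the derivative is `r - r² K₁(r)`, nonnegative by `K₁ ≤ 1/r`, and the limit
at `0⁺` is still `0`. -/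
theorem neg_sq_div_two_le_sq_mul_besselK0_sub {r : ℝ} (hr : 0 < r) :
    -(r ^ 2 / 2) ≤ r ^ 2 * besselK0 r - 2 * blobCirculation r := by
  have hd : ∀ x : ℝ, 0 < x → HasDerivAt
      (fun r => (r ^ 2 * besselK0 r - 2 * blobCirculation r) + r ^ 2 / 2)
      (-(x ^ 2 * besselK1 x) + x) x := fun x hx => by
    refine ((hasDerivAt_sq_mul_besselK0_sub hx).add ((hasDerivAt_pow 2 x).div_const 2)).congr_deriv ?_
    simp
  have hmono : MonotoneOn
      (fun r => (r ^ 2 * besselK0 r - 2 * blobCirculation r) + r ^ 2 / 2) (Ioi 0) := by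
    refine monotoneOn_of_hasDerivWithinAt_nonneg (convex_Ioi 0)
      (fun x hx => (hd x hx).continuousAt.continuousWithinAt)
      (f' := fun x => -(x ^ 2 * besselK1 x) + x) ?_ ?_
    · intro x hx
      rw [interior_Ioi] at hx ⊢
      exact (hd x hx).hasDerivWithinAt
    · intro x hx
      rw [interior_Ioi] at hx
      have hx : 0 < x := hx
      have := besselK1_le hx
      rw [le_div_iff₀ hx] at this
      nlinarith
  have hlim : Tendsto (fun r => (r ^ 2 * besselK0 r - 2 * blobCirculation r) + r ^ 2 / 2)
      (𝓝[>] 0) (𝓝 0) := by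
    have : Tendsto (fun r : ℝ => r ^ 2 / 2) (𝓝[>] 0) (𝓝 0) := by
      have h : Continuous fun r : ℝ => r ^ 2 / 2 := by fun_prop
      simpa using (h.tendsto 0).mono_left nhdsWithin_le_nhds
    simpa using tendsto_sq_mul_besselK0_sub.add this
  have : 0 ≤ (r ^ 2 * besselK0 r - 2 * blobCirculation r) + r ^ 2 / 2 := by
    refine le_of_tendsto hlim ?_
    filter_upwards [Ioo_mem_nhdsGT hr] with w hw
    exact hmono hw.1 hr hw.2.le
  linarith

/-- The radial profile of the blob kernel, as a function of the squared radius: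
`K^α(x) = blobProfile α (|x|²) x^⊥`. -/
def blobProfile (α s : ℝ) : ℝ := blobCirculation (√s / α) / (2 * Real.pi * s)

/-- The derivative of `blobProfile`. -/
def blobProfileDeriv (α s : ℝ) : ℝ :=
  ((√s / α) ^ 2 * besselK0 (√s / α) - 2 * blobCirculation (√s / α)) / (4 * Real.pi * s ^ 2)

theorem hasDerivAt_blobProfile {α s : ℝ} (hα : 0 < α) (hs : 0 < s) :
    HasDerivAt (blobProfile α) (blobProfileDeriv α s) s := by
  have hsq : 0 < √s := Real.sqrt_pos.2 hs
  have hr : 0 < √s / α := div_pos hsq hα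
  have h1 : HasDerivAt (fun s => √s / α) (1 / (2 * √s) / α) s :=
    (Real.hasDerivAt_sqrt hs.ne').div_const α
  have h2 := (hasDerivAt_blobCirculation hr).comp s h1
  have h3 : HasDerivAt (fun s : ℝ => 2 * Real.pi * s) (2 * Real.pi) s := by
    simpa using (hasDerivAt_id s).const_mul (2 * Real.pi)
  have h4 := h2.div h3 (by positivity)
  refine h4.congr_deriv ?_
  unfold blobProfileDeriv
  have hs2 : √s ^ 2 = s := Real.sq_sqrt hs.le
  simp only [Function.comp]
  generalize besselK0 (√s / α) = a
  generalize blobCirculation (√s / α) = b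
  generalize √s = c at *
  subst hs2
  field_simp
  ring

theorem blobProfileDeriv_nonpos {α s : ℝ} (hα : 0 < α) (hs : 0 < s) :
    blobProfileDeriv α s ≤ 0 :=
  div_nonpos_of_nonpos_of_nonneg
    (sq_mul_besselK0_sub_nonpos (div_pos (Real.sqrt_pos.2 hs) hα)) (by positivity)

/-- A constant that controls the blob kernel. -/
def blobConst (α : ℝ) : ℝ := 1 / α ^ 2 + 1 / α + 1

theorem blobConst_pos {α : ℝ} (hα : 0 < α) : 0 < blobConst α := by
  unfold blobConst; positivity

theorem one_le_two_pi : 1 ≤ 2 * Real.pi := by linarith [Real.pi_gt_three]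

/-- This bound of order `1/s` is the source of the logarithm in every later modulus of continuity.
-/
theorem neg_le_blobProfileDeriv {α s : ℝ} (hα : 0 < α) (hs : 0 < s) :
    -(blobConst α / s) ≤ blobProfileDeriv α s := by
  have h := neg_sq_div_two_le_sq_mul_besselK0_sub (div_pos (Real.sqrt_pos.2 hs) hα)
  have hs2 : (√s / α) ^ 2 = s / α ^ 2 := by rw [div_pow, Real.sq_sqrt hs.le]
  have h1 : -(1 / α ^ 2 / s) ≤ blobProfileDeriv α s := by
    unfold blobProfileDeriv
    rw [le_div_iff₀ (by positivity)]
    refine le_trans ?_ h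
    rw [hs2]
    have : -(1 / α ^ 2 / s) * (4 * Real.pi * s ^ 2) = -(4 * Real.pi) * (s / α ^ 2) := by
      field_simp
    rw [this]
    have : 0 < s / α ^ 2 := by positivity
    nlinarith [Real.pi_gt_three]
  refine le_trans ?_ h1
  rw [neg_le_neg_iff]
  gcongr
  unfold blobConst
  have : 0 < 1 / α := by positivity
  linarith

theorem blobProfile_nonneg {α s : ℝ} (hα : 0 < α) (hs : 0 < s) : 0 ≤ blobProfile α s :=
  div_nonneg (blobCirculation_nonneg (div_pos (Real.sqrt_pos.2 hs) hα)) (by positivity)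

theorem blobProfile_le_div {α s : ℝ} (hα : 0 < α) (hs : 0 < s) :
    blobProfile α s ≤ blobConst α / s := by
  have h := blobCirculation_le_one (div_pos (Real.sqrt_pos.2 hs) hα)
  have h2 := one_le_two_pi
  unfold blobProfile
  have h3 : 1 ≤ blobConst α := by
    unfold blobConst
    have : 0 < 1 / α := by positivity
    have : 0 < 1 / α ^ 2 := by positivity
    linarith
  rw [div_le_div_iff₀ (by positivity) hs]
  nlinarith [mul_le_mul h3 h2 (by norm_num) (by linarith)]

/-- Up to notation this is the boundedness of the kernel: the circulation grows at most linearly in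
the radius, which compensates the `1/|x|` singularity of a point vortex. -/
theorem sqrt_mul_blobProfile_le {α s : ℝ} (hα : 0 < α) (hs : 0 < s) :
    √s * blobProfile α s ≤ blobConst α := by
  have hsq := Real.sqrt_pos.2 hs
  have h := blobCirculation_le_self (div_pos hsq hα)
  have h2 := one_le_two_pi
  unfold blobProfile
  have h3 : 1 / α ≤ blobConst α := by
    unfold blobConst
    have : 0 < 1 / α ^ 2 := by positivity
    linarith
  refine le_trans ?_ h3
  rw [mul_div_assoc', div_le_div_iff₀ (by positivity) hα]
  rw [le_div_iff₀ hα] at h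
  have hs2 : √s ^ 2 = s := Real.sq_sqrt hs.le
  nlinarith [mul_le_mul_of_nonneg_left h hsq.le]

theorem antitoneOn_blobProfile {α : ℝ} (hα : 0 < α) : AntitoneOn (blobProfile α) (Ioi 0) := by
  refine antitoneOn_of_hasDerivWithinAt_nonpos (convex_Ioi 0)
    (fun x hx => (hasDerivAt_blobProfile hα hx).continuousAt.continuousWithinAt)
    (f' := blobProfileDeriv α) ?_ ?_
  · intro x hx
    rw [interior_Ioi] at hx ⊢
    exact (hasDerivAt_blobProfile hα hx).hasDerivWithinAt
  · intro x hx
    rw [interior_Ioi] at hx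
    exact blobProfileDeriv_nonpos hα hx

/-- The lower bound on the derivative in integrated form. Together with antitonicity it traps
differences of profile values between `0` and `A` times a difference of logarithms. -/
theorem monotoneOn_blobProfile_add_log {α : ℝ} (hα : 0 < α) :
    MonotoneOn (fun s => blobProfile α s + blobConst α * Real.log s) (Ioi 0) := by
  have hd : ∀ x : ℝ, 0 < x → HasDerivAt (fun s => blobProfile α s + blobConst α * Real.log s)
      (blobProfileDeriv α x + blobConst α * x⁻¹) x := fun x hx =>
    (hasDerivAt_blobProfile hα hx).add ((Real.hasDerivAt_log hx.ne').const_mul _)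
  refine monotoneOn_of_hasDerivWithinAt_nonneg (convex_Ioi 0)
    (fun x hx => (hd x hx).continuousAt.continuousWithinAt)
    (f' := fun x => blobProfileDeriv α x + blobConst α * x⁻¹) ?_ ?_
  · intro x hx
    rw [interior_Ioi] at hx ⊢
    exact (hd x hx).hasDerivWithinAt
  · intro x hx
    rw [interior_Ioi] at hx
    have := neg_le_blobProfileDeriv hα hx
    rw [div_eq_mul_inv] at this
    linarith

theorem blobProfile_le_log {α s : ℝ} (hα : 0 < α) (hs : 0 < s) (hs1 : s ≤ 1) :
    blobProfile α s ≤ blobConst α * (1 - Real.log s) := by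
  have h := monotoneOn_blobProfile_add_log hα (mem_Ioi.2 hs) (mem_Ioi.2 one_pos) hs1
  simp only [Real.log_one, mul_zero, add_zero] at h
  have h2 := blobProfile_le_div hα one_pos
  rw [div_one] at h2
  linarith

/-! ### The blob kernel and its regularizations -/

/-- The rotation by a right angle `x ↦ x^⊥`. -/
def rot : Plane →L[ℝ] Plane :=
  LinearMap.toContinuousLinearMap
    { toFun := fun x => !₂[-(x 1), x 0]
      map_add' := fun x y => by ext i; fin_cases i <;> simp [add_comm]
      map_smul' := fun c x => by ext i; fin_cases i <;> simp }

@[simp] theorem rot_zero_coord (x : Plane) : rot x 0 = -(x 1) := rfl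

@[simp] theorem rot_one_coord (x : Plane) : rot x 1 = x 0 := rfl

theorem norm_rot (x : Plane) : ‖rot x‖ = ‖x‖ := by
  simp [EuclideanSpace.norm_eq, Fin.sum_univ_two, add_comm]

theorem norm_rot_le : ‖rot‖ ≤ 1 :=
  ContinuousLinearMap.opNorm_le_bound _ zero_le_one fun x => by rw [norm_rot, one_mul]

/-- The blob kernel with `|x|²` replaced by `|x|² + ε²` in its profile. -/
def regKernel (α ε : ℝ) (x : Plane) : Plane := blobProfile α (‖x‖ ^ 2 + ε ^ 2) • rot x

theorem hasGradientAt_greenFunction {α : ℝ} (hα : 0 < α) {x : Plane} (hx : x ≠ 0) :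
    HasGradientAt (greenFunction α) (blobProfile α (‖x‖ ^ 2) • x) x := by
  have hr : 0 < ‖x‖ := norm_pos_iff.2 hx
  have hr' : 0 < ‖x‖ / α := div_pos hr hα
  have hd : HasDerivAt (fun r => (besselK0 (r / α) + Real.log r) / (2 * Real.pi))
      ((-besselK1 (‖x‖ / α) * (1 / α) + ‖x‖⁻¹) / (2 * Real.pi)) ‖x‖ := by
    refine HasDerivAt.div_const (HasDerivAt.add ?_ (Real.hasDerivAt_log hr.ne')) _
    exact (hasDerivAt_besselK0 hr').comp ‖x‖ ((hasDerivAt_id ‖x‖).div_const α)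
  have hn : HasFDerivAt (fun y : Plane => ‖y‖) (‖x‖⁻¹ • innerSL ℝ x) x := by
    have h1 : HasFDerivAt (fun y : Plane => ‖y‖ ^ 2) (2 • innerSL ℝ x) x :=
      (hasStrictFDerivAt_norm_sq x).hasFDerivAt
    have h2 := h1.sqrt (by positivity)
    simp only [Real.sqrt_sq (norm_nonneg _)] at h2
    refine h2.congr_fderiv ?_
    ext y
    simp
    field_simp
  rw [hasGradientAt_iff_hasFDerivAt]
  refine (hd.comp_hasFDerivAt x hn).congr_fderiv ?_
  ext y
  simp only [blobProfile, Real.sqrt_sq (norm_nonneg x), blobCirculation, FunLike.coe_smul,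
    Pi.smul_apply, innerSL_apply_apply, smul_eq_mul, InnerProductSpace.toDual_apply_apply,
    real_inner_smul_left]
  field_simp
  ring

theorem blobKernel_eq {α : ℝ} (hα : 0 < α) (x : Plane) :
    blobKernel α x = blobProfile α (‖x‖ ^ 2) • rot x := by
  unfold blobKernel
  split_ifs with hx
  · simp [hx]
  · unfold perpGradient
    rw [(hasGradientAt_greenFunction hα hx).gradient]
    ext i
    fin_cases i <;> simp

theorem norm_blobKernel_le {α : ℝ} (hα : 0 < α) (x : Plane) : ‖blobKernel α x‖ ≤ blobConst α := by
  rw [blobKernel_eq hα]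
  rcases eq_or_ne x 0 with rfl | hx
  · simpa using (blobConst_pos hα).le
  have hr : 0 < ‖x‖ ^ 2 := by have := norm_pos_iff.2 hx; positivity
  rw [norm_smul, norm_rot, Real.norm_of_nonneg (blobProfile_nonneg hα hr)]
  have := sqrt_mul_blobProfile_le hα hr
  rwa [Real.sqrt_sq (norm_nonneg _), mul_comm] at this

theorem norm_regKernel_le_of_norm_sq {α ε : ℝ} (hα : 0 < α) (hε : 0 < ε) (x : Plane) :
    ‖regKernel α ε x‖ ≤ blobProfile α (‖x‖ ^ 2 + ε ^ 2) * ‖x‖ := by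
  have hr : 0 < ‖x‖ ^ 2 + ε ^ 2 := by positivity
  rw [regKernel, norm_smul, norm_rot, Real.norm_of_nonneg (blobProfile_nonneg hα hr)]

theorem norm_regKernel_le {α ε : ℝ} (hα : 0 < α) (hε : 0 < ε) (x : Plane) :
    ‖regKernel α ε x‖ ≤ blobConst α := by
  have hr : 0 < ‖x‖ ^ 2 + ε ^ 2 := by positivity
  refine (norm_regKernel_le_of_norm_sq hα hε x).trans ?_
  have := sqrt_mul_blobProfile_le hα hr
  refine le_trans ?_ this
  rw [mul_comm]
  refine mul_le_mul_of_nonneg_right ?_ (blobProfile_nonneg hα hr)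
  exact Real.le_sqrt_of_sq_le (by nlinarith [sq_nonneg ε])

theorem norm_blobKernel_le_div {α : ℝ} (hα : 0 < α) {x : Plane} (hx : x ≠ 0) :
    ‖blobKernel α x‖ ≤ blobConst α / ‖x‖ := by
  have hr : 0 < ‖x‖ := norm_pos_iff.2 hx
  have hr2 : 0 < ‖x‖ ^ 2 := by positivity
  rw [blobKernel_eq hα, norm_smul, norm_rot, Real.norm_of_nonneg (blobProfile_nonneg hα hr2)]
  have := blobProfile_le_div hα hr2
  calc _ ≤ blobConst α / ‖x‖ ^ 2 * ‖x‖ := by gcongr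
    _ = _ := by field_simp

theorem norm_regKernel_le_div {α ε : ℝ} (hα : 0 < α) (hε : 0 < ε) {x : Plane} (hx : x ≠ 0) :
    ‖regKernel α ε x‖ ≤ blobConst α / ‖x‖ := by
  have hr : 0 < ‖x‖ := norm_pos_iff.2 hx
  have hr2 : 0 < ‖x‖ ^ 2 := by positivity
  refine (norm_regKernel_le_of_norm_sq hα hε x).trans ?_
  have h1 : blobProfile α (‖x‖ ^ 2 + ε ^ 2) ≤ blobProfile α (‖x‖ ^ 2) :=
    antitoneOn_blobProfile hα (mem_Ioi.2 hr2) (mem_Ioi.2 (by positivity))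
      (by nlinarith [sq_nonneg ε])
  calc _ ≤ blobConst α / ‖x‖ ^ 2 * ‖x‖ := by
        gcongr
        exact h1.trans (blobProfile_le_div hα hr2)
    _ = _ := by field_simp

/-- The profile changes by at most `A (log (|x|² + ε²) - log |x|²) ≤ 2Aε/|x|`, and the factor `|x^⊥|
= |x|` cancels the singularity. -/
theorem norm_regKernel_sub_blobKernel_le {α ε : ℝ} (hα : 0 < α) (hε : 0 < ε) (x : Plane) :
    ‖regKernel α ε x - blobKernel α x‖ ≤ 2 * blobConst α * ε := by
  have hA := blobConst_pos hα
  rw [blobKernel_eq hα, regKernel, ← sub_smul, norm_smul, norm_rot]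
  rcases eq_or_ne x 0 with rfl | hx
  · simp; positivity
  have hr : 0 < ‖x‖ := norm_pos_iff.2 hx
  have hr2 : 0 < ‖x‖ ^ 2 := by positivity
  have hre : 0 < ‖x‖ ^ 2 + ε ^ 2 := by positivity
  have hle : ‖x‖ ^ 2 ≤ ‖x‖ ^ 2 + ε ^ 2 := by nlinarith [sq_nonneg ε]
  have h1 := antitoneOn_blobProfile hα (mem_Ioi.2 hr2) (mem_Ioi.2 hre) hle
  have h2 := monotoneOn_blobProfile_add_log hα (mem_Ioi.2 hr2) (mem_Ioi.2 hre) hle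
  simp only at h2
  have h3 : Real.log (‖x‖ ^ 2 + ε ^ 2) - Real.log (‖x‖ ^ 2) ≤ 2 * (ε / ‖x‖) := by
    have e1 : Real.log (‖x‖ ^ 2 + ε ^ 2) ≤ Real.log ((‖x‖ + ε) ^ 2) :=
      Real.log_le_log hre (by nlinarith [mul_pos hr hε])
    have e2 : Real.log ((‖x‖ + ε) / ‖x‖) ≤ (‖x‖ + ε) / ‖x‖ - 1 :=
      Real.log_le_sub_one_of_pos (by positivity)
    rw [Real.log_div (by positivity) hr.ne', add_div, div_self hr.ne'] at e2
    rw [Real.log_pow] at e1 ⊢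
    push_cast at e1 ⊢
    linarith
  rw [Real.norm_eq_abs, abs_sub_comm, abs_of_nonneg (sub_nonneg.2 h1)]
  have h4 : blobProfile α (‖x‖ ^ 2) - blobProfile α (‖x‖ ^ 2 + ε ^ 2) ≤
      blobConst α * (2 * (ε / ‖x‖)) := by nlinarith
  calc _ ≤ blobConst α * (2 * (ε / ‖x‖)) * ‖x‖ := by gcongr
    _ = _ := by field_simp

/-- The derivative of `regKernel`. -/
def regKernelDeriv (α ε : ℝ) (x : Plane) : Plane →L[ℝ] Plane :=
  blobProfile α (‖x‖ ^ 2 + ε ^ 2) • rot +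
    (blobProfileDeriv α (‖x‖ ^ 2 + ε ^ 2) • (2 • innerSL ℝ x)).smulRight (rot x)

theorem hasFDerivAt_regKernel {α ε : ℝ} (hα : 0 < α) (hε : 0 < ε) (x : Plane) :
    HasFDerivAt (regKernel α ε) (regKernelDeriv α ε x) x := by
  have hre : 0 < ‖x‖ ^ 2 + ε ^ 2 := by positivity
  have h1 : HasFDerivAt (fun y : Plane => ‖y‖ ^ 2 + ε ^ 2) (2 • innerSL ℝ x) x :=
    (hasStrictFDerivAt_norm_sq x).hasFDerivAt.add_const _
  exact ((hasDerivAt_blobProfile hα hre).comp_hasFDerivAt x h1).smul rot.hasFDerivAt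

/-- The rotation term costs the profile at `ε²`, at most `A (1 - 2 log ε)`. The rank-one term costs
`2 |x|² |ψ'| ≤ 2A`. Their sum is at most `3A (1 - log ε)` because `log ε ≤ 0`. -/
theorem norm_regKernelDeriv_le {α ε : ℝ} (hα : 0 < α) (hε : 0 < ε) (hε1 : ε ≤ 1) (x : Plane) :
    ‖regKernelDeriv α ε x‖ ≤ 3 * blobConst α * (1 - Real.log ε) := by
  have hA := blobConst_pos hα
  have hre : 0 < ‖x‖ ^ 2 + ε ^ 2 := by positivity
  have hε2 : 0 < ε ^ 2 := by positivity
  have hlog : Real.log ε ≤ 0 := Real.log_nonpos hε.le hε1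
  have h1 : blobProfile α (‖x‖ ^ 2 + ε ^ 2) ≤ blobConst α * (1 - 2 * Real.log ε) := by
    refine (antitoneOn_blobProfile hα (mem_Ioi.2 hε2) (mem_Ioi.2 hre)
      (by nlinarith [sq_nonneg ‖x‖])).trans ?_
    have := blobProfile_le_log hα hε2 (by nlinarith)
    rwa [Real.log_pow] at this
  have h2 : |blobProfileDeriv α (‖x‖ ^ 2 + ε ^ 2)| ≤ blobConst α / (‖x‖ ^ 2 + ε ^ 2) := by
    rw [abs_of_nonpos (blobProfileDeriv_nonpos hα hre)]
    linarith [neg_le_blobProfileDeriv hα hre]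
  have h3 : ‖(blobProfileDeriv α (‖x‖ ^ 2 + ε ^ 2) • (2 • innerSL ℝ x)).smulRight (rot x)‖ ≤
      2 * blobConst α := by
    refine ContinuousLinearMap.opNorm_le_bound _ (by positivity) fun y => ?_
    have e : ((blobProfileDeriv α (‖x‖ ^ 2 + ε ^ 2) • (2 • innerSL ℝ x)).smulRight (rot x)) y =
        (blobProfileDeriv α (‖x‖ ^ 2 + ε ^ 2) * (2 * inner ℝ x y)) • rot x := by
      simp
    have h4 := abs_real_inner_le_norm x y
    rw [e, norm_smul, norm_rot, Real.norm_eq_abs, abs_mul, abs_mul, abs_two]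
    calc _ ≤ blobConst α / (‖x‖ ^ 2 + ε ^ 2) * (2 * (‖x‖ * ‖y‖)) * ‖x‖ := by gcongr
      _ = 2 * blobConst α * (‖x‖ ^ 2 / (‖x‖ ^ 2 + ε ^ 2)) * ‖y‖ := by ring
      _ ≤ 2 * blobConst α * 1 * ‖y‖ := by
        gcongr
        rw [div_le_one hre]; linarith
      _ = _ := by ring
  refine (norm_add_le _ _).trans ?_
  have h4 : ‖blobProfile α (‖x‖ ^ 2 + ε ^ 2) • rot‖ ≤ blobConst α * (1 - 2 * Real.log ε) := by
    rw [norm_smul, Real.norm_of_nonneg (blobProfile_nonneg hα hre)]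
    calc _ ≤ blobProfile α (‖x‖ ^ 2 + ε ^ 2) * 1 := by
          gcongr
          · exact blobProfile_nonneg hα hre
          · exact norm_rot_le
      _ ≤ _ := by rwa [mul_one]
  nlinarith

/-- The rotation has trace zero, and the rank-one term has trace proportional to `⟨x, x^⊥⟩ = 0`.
This is why the regularization acts on the profile only. -/
theorem regKernelDeriv_trace (α ε : ℝ) (x : Plane) :
    regKernelDeriv α ε x (EuclideanSpace.single 0 1) 0 +
      regKernelDeriv α ε x (EuclideanSpace.single 1 1) 1 = 0 := by
  simp [regKernelDeriv, EuclideanSpace.inner_single_right]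
  ring

theorem continuousOn_blobProfileDeriv {α : ℝ} (hα : 0 < α) :
    ContinuousOn (blobProfileDeriv α) (Ioi 0) := by
  intro s hs
  have hs : 0 < s := hs
  have hr := div_pos (Real.sqrt_pos.2 hs) hα
  have h1 : ContinuousAt (fun s => √s / α) s := by fun_prop
  have h2 := ContinuousAt.comp (f := fun s => √s / α) (x := s)
    (hasDerivAt_sq_mul_besselK0_sub hr).continuousAt h1
  refine ContinuousAt.continuousWithinAt ?_
  unfold blobProfileDeriv
  exact h2.div (by fun_prop) (by positivity)

theorem continuous_regKernelDeriv {α ε : ℝ} (hα : 0 < α) (hε : 0 < ε) :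
    Continuous (regKernelDeriv α ε) := by
  have hp : Continuous fun x : Plane => blobProfile α (‖x‖ ^ 2 + ε ^ 2) := by
    rw [continuous_iff_continuousAt]
    intro x
    have hre : 0 < ‖x‖ ^ 2 + ε ^ 2 := by positivity
    exact ContinuousAt.comp (f := fun x : Plane => ‖x‖ ^ 2 + ε ^ 2)
      (hasDerivAt_blobProfile hα hre).continuousAt (by fun_prop)
  have hp' : Continuous fun x : Plane => blobProfileDeriv α (‖x‖ ^ 2 + ε ^ 2) := by
    refine (continuousOn_blobProfileDeriv hα).comp_continuous (by fun_prop) fun x => ?_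
    exact mem_Ioi.2 (by positivity)
  unfold regKernelDeriv
  refine (hp.smul continuous_const).add ?_
  have : Continuous fun x : Plane =>
      (ContinuousLinearMap.smulRightL ℝ Plane Plane
        (blobProfileDeriv α (‖x‖ ^ 2 + ε ^ 2) • (2 • innerSL ℝ x))) (rot x) := by
    fun_prop
  exact this

/-! ### Integration against signed measures -/

theorem isFiniteMeasure_variation (q : RadonMeasure) : IsFiniteMeasure q.variation := by
  rw [← SignedMeasure.totalVariation_eq_variation]; infer_instance

attribute [local instance] isFiniteMeasure_variation

/-- The total mass of a signed measure. -/
def totalMass (q : RadonMeasure) : ℝ := q.variation.real univ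

theorem totalMass_nonneg (q : RadonMeasure) : 0 ≤ totalMass q := measureReal_nonneg

variable {E : Type*} [NormedAddCommGroup E] [NormedSpace ℝ E]

theorem integrable_of_continuous_of_bound {E : Type*} [NormedAddCommGroup E]
    [SecondCountableTopology E] (q : RadonMeasure)
    {f : Plane → E} (hf : Continuous f) {C : ℝ} (hC : ∀ x, ‖f x‖ ≤ C) : q.Integrable f :=
  Integrable.of_bound hf.aestronglyMeasurable C (Eventually.of_forall hC)

theorem norm_lsmul_flip_le : ‖(ContinuousLinearMap.lsmul ℝ ℝ (E := E)).flip‖ ≤ 1 := by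
  rw [ContinuousLinearMap.opNorm_flip]
  exact ContinuousLinearMap.opNorm_lsmul_le

theorem norm_vintegral_le (q : RadonMeasure) {f : Plane → E} {C : ℝ} (hC : ∀ x, ‖f x‖ ≤ C) :
    ‖∫ᵛ x, f x ∂<•q‖ ≤ totalMass q * C := by
  have hC0 : 0 ≤ C := (norm_nonneg _).trans (hC 0)
  refine (VectorMeasure.norm_integral_le_of_norm_le_const (Eventually.of_forall hC)).trans ?_
  have h1 : ‖(ContinuousLinearMap.lsmul ℝ ℝ (E := E)).flip‖ ≤ 1 := norm_lsmul_flip_le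
  have h2 := totalMass_nonneg q
  change C * _ * totalMass q ≤ _
  calc _ ≤ C * 1 * totalMass q := by gcongr
    _ = _ := by ring

theorem posPart_le_variation (q : RadonMeasure) :
    q.toJordanDecomposition.posPart ≤ q.variation := by
  rw [← SignedMeasure.totalVariation_eq_variation]
  exact Measure.le_add_right le_rfl

theorem negPart_le_variation (q : RadonMeasure) :
    q.toJordanDecomposition.negPart ≤ q.variation := by
  rw [← SignedMeasure.totalVariation_eq_variation]
  exact Measure.le_add_left le_rfl

/-- Through the Jordan decomposition, facts about Bochner integrals pass to signed measures. -/
theorem vintegral_eq_sub (q : RadonMeasure) {f : Plane → E} (hf : q.Integrable f) :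
    ∫ᵛ x, f x ∂<•q = ∫ x, f x ∂q.toJordanDecomposition.posPart -
      ∫ x, f x ∂q.toJordanDecomposition.negPart := by
  have e : q = q.toJordanDecomposition.posPart.toSignedMeasure -
      q.toJordanDecomposition.negPart.toSignedMeasure :=
    (SignedMeasure.toSignedMeasure_toJordanDecomposition q).symm
  have h1 : (q.toJordanDecomposition.posPart.toSignedMeasure).Integrable f := by
    rw [VectorMeasure.Integrable, Measure.variation_toSignedMeasure]
    exact hf.mono_measure (posPart_le_variation q)
  have h2 : (q.toJordanDecomposition.negPart.toSignedMeasure).Integrable f := by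
    rw [VectorMeasure.Integrable, Measure.variation_toSignedMeasure]
    exact hf.mono_measure (negPart_le_variation q)
  conv_lhs => rw [e]
  rw [VectorMeasure.integral_sub_vectorMeasure h1 h2, VectorMeasure.integral_toSignedMeasure,
    VectorMeasure.integral_toSignedMeasure]

theorem vintegral_comp_clm {F : Type*} [NormedAddCommGroup F] [NormedSpace ℝ F]
    [CompleteSpace E] [CompleteSpace F] (q : RadonMeasure) (L : E →L[ℝ] F) {f : Plane → E}
    (hf : q.Integrable f) : ∫ᵛ x, L (f x) ∂<•q = L (∫ᵛ x, f x ∂<•q) := by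
  rw [vintegral_eq_sub q hf, vintegral_eq_sub q (L.integrable_comp hf),
    L.integral_comp_comm (hf.mono_measure (posPart_le_variation q)),
    L.integral_comp_comm (hf.mono_measure (negPart_le_variation q)), map_sub]

/-- The coordinate projections of the plane. -/
abbrev coord (i : Fin 2) : Plane →L[ℝ] ℝ := EuclideanSpace.proj i

theorem eq_sum_coord (v : Plane) :
    v = v 0 • EuclideanSpace.single 0 1 + v 1 • EuclideanSpace.single 1 1 := by
  ext i; fin_cases i <;> simp

theorem vintegral_plane_eq (q : RadonMeasure) {f : Plane → Plane} (hf : q.Integrable f) :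
    ∫ᵛ x, f x ∂<•q = (∫ᵛ x, f x 0 ∂<•q) • EuclideanSpace.single 0 1 +
      (∫ᵛ x, f x 1 ∂<•q) • EuclideanSpace.single 1 1 := by
  conv_lhs => rw [eq_sum_coord (∫ᵛ x, f x ∂<•q)]
  congr 2
  · exact (vintegral_comp_clm q (coord 0) hf).symm
  · exact (vintegral_comp_clm q (coord 1) hf).symm

/-- Two signed measures agree if they have the same integrals of continuous functions with
compact support. -/
theorem ext_of_vintegral_eq {p q : RadonMeasure}
    (h : ∀ f : Plane → ℝ, Continuous f → HasCompactSupport f → ∫ᵛ x, f x ∂<•p = ∫ᵛ x, f x ∂<•q) :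
    p = q := by
  -- Moving the negative parts across turns the claim into an equality of positive measures, for
  -- which compactly supported functions are separating.
  have key : p.toJordanDecomposition.posPart + q.toJordanDecomposition.negPart =
      q.toJordanDecomposition.posPart + p.toJordanDecomposition.negPart := by
    refine Measure.ext_of_integral_eq_on_compactlySupported fun f => ?_
    have hf : Continuous (f : Plane → ℝ) := f.continuous
    obtain ⟨C, hC⟩ := f.hasCompactSupport.exists_bound_of_continuous hf
    have ip := integrable_of_continuous_of_bound p hf hC
    have iq := integrable_of_continuous_of_bound q hf hC
    have := h f hf f.hasCompactSupport
    rw [vintegral_eq_sub p ip, vintegral_eq_sub q iq] at this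
    rw [integral_add_measure (ip.mono_measure (posPart_le_variation p))
      (iq.mono_measure (negPart_le_variation q)),
      integral_add_measure (iq.mono_measure (posPart_le_variation q))
      (ip.mono_measure (negPart_le_variation p))]
    linarith
  have ep : p = p.toJordanDecomposition.posPart.toSignedMeasure -
      p.toJordanDecomposition.negPart.toSignedMeasure :=
    (SignedMeasure.toSignedMeasure_toJordanDecomposition p).symm
  have eq : q = q.toJordanDecomposition.posPart.toSignedMeasure -
      q.toJordanDecomposition.negPart.toSignedMeasure :=
    (SignedMeasure.toSignedMeasure_toJordanDecomposition q).symm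
  rw [ep, eq, sub_eq_sub_iff_add_eq_add, ← Measure.toSignedMeasure_add, ← Measure.toSignedMeasure_add]
  congr 1

/-- A bound of the action of a signed measure on continuous functions that vanish at infinity. -/
def PairingBound (q : RadonMeasure) (M : ℝ) : Prop :=
  ∀ f : Plane → ℝ, Continuous f → Tendsto f (cocompact Plane) (𝓝 0) →
    ∀ C, (∀ x, |f x| ≤ C) → |∫ᵛ x, f x ∂<•q| ≤ M * C

theorem tendsto_coord {f : Plane → Plane} {l : Filter Plane} (hf : Tendsto f l (𝓝 0)) (i : Fin 2) :
    Tendsto (fun x => f x i) l (𝓝 0) := by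
  simpa [Function.comp_def] using ((coord i).continuous.tendsto 0).comp hf

theorem abs_coord_le (v : Plane) (i : Fin 2) : |v i| ≤ ‖v‖ := by
  simpa using PiLp.norm_apply_le v i

/-- The factor `2` comes from bounding the two coordinates separately. Working with dual bounds
means that the Banach–Steinhaus constant can be used directly, without identifying it with a total
variation. -/
theorem PairingBound.norm_vintegral_le {q : RadonMeasure} {M : ℝ} (h : PairingBound q M)
    {f : Plane → Plane} (hf : Continuous f) (hf0 : Tendsto f (cocompact Plane) (𝓝 0)) {C : ℝ}
    (hC : ∀ x, ‖f x‖ ≤ C) : ‖∫ᵛ x, f x ∂<•q‖ ≤ 2 * M * C := by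
  rw [vintegral_plane_eq q (integrable_of_continuous_of_bound q hf hC)]
  have h0 := h _ ((coord 0).continuous.comp hf) (tendsto_coord hf0 0) C
    fun x => (abs_coord_le _ _).trans (hC x)
  have h1 := h _ ((coord 1).continuous.comp hf) (tendsto_coord hf0 1) C
    fun x => (abs_coord_le _ _).trans (hC x)
  refine (norm_add_le _ _).trans ?_
  have e : ∀ i : Fin 2, ‖(EuclideanSpace.single i (1 : ℝ) : Plane)‖ = 1 := fun i => by simp
  rw [norm_smul, norm_smul, e, e, mul_one, mul_one, Real.norm_eq_abs, Real.norm_eq_abs]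
  calc _ ≤ M * C + M * C := add_le_add h0 h1
    _ = _ := by ring

/-- Weak-* continuity of a curve of signed measures. -/
def IsWeakStarContinuous (q : ℝ → RadonMeasure) : Prop :=
  ∀ f : C₀(Plane, ℝ), Continuous fun t => ∫ᵛ x, f x ∂<•(q t)

theorem norm_zeroAtInfty_apply_le (f : C₀(Plane, ℝ)) (x : Plane) : ‖f x‖ ≤ ‖f‖ := by
  rw [← ZeroAtInftyContinuousMap.norm_toBCF_eq_norm]
  exact f.toBCF.norm_coe_le_norm x

theorem norm_zeroAtInfty_le {f : C₀(Plane, ℝ)} {C : ℝ} (hC : ∀ x, ‖f x‖ ≤ C) : ‖f‖ ≤ C := by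
  rw [← ZeroAtInftyContinuousMap.norm_toBCF_eq_norm]
  exact (BoundedContinuousFunction.norm_le ((norm_nonneg _).trans (hC 0))).2 hC

/-- A signed measure as a functional on continuous functions that vanish at infinity. -/
def pairing (q : RadonMeasure) : C₀(Plane, ℝ) →L[ℝ] ℝ :=
  LinearMap.mkContinuous
    { toFun := fun f => ∫ᵛ x, f x ∂<•q
      map_add' := fun f g => VectorMeasure.integral_fun_add
        (integrable_of_continuous_of_bound q f.continuous (norm_zeroAtInfty_apply_le f))
        (integrable_of_continuous_of_bound q g.continuous (norm_zeroAtInfty_apply_le g))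
      map_smul' := fun c f => VectorMeasure.integral_fun_smul _ _ c f }
    (totalMass q) fun f => norm_vintegral_le q (norm_zeroAtInfty_apply_le f)

/-- By the uniform boundedness principle, a weak-* continuous curve is locally bounded. -/
theorem IsWeakStarContinuous.exists_pairingBound {q : ℝ → RadonMeasure}
    (hq : IsWeakStarContinuous q) (T : ℝ) :
    ∃ M, 0 ≤ M ∧ ∀ t ∈ Icc (-T) T, PairingBound (q t) M := by
  have hb : ∀ f : C₀(Plane, ℝ), ∃ C, ∀ t : Icc (-T) T, ‖pairing (q t) f‖ ≤ C := by
    intro f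
    obtain ⟨C, hC⟩ := (isCompact_Icc (a := -T) (b := T)).exists_bound_of_continuousOn
      (hq f).continuousOn
    exact ⟨C, fun t => hC t t.2⟩
  obtain ⟨M, hM⟩ := banach_steinhaus hb
  refine ⟨max M 0, le_max_right _ _, fun t ht f hf hf0 C hC => ?_⟩
  let g : C₀(Plane, ℝ) := ⟨⟨f, hf⟩, hf0⟩
  have h1 := (pairing (q t)).le_opNorm g
  have h2 : ‖g‖ ≤ C := norm_zeroAtInfty_le hC
  calc |∫ᵛ x, f x ∂<•(q t)| = ‖pairing (q t) g‖ := rfl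
    _ ≤ ‖pairing (q t)‖ * ‖g‖ := h1
    _ ≤ max M 0 * C := by
      gcongr
      exact (hM ⟨t, ht⟩).trans (le_max_left _ _)

/-- The difference `F x - F x₀` is uniformly small and is controlled by the local bound on the
measures; the fixed function `F x₀` is handled by weak-* continuity. -/
theorem IsWeakStarContinuous.continuousAt_vintegral {X : Type*} [TopologicalSpace X]
    {q : ℝ → RadonMeasure} (hq : IsWeakStarContinuous q) {τ : X → ℝ} {F : X → Plane → ℝ} {x₀ : X}
    (hτ : ContinuousAt τ x₀) (hF : ∀ x, Continuous (F x))
    (hF0 : ∀ x, Tendsto (F x) (cocompact Plane) (𝓝 0))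
    (hFu : ∀ ε > 0, ∀ᶠ x in 𝓝 x₀, ∀ y, |F x y - F x₀ y| ≤ ε) :
    ContinuousAt (fun x => ∫ᵛ y, F x y ∂<•(q (τ x))) x₀ := by
  obtain ⟨M, hM0, hM⟩ := hq.exists_pairingBound (|τ x₀| + 1)
  let g : X → C₀(Plane, ℝ) := fun x => ⟨⟨F x, hF x⟩, hF0 x⟩
  have hint : ∀ x t, (q t).Integrable (F x) := fun x t =>
    integrable_of_continuous_of_bound _ (hF x) (norm_zeroAtInfty_apply_le (g x))
  have h1 : Tendsto (fun x => ∫ᵛ y, F x₀ y ∂<•(q (τ x))) (𝓝 x₀)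
      (𝓝 (∫ᵛ y, F x₀ y ∂<•(q (τ x₀)))) :=
    ((hq (g x₀)).tendsto (τ x₀)).comp hτ
  have hτev : ∀ᶠ x in 𝓝 x₀, τ x ∈ Icc (-(|τ x₀| + 1)) (|τ x₀| + 1) := by
    refine hτ.eventually (Icc_mem_nhds ?_ ?_)
    · linarith [neg_abs_le (τ x₀)]
    · linarith [le_abs_self (τ x₀)]
  have h2 : Tendsto (fun x => ∫ᵛ y, F x y ∂<•(q (τ x)) - ∫ᵛ y, F x₀ y ∂<•(q (τ x))) (𝓝 x₀)
      (𝓝 0) := by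
    rw [Metric.tendsto_nhds]
    intro ε hε
    filter_upwards [hτev, hFu (ε / (M + 1)) (by positivity)] with x hx hxF
    rw [dist_zero_right, ← VectorMeasure.integral_fun_sub (hint x _) (hint x₀ _)]
    have h0 : Tendsto (fun y => F x y - F x₀ y) (cocompact Plane) (𝓝 0) := by
      simpa using (hF0 x).sub (hF0 x₀)
    refine (hM _ hx _ ((hF x).sub (hF x₀)) h0 _ hxF).trans_lt ?_
    rw [mul_div_assoc', div_lt_iff₀ (by positivity)]
    nlinarith
  have h3 := h2.add h1
  simp only [sub_add_cancel, zero_add] at h3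
  exact h3

/-! ### Velocities -/

/-- The convolution of a kernel with a signed measure. -/
def velocity (k : Plane → Plane) (q : RadonMeasure) (x : Plane) : Plane :=
  ∫ᵛ y, k (x - y) ∂<•q

theorem tendsto_sub_left_cocompact (x : Plane) :
    Tendsto (fun y => x - y) (cocompact Plane) (cocompact Plane) :=
  (Homeomorph.subLeft x).isClosedEmbedding.tendsto_cocompact

/-- Continuous kernels that vanish at infinity. -/
structure IsKernel (k : Plane → Plane) : Prop where
  continuous : Continuous k
  tendsto : Tendsto k (cocompact Plane) (𝓝 0)

namespace IsKernel

variable {k k' : Plane → Plane}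

theorem continuous_sub (h : IsKernel k) (x : Plane) : Continuous fun y => k (x - y) :=
  h.continuous.comp (by fun_prop)

theorem tendsto_sub (h : IsKernel k) (x : Plane) :
    Tendsto (fun y => k (x - y)) (cocompact Plane) (𝓝 0) :=
  h.tendsto.comp (tendsto_sub_left_cocompact x)

theorem exists_bound (h : IsKernel k) : ∃ C, ∀ x, ‖k x‖ ≤ C := by
  let g : C₀(Plane, Plane) := ⟨⟨k, h.continuous⟩, h.tendsto⟩
  exact ⟨‖g.toBCF‖, fun x => g.toBCF.norm_coe_le_norm x⟩

theorem uniformContinuous (h : IsKernel k) : UniformContinuous k := by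
  let g : C₀(Plane, Plane) := ⟨⟨k, h.continuous⟩, h.tendsto⟩
  exact ZeroAtInftyContinuousMap.uniformContinuous g

theorem integrable (h : IsKernel k) (q : RadonMeasure) (x : Plane) :
    q.Integrable fun y => k (x - y) := by
  obtain ⟨C, hC⟩ := h.exists_bound
  exact integrable_of_continuous_of_bound q (h.continuous_sub x) fun y => hC _

theorem norm_velocity_le (h : IsKernel k) {q : RadonMeasure} {M : ℝ} (hM : PairingBound q M)
    {C : ℝ} (hC : ∀ x, ‖k x‖ ≤ C) (x : Plane) : ‖velocity k q x‖ ≤ 2 * M * C :=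
  hM.norm_vintegral_le (h.continuous_sub x) (h.tendsto_sub x) fun _ => hC _

theorem norm_velocity_sub_le (h : IsKernel k) (h' : IsKernel k') {q : RadonMeasure} {M : ℝ}
    (hM : PairingBound q M) {x x' : Plane} {C : ℝ} (hC : ∀ y, ‖k (x - y) - k' (x' - y)‖ ≤ C) :
    ‖velocity k q x - velocity k' q x'‖ ≤ 2 * M * C := by
  unfold velocity
  rw [← VectorMeasure.integral_fun_sub (h.integrable q x) (h'.integrable q x')]
  refine hM.norm_vintegral_le ((h.continuous_sub x).sub (h'.continuous_sub x')) ?_ hC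
  simpa [Pi.sub_def] using (h.tendsto_sub x).sub (h'.tendsto_sub x')

/-- Decay at infinity puts the translates `k (x - ·)` in `C₀`, so weak-* continuity suffices;
uniform continuity of `k` handles the dependence on `x`. -/
theorem continuous_velocity (h : IsKernel k) {q : ℝ → RadonMeasure} (hq : IsWeakStarContinuous q) :
    Continuous (Function.uncurry fun t x => velocity k (q t) x) := by
  have key : ∀ i : Fin 2, Continuous fun p : ℝ × Plane => ∫ᵛ y, k (p.2 - y) i ∂<•(q p.1) := by
    intro i
    rw [continuous_iff_continuousAt]
    intro p₀
    refine hq.continuousAt_vintegral (τ := Prod.fst) (F := fun p y => k (p.2 - y) i)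
      continuous_fst.continuousAt (fun p => (coord i).continuous.comp (h.continuous_sub _))
      (fun p => tendsto_coord (h.tendsto_sub _) i) fun ε hε => ?_
    obtain ⟨δ, hδ, H⟩ := Metric.uniformContinuous_iff.1 h.uniformContinuous ε hε
    have hev : ∀ᶠ p : ℝ × Plane in 𝓝 p₀, dist p.2 p₀.2 < δ :=
      continuous_snd.continuousAt.eventually (Metric.ball_mem_nhds _ hδ)
    filter_upwards [hev] with p hp y
    have := @H (p.2 - y) (p₀.2 - y) (by simpa using hp)
    rw [dist_eq_norm] at this
    exact (abs_coord_le (k (p.2 - y) - k (p₀.2 - y)) i).trans this.le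
  have e : (Function.uncurry fun t x => velocity k (q t) x) = fun p : ℝ × Plane =>
      (∫ᵛ y, k (p.2 - y) 0 ∂<•(q p.1)) • EuclideanSpace.single (0 : Fin 2) (1 : ℝ) +
      (∫ᵛ y, k (p.2 - y) 1 ∂<•(q p.1)) • EuclideanSpace.single (1 : Fin 2) (1 : ℝ) :=
    funext fun p => vintegral_plane_eq _ (h.integrable _ _)
  rw [e]
  exact ((key 0).smul continuous_const).add ((key 1).smul continuous_const)

end IsKernel

/-! ### Kernel estimates -/

theorem tendsto_zero_of_norm_le_div {k : Plane → Plane} {C : ℝ}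
    (h : ∀ x, x ≠ 0 → ‖k x‖ ≤ C / ‖x‖) : Tendsto k (cocompact Plane) (𝓝 0) := by
  have h1 : Tendsto (fun x : Plane => C / ‖x‖) (cocompact Plane) (𝓝 0) :=
    (tendsto_const_nhds).div_atTop tendsto_norm_cocompact_atTop
  refine squeeze_zero_norm' ?_ h1
  have : ({0} : Set Plane)ᶜ ∈ cocompact Plane := isCompact_singleton.compl_mem_cocompact
  filter_upwards [this] with x hx using h x hx

theorem continuous_regKernel {α ε : ℝ} (hα : 0 < α) (hε : 0 < ε) : Continuous (regKernel α ε) :=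
  continuous_iff_continuousAt.2 fun x => (hasFDerivAt_regKernel hα hε x).continuousAt

theorem isKernel_regKernel {α ε : ℝ} (hα : 0 < α) (hε : 0 < ε) : IsKernel (regKernel α ε) :=
  ⟨continuous_regKernel hα hε, tendsto_zero_of_norm_le_div fun _ => norm_regKernel_le_div hα hε⟩

/-- The regularized kernels converge uniformly, so no separate analysis at the origin is needed. -/
theorem continuous_blobKernel {α : ℝ} (hα : 0 < α) : Continuous (blobKernel α) := by
  have hA := blobConst_pos hα
  refine continuous_of_uniform_approx_of_continuous fun U hU => ?_
  obtain ⟨δ, hδ, H⟩ := Metric.mem_uniformity_dist.1 hU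
  refine ⟨regKernel α (δ / (4 * blobConst α)), continuous_regKernel hα (by positivity),
    fun x => H ?_⟩
  rw [dist_comm, dist_eq_norm]
  refine (norm_regKernel_sub_blobKernel_le hα (by positivity) x).trans_lt ?_
  have : 2 * blobConst α * (δ / (4 * blobConst α)) = δ / 2 := by field_simp; norm_num
  linarith

theorem isKernel_blobKernel {α : ℝ} (hα : 0 < α) : IsKernel (blobKernel α) :=
  ⟨continuous_blobKernel hα, tendsto_zero_of_norm_le_div fun _ => norm_blobKernel_le_div hα⟩

theorem norm_regKernel_sub_le {α ε : ℝ} (hα : 0 < α) (hε : 0 < ε) (hε1 : ε ≤ 1) (x y : Plane) :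
    ‖regKernel α ε x - regKernel α ε y‖ ≤ 3 * blobConst α * (1 - Real.log ε) * ‖x - y‖ :=
  convex_univ.norm_image_sub_le_of_norm_hasFDerivWithin_le
    (fun z _ => (hasFDerivAt_regKernel hα hε z).hasFDerivWithinAt)
    (fun z _ => norm_regKernelDeriv_le hα hε hε1 z) (mem_univ y) (mem_univ x)

/-! ### The Osgood modulus -/

/-- The solution at time `c` of `B' = B (1 - log B)`, `B(0) = r`. -/
def osgoodModulus (c r : ℝ) : ℝ := Real.exp (1 - (1 - Real.log r) * Real.exp (-c))

theorem osgoodModulus_pos (c r : ℝ) : 0 < osgoodModulus c r := Real.exp_pos _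

theorem osgoodModulus_le_osgoodModulus_left {c c' r : ℝ} (hr : 0 < r) (hr1 : r ≤ 1) (hc : c ≤ c') :
    osgoodModulus c r ≤ osgoodModulus c' r := by
  have := Real.log_nonpos hr.le hr1
  unfold osgoodModulus
  gcongr
  linarith

theorem osgoodModulus_mono {c r r' : ℝ} (hr : 0 < r) (h : r ≤ r') :
    osgoodModulus c r ≤ osgoodModulus c r' := by
  unfold osgoodModulus
  gcongr

theorem tendsto_one_sub_log : Tendsto (fun r => 1 - Real.log r) (𝓝[>] 0) atTop :=
  tendsto_atTop_add_const_left _ _ (tendsto_neg_atBot_atTop.comp Real.tendsto_log_nhdsGT_zero)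

/-- With `y = 1 - log r` the product is `e · y · exp (-e^{-c} y)`. The modulus behaves like a power
of `r`, which absorbs one logarithm; both the construction of solutions and the commutator estimate
rest on this. -/
theorem tendsto_log_mul_osgoodModulus (c : ℝ) :
    Tendsto (fun r => (1 - Real.log r) * osgoodModulus c r) (𝓝[>] 0) (𝓝 0) := by
  have h0 : Tendsto (fun y : ℝ => y * Real.exp (-(Real.exp (-c) * y))) atTop (𝓝 0) := by
    have := Real.tendsto_pow_mul_exp_neg_atTop_nhds_zero 1
    have h1 := (this.comp ((tendsto_id (α := ℝ)).const_mul_atTop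
      (Real.exp_pos (-c)))).const_mul (1 / Real.exp (-c))
    simp only [mul_zero] at h1
    refine h1.congr fun y => ?_
    simp only [Function.comp, id, pow_one]
    have := (Real.exp_pos (-c)).ne'
    field_simp
  have h1 := (h0.const_mul (Real.exp 1)).comp tendsto_one_sub_log
  simp only [mul_zero] at h1
  refine h1.congr fun r => ?_
  simp only [Function.comp, osgoodModulus]
  rw [sub_eq_add_neg 1 (_ * _), Real.exp_add, mul_comm (Real.exp (-c))]
  ring

theorem tendsto_osgoodModulus (c : ℝ) : Tendsto (osgoodModulus c) (𝓝[>] 0) (𝓝 0) := by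
  refine squeeze_zero' (Eventually.of_forall fun r => (osgoodModulus_pos c r).le) ?_
    (tendsto_log_mul_osgoodModulus c)
  filter_upwards [Ioo_mem_nhdsGT (zero_lt_one' ℝ)] with r hr
  have := Real.log_nonpos hr.1.le hr.2.le
  exact le_mul_of_one_le_left (osgoodModulus_pos c r).le (by linarith)

theorem exists_osgoodModulus_le (c : ℝ) {δ : ℝ} (hδ : 0 < δ) :
    ∃ r, 0 < r ∧ r ≤ 1 ∧ osgoodModulus c r ≤ δ := by
  have h := ((tendsto_osgoodModulus c).eventually (ge_mem_nhds hδ)).and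
    (Ioo_mem_nhdsGT (zero_lt_one' ℝ))
  obtain ⟨r, hr1, hr2⟩ := h.exists
  exact ⟨r, hr2.1, hr2.2.le, hr1⟩

/-- A Grönwall inequality for logarithmic moduli of continuity. -/
theorem norm_le_osgoodModulus {f f' : ℝ → E} {a b C r : ℝ} (hC : 0 ≤ C) (hr : 0 < r)
    (hr1 : r ≤ 1) (hB : osgoodModulus ((2 * C + 1) * (b - a)) r ≤ 1)
    (hf : ∀ t ∈ Icc a b, HasDerivAt f (f' t) t) (ha : ‖f a‖ ≤ r)
    (hbd : ∀ t ∈ Icc a b, ∀ ε, r ≤ ε → ε ≤ 1 →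
      ‖f' t‖ ≤ C * ((1 - Real.log ε) * ‖f t‖ + ε)) :
    ∀ t ∈ Icc a b, ‖f t‖ ≤ osgoodModulus ((2 * C + 1) * (b - a)) r := by
  set c := 2 * C + 1 with hc
  have hc0 : 0 < c := by positivity
  have hlr : Real.log r ≤ 0 := Real.log_nonpos hr.le hr1
  have hd : ∀ t, HasDerivAt (fun t => osgoodModulus (c * (t - a)) r)
      (osgoodModulus (c * (t - a)) r * ((1 - Real.log r) * Real.exp (-(c * (t - a))) * c)) t := by
    intro t
    have h1 : HasDerivAt (fun t => -(c * (t - a))) (-(c * 1)) t :=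
      (((hasDerivAt_id t).sub_const a).const_mul c).neg
    refine (((h1.exp).const_mul (1 - Real.log r)).const_sub 1).exp.congr_deriv ?_
    unfold osgoodModulus
    ring
  have key := image_norm_le_of_norm_deriv_right_lt_deriv_boundary (f := f) (f' := f')
    (a := a) (b := b) (fun t ht => (hf t ht).continuousAt.continuousWithinAt)
    (fun t ht => (hf t ⟨ht.1, ht.2.le⟩).hasDerivWithinAt)
    (B := fun t => osgoodModulus (c * (t - a)) r) ?_ hd ?_
  · intro t ht
    refine (key ht).trans (osgoodModulus_le_osgoodModulus_left hr hr1 ?_)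
    gcongr
    exact ht.2
  · simp [osgoodModulus, Real.exp_log hr, ha]
  · intro t ht heq
    have hB1 : osgoodModulus (c * (t - a)) r ≤ 1 := by
      refine le_trans (osgoodModulus_le_osgoodModulus_left hr hr1 ?_) hB
      gcongr
      exact ht.2.le
    have hrB : r ≤ osgoodModulus (c * (t - a)) r := by
      have h0 : 0 ≤ c * (t - a) := mul_nonneg hc0.le (sub_nonneg.2 ht.1)
      have := osgoodModulus_le_osgoodModulus_left hr hr1 h0
      simpa [osgoodModulus, Real.exp_log hr] using this
    -- At a contact time, where `‖f t‖ = B`, the free parameter is taken to be `ε = B` itself. The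
    -- bound becomes at most `2C (1 - log B) B`, strictly below `B' = (2C + 1)(1 - log B) B`; the `+
    -- 1` in the exponent gives the strictness.
    have h := hbd t ⟨ht.1, ht.2.le⟩ _ hrB hB1
    rw [heq] at h
    have hlog : Real.log (osgoodModulus (c * (t - a)) r) =
        1 - (1 - Real.log r) * Real.exp (-(c * (t - a))) := by rw [osgoodModulus, Real.log_exp]
    have hlogle : Real.log (osgoodModulus (c * (t - a)) r) ≤ 0 :=
      Real.log_nonpos (osgoodModulus_pos _ _).le hB1
    have hBp := osgoodModulus_pos (c * (t - a)) r
    refine h.trans_lt ?_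
    have e : (1 - Real.log r) * Real.exp (-(c * (t - a))) =
        1 - Real.log (osgoodModulus (c * (t - a)) r) := by rw [hlog]; ring
    rw [e]
    set B := osgoodModulus (c * (t - a)) r
    set l := Real.log B
    have : C * ((1 - l) * B + B) ≤ C * (2 * (1 - l) * B) := by
      gcongr
      nlinarith
    refine this.trans_lt ?_
    have h3 : 0 < B * (1 - l) := by apply mul_pos hBp; linarith
    rw [hc]
    nlinarith

/-- Times before `t₀` are reached by applying the forward estimate to the reversed curve. -/
theorem norm_le_osgoodModulus_Icc {f f' : ℝ → E} {T t₀ C r : ℝ} (ht₀ : t₀ ∈ Icc (-T) T)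
    (hC : 0 ≤ C) (hr : 0 < r) (hr1 : r ≤ 1) (hB : osgoodModulus ((2 * C + 1) * (2 * T)) r ≤ 1)
    (hf : ∀ t ∈ Icc (-T) T, HasDerivAt f (f' t) t) (ha : ‖f t₀‖ ≤ r)
    (hbd : ∀ t ∈ Icc (-T) T, ∀ ε, r ≤ ε → ε ≤ 1 →
      ‖f' t‖ ≤ C * ((1 - Real.log ε) * ‖f t‖ + ε)) :
    ∀ t ∈ Icc (-T) T, ‖f t‖ ≤ osgoodModulus ((2 * C + 1) * (2 * T)) r := by
  intro t ht
  have hc : 0 ≤ 2 * C + 1 := by positivity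
  rcases le_total t₀ t with h | h
  · have hle : osgoodModulus ((2 * C + 1) * (t - t₀)) r ≤ osgoodModulus ((2 * C + 1) * (2 * T)) r :=
      osgoodModulus_le_osgoodModulus_left hr hr1
        (mul_le_mul_of_nonneg_left (by linarith [ht.2, ht₀.1]) hc)
    refine le_trans (norm_le_osgoodModulus hC hr hr1 (hle.trans hB)
      (fun s hs => hf s ⟨ht₀.1.trans hs.1, hs.2.trans ht.2⟩) ha
      (fun s hs => hbd s ⟨ht₀.1.trans hs.1, hs.2.trans ht.2⟩) t ⟨h, le_rfl⟩) hle
  · have hle : osgoodModulus ((2 * C + 1) * (-t - -t₀)) r ≤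
        osgoodModulus ((2 * C + 1) * (2 * T)) r :=
      osgoodModulus_le_osgoodModulus_left hr hr1
        (mul_le_mul_of_nonneg_left (by linarith [ht.1, ht₀.2]) hc)
    have hmem : ∀ s ∈ Icc (-t₀) (-t), -s ∈ Icc (-T) T := fun s hs =>
      ⟨by linarith [hs.2, ht.1], by linarith [hs.1, ht₀.2]⟩
    have key := norm_le_osgoodModulus (f := fun s => f (-s)) (f' := fun s => -f' (-s)) hC hr hr1
      (hle.trans hB)
      (fun s hs => by
        have := (hf (-s) (hmem s hs)).scomp s (hasDerivAt_neg s)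
        simpa [Function.comp_def] using this)
      (by simpa using ha)
      (fun s hs ε h1 h2 => by
        rw [norm_neg]
        exact hbd (-s) (hmem s hs) ε h1 h2) (-t) ⟨by linarith, le_rfl⟩
    rw [neg_neg] at key
    exact key.trans hle

/-! ### Log-Lipschitz vector fields -/

/-- The field `v` is log-Lipschitz, uniformly in the time interval `[-T, T]`. -/
def LogLipOn (v : ℝ → E → E) (M T : ℝ) : Prop :=
  ∀ t ∈ Icc (-T) T, ∀ x y, ∀ ε, 0 < ε → ε ≤ 1 →
    ‖v t x - v t y‖ ≤ M * ((1 - Real.log ε) * ‖x - y‖ + ε)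

/-- The exponent in the stability estimate for log-Lipschitz fields. -/
def stabilityExponent (M T : ℝ) : ℝ := (2 * (3 * M) + 1) * (2 * T)

/-- Stability of approximate solutions: each defect is at most `M r ≤ M ε`, and the field itself
contributes `M ((1 - log ε) d + ε)`. The total is at most `3M ((1 - log ε) d + ε)`, whence the `3M`
in the exponent. -/
theorem LogLipOn.norm_solution_sub_le {v : ℝ → E → E} {M T : ℝ} (h : LogLipOn v M T) (hM : 0 ≤ M)
    {x y x' y' : ℝ → E} {t₀ r : ℝ} (ht₀ : t₀ ∈ Icc (-T) T) (hr : 0 < r) (hr1 : r ≤ 1)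
    (hB : osgoodModulus (stabilityExponent M T) r ≤ 1)
    (hx : ∀ t ∈ Icc (-T) T, HasDerivAt x (x' t) t) (hy : ∀ t ∈ Icc (-T) T, HasDerivAt y (y' t) t)
    (hx' : ∀ t ∈ Icc (-T) T, ‖x' t - v t (x t)‖ ≤ M * r)
    (hy' : ∀ t ∈ Icc (-T) T, ‖y' t - v t (y t)‖ ≤ M * r) (h₀ : ‖x t₀ - y t₀‖ ≤ r) :
    ∀ t ∈ Icc (-T) T, ‖x t - y t‖ ≤ osgoodModulus (stabilityExponent M T) r := by
  refine norm_le_osgoodModulus_Icc (f := fun t => x t - y t) (f' := fun t => x' t - y' t)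
    ht₀ (by positivity) hr hr1 hB (fun t ht => (hx t ht).sub (hy t ht)) h₀ ?_
  intro t ht ε hε hε1
  have hlog := Real.log_nonpos (hr.le.trans hε) hε1
  have h1 := h t ht (x t) (y t) ε (hr.trans_le hε) hε1
  have h2 : x' t - y' t = (x' t - v t (x t)) - (y' t - v t (y t)) + (v t (x t) - v t (y t)) := by
    abel
  have h3 : ‖x' t - y' t‖ ≤ M * r + M * r + M * ((1 - Real.log ε) * ‖x t - y t‖ + ε) := by
    rw [h2]
    refine (norm_add_le _ _).trans (add_le_add ((norm_sub_le _ _).trans ?_) h1)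
    exact add_le_add (hx' t ht) (hy' t ht)
  have h4 : 0 ≤ (1 - Real.log ε) * ‖x t - y t‖ := mul_nonneg (by linarith) (norm_nonneg _)
  have h5 : M * r ≤ M * ε := by gcongr
  nlinarith [mul_nonneg hM h4]

/-- Two exact solutions have zero defect, so the stability estimate holds for every small `r`; let
`r` tend to `0`. -/
theorem LogLipOn.eq_of_eq {v : ℝ → E → E} {M T : ℝ} (h : LogLipOn v M T) (hM : 0 ≤ M)
    {x y : ℝ → E} {t₀ : ℝ} (ht₀ : t₀ ∈ Icc (-T) T)
    (hx : ∀ t ∈ Icc (-T) T, HasDerivAt x (v t (x t)) t)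
    (hy : ∀ t ∈ Icc (-T) T, HasDerivAt y (v t (y t)) t) (h₀ : x t₀ = y t₀) :
    ∀ t ∈ Icc (-T) T, x t = y t := by
  intro t ht
  rw [← sub_eq_zero, ← norm_le_zero_iff]
  have hev := (((tendsto_osgoodModulus (stabilityExponent M T)).eventually
    (ge_mem_nhds zero_lt_one)).and (Ioo_mem_nhdsGT (zero_lt_one' ℝ)))
  refine ge_of_tendsto (tendsto_osgoodModulus (stabilityExponent M T)) ?_
  filter_upwards [hev] with r hr
  refine h.norm_solution_sub_le hM ht₀ hr.2.1 hr.2.2.le hr.1 hx hy ?_ ?_ ?_ t ht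
  · intro s _; simpa using mul_nonneg hM hr.2.1.le
  · intro s _; simpa using mul_nonneg hM hr.2.1.le
  · simpa [h₀] using hr.2.1.le

/-- Continuous, locally in time bounded vector fields that are approximated up to `ε` by Lipschitz
fields with constant of order `log (1 / ε)`. -/
structure IsOsgoodField (v : ℝ → E → E) : Prop where
  continuous : Continuous (Function.uncurry v)
  approx : ∀ T, ∃ M, 0 ≤ M ∧ ∀ ε, 0 < ε → ε ≤ 1 → ∃ w : ℝ → E → E,
    Continuous (Function.uncurry w) ∧ ∀ t ∈ Icc (-T) T,
      (∀ x y, ‖w t x - w t y‖ ≤ M * (1 - Real.log ε) * ‖x - y‖) ∧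
      ∀ x, ‖w t x‖ ≤ M ∧ ‖w t x - v t x‖ ≤ M * ε

theorem exists_solution_of_lipschitz [CompleteSpace E] {w : ℝ → E → E} {T t₀ M L : ℝ} (hM : 0 ≤ M)
    (hL : 0 ≤ L) (hw : Continuous (Function.uncurry w))
    (hwL : ∀ t ∈ Icc (-T) T, ∀ x y, ‖w t x - w t y‖ ≤ L * ‖x - y‖)
    (hwM : ∀ t ∈ Icc (-T) T, ∀ x, ‖w t x‖ ≤ M) (ht₀ : t₀ ∈ Icc (-T) T) (x₀ : E) :
    ∃ x : ℝ → E, x t₀ = x₀ ∧ ∀ t ∈ Ioo (-T) T, HasDerivAt x (w t (x t)) t := by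
  have hT : 0 ≤ T := by linarith [ht₀.1, ht₀.2]
  let τ : Icc (-T) T := ⟨t₀, ht₀⟩
  -- The global bound `M` keeps solutions within distance `2TM` of the starting point, so a ball of
  -- that radius serves for the whole interval.
  have hPL : IsPicardLindelof w τ x₀ (⟨M, hM⟩ * ⟨2 * T, by positivity⟩) 0 ⟨M, hM⟩ ⟨L, hL⟩ := by
    refine ⟨fun t ht => ?_, fun x _ => ?_, fun t ht x _ => hwM t ht x, ?_⟩
    · exact (LipschitzWith.of_dist_le_mul fun x y => by
        rw [dist_eq_norm, dist_eq_norm]; exact hwL t ht x y).lipschitzOnWith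
    · exact (hw.comp (continuous_id.prodMk continuous_const)).continuousOn
    · change M * max (T - t₀) (t₀ - -T) ≤ M * (2 * T) - 0
      rw [sub_zero]
      gcongr
      exact max_le (by linarith [ht₀.1]) (by linarith [ht₀.2])
  obtain ⟨x, hx0, hx⟩ := hPL.exists_eq_forall_mem_Icc_hasDerivWithinAt₀
  exact ⟨x, hx0, fun t ht => (hx t ⟨ht.1.le, ht.2.le⟩).hasDerivAt (Icc_mem_nhds ht.1 ht.2)⟩

namespace IsOsgoodField

variable {v : ℝ → E → E}

theorem exists_logLipOn {E : Type*} [NormedAddCommGroup E] {v : ℝ → E → E}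
    (hv : IsOsgoodField v) (T : ℝ) :
    ∃ M, 0 ≤ M ∧ LogLipOn v M T ∧ ∀ t ∈ Icc (-T) T, ∀ x, ‖v t x‖ ≤ M := by
  obtain ⟨M, hM, H⟩ := hv.approx T
  refine ⟨2 * M, by positivity, fun t ht x y ε hε hε1 => ?_, fun t ht x => ?_⟩
  · obtain ⟨w, -, hw⟩ := H ε hε hε1
    obtain ⟨h1, h2⟩ := hw t ht
    have hlog := Real.log_nonpos hε.le hε1
    have e : v t x - v t y = (w t x - w t y) - (w t x - v t x) + (w t y - v t y) := by abel
    rw [e]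
    have h3 : 0 ≤ M * ((1 - Real.log ε) * ‖x - y‖) :=
      mul_nonneg hM (mul_nonneg (by linarith) (norm_nonneg _))
    refine (norm_add_le _ _).trans ((add_le_add (norm_sub_le _ _) le_rfl).trans ?_)
    have := h1 x y
    have := (h2 x).2
    have := (h2 y).2
    nlinarith
  · obtain ⟨w, -, hw⟩ := H 1 one_pos le_rfl
    obtain ⟨h1, h2⟩ := (hw t ht).2 x
    have e : v t x = w t x - (w t x - v t x) := by abel
    rw [e]
    refine (norm_sub_le _ _).trans ?_
    linarith

/-- Solutions for the Lipschitz approximations are Cauchy by the stability estimate, and their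
derivatives converge uniformly as well. No compactness enters, so the result holds in infinite
dimension. -/
theorem exists_solution_on [CompleteSpace E] (hv : IsOsgoodField v) {T t₀ : ℝ}
    (ht₀ : t₀ ∈ Icc (-T) T) (x₀ : E) :
    ∃ x : ℝ → E, x t₀ = x₀ ∧ ∀ t ∈ Ioo (-T) T, HasDerivAt x (v t (x t)) t := by
  have hsub : ∀ t ∈ Icc (-T) T, t ∈ Ioo (-(T + 1)) (T + 1) := fun t ht =>
    ⟨by linarith [ht.1], by linarith [ht.2]⟩
  obtain ⟨M₁, hM₁, hlog, -⟩ := hv.exists_logLipOn T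
  obtain ⟨M₂, hM₂, H⟩ := hv.approx (T + 1)
  obtain ⟨M, hM1, hM2⟩ : ∃ M, M₁ ≤ M ∧ M₂ ≤ M := ⟨max M₁ M₂, le_max_left _ _, le_max_right _ _⟩
  have hM : 0 ≤ M := hM₁.trans hM1
  have hlogM : LogLipOn v M T := fun t ht x y ε hε hε1 => by
    have hl := Real.log_nonpos hε.le hε1
    refine (hlog t ht x y ε hε hε1).trans ?_
    gcongr
    have : 0 ≤ (1 - Real.log ε) * ‖x - y‖ := mul_nonneg (by linarith) (norm_nonneg _)
    linarith
  set c := stabilityExponent M T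
  obtain ⟨r₀, hr₀, hr₀1, hB₀⟩ := exists_osgoodModulus_le c (zero_lt_one' ℝ)
  let r : ℕ → ℝ := fun n => r₀ / (n + 1)
  have hrpos : ∀ n, 0 < r n := fun n => by positivity
  have hrle : ∀ n, r n ≤ r₀ := fun n => div_le_self hr₀.le (by
    have : (0 : ℝ) ≤ n := n.cast_nonneg
    linarith)
  have hr1 : ∀ n, r n ≤ 1 := fun n => (hrle n).trans hr₀1
  have hranti : ∀ n m, n ≤ m → r m ≤ r n := fun n m h => by
    have : (n : ℝ) ≤ m := Nat.cast_le.2 h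
    change r₀ / (m + 1) ≤ r₀ / (n + 1)
    gcongr
  have hrB : ∀ n, osgoodModulus c (r n) ≤ 1 := fun n =>
    (osgoodModulus_mono (hrpos n) (hrle n)).trans hB₀
  have hr0 : Tendsto r atTop (𝓝[>] 0) := by
    rw [tendsto_nhdsWithin_iff]
    refine ⟨?_, Eventually.of_forall hrpos⟩
    have := (tendsto_one_div_add_atTop_nhds_zero_nat (𝕜 := ℝ)).const_mul r₀
    simp only [mul_zero, mul_one_div] at this
    exact this
  choose w hwc hw using fun n => H (r n) (hrpos n) (hr1 n)
  -- The approximate equations are solved on a larger interval so that two-sided derivatives exist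
  -- at the endpoints `±T`.
  have hexist : ∀ n, ∃ x : ℝ → E, x t₀ = x₀ ∧
      ∀ t ∈ Ioo (-(T + 1)) (T + 1), HasDerivAt x (w n t (x t)) t := fun n =>
    exists_solution_of_lipschitz (L := M₂ * (1 - Real.log (r n))) hM₂
      (mul_nonneg hM₂ (by linarith [Real.log_nonpos (hrpos n).le (hr1 n)])) (hwc n)
      (fun t ht => (hw n t ht).1) (fun t ht x => ((hw n t ht).2 x).1)
      ⟨(hsub t₀ ht₀).1.le, (hsub t₀ ht₀).2.le⟩ x₀
  choose x hx0 hx using hexist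
  have herr : ∀ n, ∀ t ∈ Icc (-T) T, ‖w n t (x n t) - v t (x n t)‖ ≤ M * r n := fun n t ht => by
    refine (((hw n t ⟨(hsub t ht).1.le, (hsub t ht).2.le⟩).2 (x n t)).2).trans ?_
    exact mul_le_mul_of_nonneg_right hM2 (hrpos n).le
  have hcauchy : ∀ N n m, N ≤ n → N ≤ m → ∀ t ∈ Icc (-T) T,
      ‖x n t - x m t‖ ≤ osgoodModulus c (r N) := by
    intro N n m hn hm
    refine hlogM.norm_solution_sub_le hM ht₀ (hrpos N) (hr1 N) (hrB N) (fun t ht => hx n t (hsub t ht))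
      (fun t ht => hx m t (hsub t ht)) (fun t ht => (herr n t ht).trans ?_)
      (fun t ht => (herr m t ht).trans ?_) (by simp [hx0, (hrpos N).le])
    · exact mul_le_mul_of_nonneg_left (hranti _ _ hn) hM
    · exact mul_le_mul_of_nonneg_left (hranti _ _ hm) hM
  have hlim : ∀ t ∈ Icc (-T) T, ∃ y, Tendsto (fun n => x n t) atTop (𝓝 y) := by
    intro t ht
    refine cauchySeq_tendsto_of_complete (cauchySeq_of_le_tendsto_0
      (fun N => osgoodModulus c (r N)) (fun n m N hn hm => ?_)
      ((tendsto_osgoodModulus c).comp hr0))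
    rw [dist_eq_norm]
    exact hcauchy N n m hn hm t ht
  classical
  let y : ℝ → E := fun t => if ht : t ∈ Icc (-T) T then (hlim t ht).choose else 0
  have hy : ∀ t ∈ Icc (-T) T, Tendsto (fun n => x n t) atTop (𝓝 (y t)) := fun t ht => by
    simp only [y, dif_pos ht]
    exact (hlim t ht).choose_spec
  have hbound : ∀ n, ∀ t ∈ Icc (-T) T, ‖x n t - y t‖ ≤ osgoodModulus c (r n) := fun n t ht => by
    refine le_of_tendsto ((tendsto_const_nhds.sub (hy t ht)).norm) ?_
    filter_upwards [eventually_ge_atTop n] with m hm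
    exact hcauchy n n m le_rfl hm t ht
  refine ⟨y, ?_, fun t ht => ?_⟩
  · refine tendsto_nhds_unique (hy t₀ ht₀) ?_
    simp [hx0]
  · refine hasDerivAt_of_tendstoUniformlyOn (f := x) (f' := fun n t => w n t (x n t))
      (g' := fun t => v t (y t)) (l := atTop) isOpen_Ioo ?_ ?_ ?_ ht
    · rw [Metric.tendstoUniformlyOn_iff]
      intro δ hδ
      -- The derivative error consists of the distance between the fields, `M r`, and the
      -- log-Lipschitz modulus evaluated at distance `osgoodModulus c r`; the latter vanishes
      -- because the modulus beats the logarithm.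
      have hb : Tendsto (fun n => M * r n + M * ((1 - Real.log (r n)) * osgoodModulus c (r n) +
          r n)) atTop (𝓝 0) := by
        have h1 : Tendsto r atTop (𝓝 0) := hr0.mono_right nhdsWithin_le_nhds
        have h2 := (tendsto_log_mul_osgoodModulus c).comp hr0
        simpa using (h1.const_mul M).add ((h2.add h1).const_mul M)
      filter_upwards [hb.eventually (gt_mem_nhds hδ)] with n hn s hs
      have hs' : s ∈ Icc (-T) T := ⟨hs.1.le, hs.2.le⟩
      refine lt_of_le_of_lt ?_ hn
      rw [dist_comm, dist_eq_norm]
      have e : w n s (x n s) - v s (y s) =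
        (w n s (x n s) - v s (x n s)) + (v s (x n s) - v s (y s)) := by abel
      rw [e]
      refine (norm_add_le _ _).trans (add_le_add (herr n s hs') ?_)
      refine (hlogM s hs' _ _ (r n) (hrpos n) (hr1 n)).trans ?_
      gcongr
      · linarith [Real.log_nonpos (hrpos n).le (hr1 n)]
      · exact hbound n s hs'
    · exact Eventually.of_forall fun n s hs => hx n s (hsub s ⟨hs.1.le, hs.2.le⟩)
    · exact fun s hs => hy s ⟨hs.1.le, hs.2.le⟩

theorem eq_of_eq (hv : IsOsgoodField v) {x y : ℝ → E} {T t₀ : ℝ}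
    (ht₀ : t₀ ∈ Ioo (-T) T) (hx : ∀ t ∈ Ioo (-T) T, HasDerivAt x (v t (x t)) t)
    (hy : ∀ t ∈ Ioo (-T) T, HasDerivAt y (v t (y t)) t) (h₀ : x t₀ = y t₀) :
    ∀ t ∈ Ioo (-T) T, x t = y t := by
  intro t ht
  obtain ⟨M, hM, hlog, -⟩ := hv.exists_logLipOn (max |t₀| |t|)
  have hsub : ∀ s ∈ Icc (-(max |t₀| |t|)) (max |t₀| |t|), s ∈ Ioo (-T) T := by
    intro s hs
    have : max |t₀| |t| < T := max_lt (abs_lt.2 ht₀) (abs_lt.2 ht)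
    exact ⟨by linarith [hs.1], by linarith [hs.2]⟩
  exact hlog.eq_of_eq hM (abs_le.1 (le_max_left _ _)) (fun s hs => hx s (hsub s hs))
    (fun s hs => hy s (hsub s hs)) h₀ t (abs_le.1 (le_max_right _ _))

/-- Solutions on symmetric intervals agree where both are defined, so the value at `t` may be read
off from the interval of half-length `|t₀| + |t| + 1`. -/
theorem exists_solution [CompleteSpace E] (hv : IsOsgoodField v) (t₀ : ℝ) (x₀ : E) :
    ∃ x : ℝ → E, x t₀ = x₀ ∧ ∀ t, HasDerivAt x (v t (x t)) t := by
  have hmem : ∀ s S : ℝ, |s| < S → s ∈ Ioo (-S) S := fun s S h => abs_lt.1 h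
  choose X hX0 hX using fun S : {S : ℝ // |t₀| < S} =>
    hv.exists_solution_on (T := S.1) (t₀ := t₀) (abs_le.1 S.2.le) x₀
  let S : ℝ → {S : ℝ // |t₀| < S} := fun t => ⟨|t₀| + |t| + 1, by linarith [abs_nonneg t]⟩
  have hcomp : ∀ (A B : {S : ℝ // |t₀| < S}) (s : ℝ), |s| < A.1 → |s| < B.1 → X A s = X B s := by
    intro A B s hA hB
    refine hv.eq_of_eq (T := min A.1 B.1) (t₀ := t₀) (hmem _ _ (lt_min A.2 B.2))
      (fun t ht => hX A t (hmem _ _ ((abs_lt.2 ht).trans_le (min_le_left _ _))))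
      (fun t ht => hX B t (hmem _ _ ((abs_lt.2 ht).trans_le (min_le_right _ _))))
      ((hX0 A).trans (hX0 B).symm) s (hmem _ _ (lt_min hA hB))
  have hS : ∀ t, |t| < (S t).1 := fun t => by
    change |t| < |t₀| + |t| + 1
    linarith [abs_nonneg t₀]
  refine ⟨fun t => X (S t) t, hX0 _, fun t => ?_⟩
  refine (hX (S t) t (hmem _ _ (hS t))).congr_of_eventuallyEq ?_
  have : ∀ᶠ s in 𝓝 t, |s| < (S t).1 := continuous_abs.continuousAt.eventually (gt_mem_nhds (hS t))
  filter_upwards [this] with s hs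
  exact hcomp _ _ s (hS s) hs

theorem unique (hv : IsOsgoodField v) {x y : ℝ → E} {t₀ : ℝ}
    (hx : ∀ t, HasDerivAt x (v t (x t)) t) (hy : ∀ t, HasDerivAt y (v t (y t)) t)
    (h₀ : x t₀ = y t₀) (t : ℝ) : x t = y t := by
  refine hv.eq_of_eq (T := max |t₀| |t| + 1) (t₀ := t₀) ?_ (fun s _ => hx s) (fun s _ => hy s) h₀ t ?_
  · exact abs_lt.1 (by linarith [le_max_left |t₀| |t|])
  · exact abs_lt.1 (by linarith [le_max_right |t₀| |t|])

theorem of_lipschitz {E : Type*} [NormedAddCommGroup E] {w : ℝ → E → E}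
    (hw : Continuous (Function.uncurry w)) (h : ∀ T, ∃ M, 0 ≤ M ∧ ∀ t ∈ Icc (-T) T,
      (∀ x y, ‖w t x - w t y‖ ≤ M * ‖x - y‖) ∧ ∀ x, ‖w t x‖ ≤ M) : IsOsgoodField w := by
  refine ⟨hw, fun T => ?_⟩
  obtain ⟨M, hM, H⟩ := h T
  refine ⟨M, hM, fun ε hε hε1 => ⟨w, hw, fun t ht => ⟨fun x y => ?_, fun x => ⟨(H t ht).2 x, ?_⟩⟩⟩⟩
  · refine ((H t ht).1 x y).trans ?_
    have hl := Real.log_nonpos hε.le hε1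
    gcongr
    exact le_mul_of_one_le_right hM (by linarith)
  · simpa using mul_nonneg hM hε.le

/-! ### The flow of an Osgood field -/

/-- The flow of `v` from time `s` to time `t`. -/
def flow [CompleteSpace E] (hv : IsOsgoodField v) (s t : ℝ) (x : E) : E :=
  (hv.exists_solution s x).choose t

variable [CompleteSpace E]

@[simp] theorem flow_self (hv : IsOsgoodField v) (s : ℝ) (x : E) : hv.flow s s x = x :=
  (hv.exists_solution s x).choose_spec.1

theorem hasDerivAt_flow (hv : IsOsgoodField v) (s t : ℝ) (x : E) :
    HasDerivAt (fun τ => hv.flow s τ x) (v t (hv.flow s t x)) t :=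
  (hv.exists_solution s x).choose_spec.2 t

theorem flow_eq (hv : IsOsgoodField v) {y : ℝ → E} (hy : ∀ t, HasDerivAt y (v t (y t)) t)
    (s t : ℝ) : hv.flow s t (y s) = y t :=
  hv.unique (fun t => hv.hasDerivAt_flow s t (y s)) hy (hv.flow_self s (y s)) t

@[simp] theorem flow_flow (hv : IsOsgoodField v) (r s t : ℝ) (x : E) :
    hv.flow s t (hv.flow r s x) = hv.flow r t x :=
  hv.flow_eq (fun t => hv.hasDerivAt_flow r t x) s t

theorem norm_flow_sub_flow_le (hv : IsOsgoodField v) {M T : ℝ}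
    (hM : ∀ t ∈ Icc (-T) T, ∀ x, ‖v t x‖ ≤ M) (r : ℝ) {s t : ℝ} (hs : s ∈ Icc (-T) T)
    (ht : t ∈ Icc (-T) T) (x : E) : ‖hv.flow r t x - hv.flow r s x‖ ≤ M * |t - s| := by
  have := (convex_Icc (-T) T).norm_image_sub_le_of_norm_hasDerivWithin_le
    (f := fun τ => hv.flow r τ x) (f' := fun τ => v τ (hv.flow r τ x)) (C := M)
    (fun τ _ => (hv.hasDerivAt_flow r τ x).hasDerivWithinAt) (fun τ hτ => hM τ hτ _) hs ht
  simpa using this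

theorem norm_flow_sub_le (hv : IsOsgoodField v) {M T : ℝ}
    (hM : ∀ t ∈ Icc (-T) T, ∀ x, ‖v t x‖ ≤ M) {s t : ℝ} (hs : s ∈ Icc (-T) T)
    (ht : t ∈ Icc (-T) T) (x : E) : ‖hv.flow s t x - x‖ ≤ M * |t - s| := by
  simpa using hv.norm_flow_sub_flow_le hM s hs ht x

theorem norm_flow_sub_flow_le_osgoodModulus (hv : IsOsgoodField v) {M T : ℝ} (hM : 0 ≤ M)
    (hlog : LogLipOn v M T) {s t r : ℝ} (hs : s ∈ Icc (-T) T) (ht : t ∈ Icc (-T) T) (hr : 0 < r)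
    (hr1 : r ≤ 1) (hB : osgoodModulus (stabilityExponent M T) r ≤ 1) {x y : E}
    (hxy : ‖x - y‖ ≤ r) :
    ‖hv.flow s t x - hv.flow s t y‖ ≤ osgoodModulus (stabilityExponent M T) r := by
  refine hlog.norm_solution_sub_le hM hs hr hr1 hB (fun t _ => hv.hasDerivAt_flow s t x)
    (fun t _ => hv.hasDerivAt_flow s t y) ?_ ?_ (by simpa using hxy) t ht
  · intro s _; simpa using mul_nonneg hM hr.le
  · intro s _; simpa using mul_nonneg hM hr.le

theorem continuous_flow (hv : IsOsgoodField v) (s : ℝ) :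
    Continuous (Function.uncurry (hv.flow s)) := by
  rw [continuous_iff_continuousAt]
  rintro ⟨t₀, x₀⟩
  obtain ⟨M, hM, hlog, hb⟩ := hv.exists_logLipOn (max |s| (|t₀| + 1))
  set T := max |s| (|t₀| + 1)
  have hs : s ∈ Icc (-T) T := abs_le.1 (le_max_left _ _)
  rw [ContinuousAt, Metric.tendsto_nhds]
  intro δ hδ
  obtain ⟨r, hr, hr1, hB⟩ := exists_osgoodModulus_le (stabilityExponent M T)
    (lt_min (half_pos hδ) one_pos)
  have e1 : ∀ᶠ p : ℝ × E in 𝓝 (t₀, x₀), ‖p.2 - x₀‖ < r := by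
    have : Continuous fun p : ℝ × E => ‖p.2 - x₀‖ := by fun_prop
    exact this.continuousAt.eventually (gt_mem_nhds (by simpa using hr))
  have e2 : ∀ᶠ p : ℝ × E in 𝓝 (t₀, x₀), |p.1| < |t₀| + 1 := by
    have : Continuous fun p : ℝ × E => |p.1| := by fun_prop
    exact this.continuousAt.eventually (gt_mem_nhds (by simp))
  have e3 : ∀ᶠ p : ℝ × E in 𝓝 (t₀, x₀), dist (hv.flow s p.1 x₀) (hv.flow s t₀ x₀) < δ / 2 := by
    have h : ContinuousAt (fun p : ℝ × E => hv.flow s p.1 x₀) (t₀, x₀) :=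
      ContinuousAt.comp (f := Prod.fst) (x := ((t₀, x₀) : ℝ × E))
        (hv.hasDerivAt_flow s t₀ x₀).continuousAt continuousAt_fst
    exact h (Metric.ball_mem_nhds _ (half_pos hδ))
  filter_upwards [e1, e2, e3] with p h1 h2 h3
  have hp : p.1 ∈ Icc (-T) T := abs_le.1 (h2.le.trans (le_max_right _ _))
  have h4 := hv.norm_flow_sub_flow_le_osgoodModulus hM hlog hs hp hr hr1
    (hB.trans (min_le_right _ _)) h1.le
  rw [← dist_eq_norm] at h4
  have h5 := hB.trans (min_le_left _ _)
  calc dist (hv.flow s p.1 p.2) (hv.flow s t₀ x₀) ≤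
      dist (hv.flow s p.1 p.2) (hv.flow s p.1 x₀) + dist (hv.flow s p.1 x₀) (hv.flow s t₀ x₀) :=
        dist_triangle _ _ _
    _ < δ := by linarith

theorem continuous_flow_right (hv : IsOsgoodField v) (s t : ℝ) : Continuous (hv.flow s t) :=
  (hv.continuous_flow s).comp (continuous_const.prodMk continuous_id)

/-- The flow as a homeomorphism. -/
def flowHomeo (hv : IsOsgoodField v) (s t : ℝ) : E ≃ₜ E where
  toFun := hv.flow s t
  invFun := hv.flow t s
  left_inv x := by simp
  right_inv x := by simp
  continuous_toFun := hv.continuous_flow_right s t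
  continuous_invFun := hv.continuous_flow_right t s

end IsOsgoodField

/-! ### The velocity fields -/

/-- The approximating fields are the convolutions with `regKernel`. The constant `6` is the kernel's
Lipschitz factor `3` times the factor `2` of the coordinatewise pairing bound. -/
theorem isOsgoodField_velocity {α : ℝ} (hα : 0 < α) {q : ℝ → RadonMeasure}
    (hq : IsWeakStarContinuous q) : IsOsgoodField fun t x => velocity (blobKernel α) (q t) x := by
  have hA := blobConst_pos hα
  have hk := isKernel_blobKernel hα
  refine ⟨hk.continuous_velocity hq, fun T => ?_⟩
  obtain ⟨M, hM, hqM⟩ := hq.exists_pairingBound T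
  refine ⟨6 * M * blobConst α, by positivity, fun ε hε hε1 =>
    ⟨fun t x => velocity (regKernel α ε) (q t) x, (isKernel_regKernel hα hε).continuous_velocity hq,
      fun t ht => ⟨fun x y => ?_, fun x => ⟨?_, ?_⟩⟩⟩⟩
  · refine ((isKernel_regKernel hα hε).norm_velocity_sub_le (isKernel_regKernel hα hε) (hqM t ht)
      (C := 3 * blobConst α * (1 - Real.log ε) * ‖x - y‖) fun z => ?_).trans_eq (by ring)
    simpa using norm_regKernel_sub_le hα hε hε1 (x - z) (y - z)
  · refine ((isKernel_regKernel hα hε).norm_velocity_le (hqM t ht)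
      (norm_regKernel_le hα hε) x).trans ?_
    have : 0 ≤ M * blobConst α := by positivity
    linarith
  · refine ((isKernel_regKernel hα hε).norm_velocity_sub_le hk (hqM t ht)
      (C := 2 * blobConst α * ε) fun z => norm_regKernel_sub_blobKernel_le hα hε _).trans ?_
    have : 0 ≤ M * blobConst α * ε := by positivity
    linarith

theorem exists_lipschitz_regVelocity {α ε : ℝ} (hα : 0 < α) (hε : 0 < ε) (hε1 : ε ≤ 1)
    {q : ℝ → RadonMeasure} (hq : IsWeakStarContinuous q) (T : ℝ) :
    ∃ M, 0 ≤ M ∧ ∀ t ∈ Icc (-T) T,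
      (∀ x y, ‖velocity (regKernel α ε) (q t) x - velocity (regKernel α ε) (q t) y‖ ≤
        M * ‖x - y‖) ∧ ∀ x, ‖velocity (regKernel α ε) (q t) x‖ ≤ M := by
  have hA := blobConst_pos hα
  obtain ⟨M, hM, hqM⟩ := hq.exists_pairingBound T
  have hlog := Real.log_nonpos hε.le hε1
  have hl : 1 ≤ 1 - Real.log ε := by linarith
  have hMA : 0 ≤ M * blobConst α := by positivity
  refine ⟨6 * M * blobConst α * (1 - Real.log ε), by positivity, fun t ht => ⟨fun x y => ?_,
    fun x => ?_⟩⟩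
  · refine ((isKernel_regKernel hα hε).norm_velocity_sub_le (isKernel_regKernel hα hε) (hqM t ht)
      (C := 3 * blobConst α * (1 - Real.log ε) * ‖x - y‖) fun z => ?_).trans_eq (by ring)
    simpa using norm_regKernel_sub_le hα hε hε1 (x - z) (y - z)
  · refine ((isKernel_regKernel hα hε).norm_velocity_le (hqM t ht)
      (norm_regKernel_le hα hε) x).trans ?_
    nlinarith

theorem isOsgoodField_regVelocity {α ε : ℝ} (hα : 0 < α) (hε : 0 < ε) (hε1 : ε ≤ 1)
    {q : ℝ → RadonMeasure} (hq : IsWeakStarContinuous q) :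
    IsOsgoodField fun t x => velocity (regKernel α ε) (q t) x :=
  IsOsgoodField.of_lipschitz ((isKernel_regKernel hα hε).continuous_velocity hq)
    (exists_lipschitz_regVelocity hα hε hε1 hq)

/-- The trace of a linear map of the plane. -/
def planeTrace : (Plane →L[ℝ] Plane) →L[ℝ] ℝ :=
  (coord 0).comp (ContinuousLinearMap.apply ℝ Plane (EuclideanSpace.single 0 1)) +
    (coord 1).comp (ContinuousLinearMap.apply ℝ Plane (EuclideanSpace.single 1 1))

theorem planeTrace_apply (A : Plane →L[ℝ] Plane) :
    planeTrace A = A (EuclideanSpace.single 0 1) 0 + A (EuclideanSpace.single 1 1) 1 := rfl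

theorem hasFDerivAt_integral_regKernel {α ε : ℝ} (hα : 0 < α) (hε : 0 < ε) (hε1 : ε ≤ 1)
    (μ : Measure Plane) [IsFiniteMeasure μ] (x : Plane) :
    HasFDerivAt (fun x => ∫ y, regKernel α ε (x - y) ∂μ) (∫ y, regKernelDeriv α ε (x - y) ∂μ) x := by
  have hc := continuous_regKernel hα hε
  have hc' := continuous_regKernelDeriv hα hε
  refine hasFDerivAt_integral_of_dominated_of_fderiv_le (s := univ)
    (F' := fun z y => regKernelDeriv α ε (z - y))
    (bound := fun _ => 3 * blobConst α * (1 - Real.log ε)) univ_mem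
    (Eventually.of_forall fun z => (hc.comp (by fun_prop)).aestronglyMeasurable) ?_
    (hc'.comp (by fun_prop)).aestronglyMeasurable
    (Eventually.of_forall fun y z _ => norm_regKernelDeriv_le hα hε hε1 _)
    (integrable_const _) (Eventually.of_forall fun y z _ => ?_)
  · exact Integrable.of_bound (hc.comp (by fun_prop)).aestronglyMeasurable (blobConst α)
      (Eventually.of_forall fun y => norm_regKernel_le hα hε _)
  · exact (hasFDerivAt_comp_sub y).2 (hasFDerivAt_regKernel hα hε (z - y))

/-- Differentiation passes under the integral, and the trace, being linear and continuous, does too.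
-/
theorem exists_hasFDerivAt_regVelocity {α ε : ℝ} (hα : 0 < α) (hε : 0 < ε) (hε1 : ε ≤ 1)
    (q : RadonMeasure) (x : Plane) :
    ∃ D : Plane →L[ℝ] Plane, HasFDerivAt (velocity (regKernel α ε) q) D x ∧ planeTrace D = 0 := by
  have hc' := continuous_regKernelDeriv hα hε
  refine ⟨∫ᵛ y, regKernelDeriv α ε (x - y) ∂<•q, ?_, ?_⟩
  · have hi : q.Integrable fun y => regKernelDeriv α ε (x - y) :=
      integrable_of_continuous_of_bound q (hc'.comp (by fun_prop))
        fun y => norm_regKernelDeriv_le hα hε hε1 _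
    rw [vintegral_eq_sub q hi]
    have e : velocity (regKernel α ε) q = fun x =>
        ∫ y, regKernel α ε (x - y) ∂q.toJordanDecomposition.posPart -
        ∫ y, regKernel α ε (x - y) ∂q.toJordanDecomposition.negPart :=
      funext fun x => vintegral_eq_sub q ((isKernel_regKernel hα hε).integrable q x)
    rw [e]
    exact (hasFDerivAt_integral_regKernel hα hε hε1 _ x).sub
      (hasFDerivAt_integral_regKernel hα hε hε1 _ x)
  · rw [← vintegral_comp_clm]
    · simp only [planeTrace_apply, regKernelDeriv_trace]
      exact VectorMeasure.integral_zero
    · exact integrable_of_continuous_of_bound q (hc'.comp (by fun_prop))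
        fun y => norm_regKernelDeriv_le hα hε hε1 _

/-! ### Volume preservation -/

theorem det_eq (A : Plane →L[ℝ] Plane) :
    A.det = A (EuclideanSpace.single 0 1) 0 * A (EuclideanSpace.single 1 1) 1 -
      A (EuclideanSpace.single 1 1) 0 * A (EuclideanSpace.single 0 1) 1 := by
  rw [ContinuousLinearMap.det,
    ← LinearMap.det_toMatrix (EuclideanSpace.basisFun (Fin 2) ℝ).toBasis, Matrix.det_fin_two]
  simp [LinearMap.toMatrix_apply]

/-- In the plane `det (1 + hA) = 1 + h tr A + h² det A`; the linear term drops out. -/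
theorem det_id_add_smul {A : Plane →L[ℝ] Plane} (hA : planeTrace A = 0) (h : ℝ) :
    (ContinuousLinearMap.id ℝ Plane + h • A).det = 1 + h ^ 2 * A.det := by
  rw [planeTrace_apply] at hA
  rw [det_eq, det_eq]
  simp
  linear_combination h * hA

theorem abs_det_le {A : Plane →L[ℝ] Plane} {L : ℝ} (hA : ‖A‖ ≤ L) : |A.det| ≤ 2 * L ^ 2 := by
  have hL : 0 ≤ L := (norm_nonneg _).trans hA
  have h : ∀ i j : Fin 2, |A (EuclideanSpace.single i 1) j| ≤ L := fun i j => by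
    refine (abs_coord_le _ _).trans ((A.le_opNorm _).trans ?_)
    simpa using hA
  rw [det_eq]
  refine (abs_sub _ _).trans ?_
  rw [abs_mul, abs_mul]
  nlinarith [mul_le_mul (h 0 0) (h 1 1) (abs_nonneg _) hL,
    mul_le_mul (h 1 0) (h 0 1) (abs_nonneg _) hL]

/-- One explicit Euler step along a trace-free field has Jacobian `1 + O(h²)`, so by change of
variables it alters integrals only to second order. -/
theorem abs_integral_comp_id_add_smul_sub_le {f : Plane → Plane} {D : Plane → Plane →L[ℝ] Plane}
    {h L C R : ℝ} (hL : 0 ≤ L) (hh : |h| * L ≤ 1 / 2) (hf : ∀ x, HasFDerivAt f (D x) x)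
    (hfL : ∀ x y, ‖f x - f y‖ ≤ L * ‖x - y‖) (hD : ∀ x, planeTrace (D x) = 0)
    {ψ : Plane → ℝ} (hψ : Continuous ψ) (hC : ∀ x, |ψ x| ≤ C)
    (hR : ∀ x, ψ (x + h • f x) ≠ 0 → ‖x‖ ≤ R) :
    |(∫ x, ψ (x + h • f x)) - ∫ x, ψ x| ≤
      h ^ 2 * (2 * L ^ 2 * C * volume.real (Metric.closedBall (0 : Plane) R)) := by
  have hDn : ∀ x, ‖D x‖ ≤ L := fun x => (hf x).le_of_lip' hL
    (Eventually.of_forall fun y => hfL y x)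
  have hfc : Continuous f := continuous_iff_continuousAt.2 fun x => (hf x).continuousAt
  set P : Plane → Plane := fun x => x + h • f x
  have hPd : ∀ x ∈ (univ : Set Plane), HasFDerivWithinAt P
      (ContinuousLinearMap.id ℝ Plane + h • D x) univ x := fun x _ =>
    ((hasFDerivAt_id x).add ((hf x).const_smul h)).hasFDerivWithinAt
  have hPlow : ∀ x y, ‖h • f x - h • f y‖ ≤ 1 / 2 * ‖x - y‖ := fun x y => by
    rw [← smul_sub, norm_smul, Real.norm_eq_abs]
    calc |h| * ‖f x - f y‖ ≤ |h| * (L * ‖x - y‖) := by gcongr; exact hfL x y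
      _ = |h| * L * ‖x - y‖ := by ring
      _ ≤ _ := by gcongr
  have hinj : InjOn P univ := by
    intro x _ y _ hxy
    have e : x - y = -(h • f x - h • f y) := by
      have : x + h • f x = y + h • f y := hxy
      rw [neg_sub, sub_eq_sub_iff_add_eq_add, this, add_comm]
    have h1 := hPlow x y
    rw [← norm_neg, ← e] at h1
    have : ‖x - y‖ = 0 := by linarith [norm_nonneg (x - y)]
    exact sub_eq_zero.1 (norm_eq_zero.1 this)
  have hsurj : P '' univ = univ := by
    rw [image_univ, range_eq_univ]
    intro y
    -- Solving `x + h f(x) = y` is a fixed point problem for a map with contraction constant `1/2`.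
    have hcon : ContractingWith (1 / 2) fun x => y - h • f x := by
      refine ⟨by norm_num, LipschitzWith.of_dist_le_mul fun a b => ?_⟩
      rw [dist_eq_norm, dist_eq_norm, sub_sub_sub_cancel_left, norm_sub_rev]
      simpa using hPlow a b
    refine ⟨hcon.fixedPoint, ?_⟩
    have := hcon.fixedPoint_isFixedPt
    have h2 : y - h • f hcon.fixedPoint = hcon.fixedPoint := this
    exact (sub_eq_iff_eq_add.1 h2).symm
  have hcv := integral_image_eq_integral_abs_det_fderiv_smul volume MeasurableSet.univ hPd hinj ψ
  rw [hsurj, setIntegral_univ, setIntegral_univ] at hcv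
  have hdet : ∀ x, |(ContinuousLinearMap.id ℝ Plane + h • D x).det| = 1 + h ^ 2 * (D x).det := by
    intro x
    rw [det_id_add_smul (hD x), abs_of_nonneg]
    have h1 := neg_le_of_abs_le (abs_det_le (hDn x))
    have h2 : h ^ 2 * L ^ 2 ≤ 1 / 4 := by
      rw [← sq_abs h, ← mul_pow]
      nlinarith [mul_nonneg (abs_nonneg h) hL]
    nlinarith [sq_nonneg h]
  simp only [hdet, smul_eq_mul] at hcv
  have hPc : Continuous P := by fun_prop
  have hsupp : ∀ x, x ∉ Metric.closedBall (0 : Plane) R → ψ (P x) = 0 := fun x hx => by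
    by_contra hne
    exact hx (by simpa using hR x hne)
  have hi : Integrable fun x => ψ (P x) := by
    refine (hψ.comp hPc).integrable_of_hasCompactSupport
      (HasCompactSupport.intro (isCompact_closedBall 0 R) hsupp)
  have hle : ∀ x, ‖(D x).det * ψ (P x)‖ ≤
      (Metric.closedBall (0 : Plane) R).indicator (fun _ => 2 * L ^ 2 * C) x := by
    intro x
    by_cases hx : x ∈ Metric.closedBall (0 : Plane) R
    · rw [indicator_of_mem hx, norm_mul]
      have := abs_det_le (hDn x)
      gcongr
      · exact this
      · exact hC _
    · rw [indicator_of_notMem hx, hsupp x hx]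
      simp
  have hind : Integrable ((Metric.closedBall (0 : Plane) R).indicator
      fun _ => 2 * L ^ 2 * C) volume := by
    rw [integrable_indicator_iff Metric.isClosed_closedBall.measurableSet]
    exact integrableOn_const (measure_closedBall_lt_top.ne)
  have hdm : AEStronglyMeasurable (fun x => (D x).det * ψ (P x)) volume := by
    have e : D = fderiv ℝ f := funext fun x => (hf x).fderiv.symm
    rw [e]
    exact ((ContinuousLinearMap.continuous_det.measurable.comp
      (measurable_fderiv ℝ f)).mul (hψ.comp hPc).measurable).aestronglyMeasurable
  have hi2 : Integrable fun x => (D x).det * ψ (P x) := hind.mono' hdm (Eventually.of_forall hle)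
  have e : ∫ x, ψ x = (∫ x, ψ (P x)) + h ^ 2 * ∫ x, (D x).det * ψ (P x) := by
    rw [hcv, ← integral_const_mul, ← integral_add hi (hi2.const_mul _)]
    congr 1
    ext x
    ring
  rw [e, sub_add_cancel_left, abs_neg, abs_mul, abs_of_nonneg (sq_nonneg h)]
  gcongr
  refine (norm_integral_le_of_norm_le hind (Eventually.of_forall hle)).trans_eq ?_
  rw [integral_indicator Metric.isClosed_closedBall.measurableSet, setIntegral_const, smul_eq_mul,
    mul_comm]

theorem norm_sub_le_exp_of_lipschitz {E : Type*} [NormedAddCommGroup E] [NormedSpace ℝ E]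
    {w : ℝ → E → E} {x y : ℝ → E} {T L s : ℝ} (hL : 0 ≤ L)
    (hw : ∀ t ∈ Icc (-T) T, ∀ x y, ‖w t x - w t y‖ ≤ L * ‖x - y‖)
    (hx : ∀ t, HasDerivAt x (w t (x t)) t) (hy : ∀ t, HasDerivAt y (w t (y t)) t)
    (hs : s ∈ Icc (-T) T) {t : ℝ} (ht : t ∈ Icc (-T) T) :
    ‖x t - y t‖ ≤ ‖x s - y s‖ * Real.exp (L * (2 * T)) := by
  have hd : ∀ t, HasDerivAt (fun t => x t - y t) (w t (x t) - w t (y t)) t :=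
    fun t => (hx t).sub (hy t)
  rcases le_total s t with h | h
  · have := norm_le_gronwallBound_of_norm_deriv_right_le (f := fun t => x t - y t)
      (f' := fun t => w t (x t) - w t (y t)) (δ := ‖x s - y s‖) (K := L) (ε := 0) (a := s) (b := t)
      (fun τ _ => (hd τ).continuousAt.continuousWithinAt) (fun τ _ => (hd τ).hasDerivWithinAt)
      le_rfl (fun τ hτ => by
        rw [add_zero]
        exact hw τ ⟨hs.1.trans hτ.1, hτ.2.le.trans ht.2⟩ _ _) t ⟨h, le_rfl⟩
    rw [gronwallBound_ε0] at this
    refine this.trans ?_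
    gcongr
    linarith [hs.1, ht.2]
  · have hd' : ∀ τ, HasDerivAt (fun τ => x (-τ) - y (-τ)) (-(w (-τ) (x (-τ)) - w (-τ) (y (-τ)))) τ :=
      fun τ => by
        have := (hd (-τ)).scomp τ (hasDerivAt_neg τ)
        simpa [Function.comp_def] using this
    have := norm_le_gronwallBound_of_norm_deriv_right_le (f := fun τ => x (-τ) - y (-τ))
      (f' := fun τ => -(w (-τ) (x (-τ)) - w (-τ) (y (-τ)))) (δ := ‖x s - y s‖) (K := L) (ε := 0)
      (a := -s) (b := -t)
      (fun τ _ => (hd' τ).continuousAt.continuousWithinAt) (fun τ _ => (hd' τ).hasDerivWithinAt)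
      (by simp) (fun τ hτ => by
        rw [add_zero, norm_neg]
        exact hw (-τ) ⟨by linarith [hτ.2, ht.1], by linarith [hτ.1, hs.2]⟩ _ _) (-t)
        ⟨by linarith, le_rfl⟩
    rw [gronwallBound_ε0] at this
    simp only [neg_neg] at this
    refine this.trans ?_
    gcongr
    linarith [hs.2, ht.1]

/-- Test functions on the plane are Lipschitz, bounded and supported in a ball. -/
theorem IsTestFunction.exists_bounds {φ : Plane → ℝ} (hφ : IsTestFunction φ) :
    ∃ K C R, 0 ≤ K ∧ 0 ≤ C ∧ 0 ≤ R ∧ (∀ x y, |φ x - φ y| ≤ K * ‖x - y‖) ∧ (∀ x, |φ x| ≤ C) ∧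
      ∀ x, φ x ≠ 0 → ‖x‖ ≤ R := by
  obtain ⟨K, hK⟩ := ContDiff.lipschitzWith_of_hasCompactSupport hφ.2 hφ.1 (by simp)
  obtain ⟨C, hC⟩ := hφ.2.exists_bound_of_continuous hφ.1.continuous
  obtain ⟨R, hR⟩ := hφ.2.isCompact.isBounded.exists_norm_le
  refine ⟨K, C, max R 0, K.2, (norm_nonneg _).trans (hC 0), le_max_right _ _, fun x y => ?_, hC,
    fun x hx => (hR x (subset_tsupport _ hx)).trans (le_max_left _ _)⟩
  have := hK.dist_le_mul x y
  rwa [Real.dist_eq, dist_eq_norm] at this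

/-- The integral of `φ` composed with the flow from `s` to `t₁` has zero derivative in `s`. Over a
short time the flow is replaced by an Euler step with error `o(h)`, and the Euler step preserves
integrals up to `O(h²)`. Differentiability of the flow in space is never needed. -/
theorem integral_comp_flow_of_lipschitz {w : ℝ → Plane → Plane} (hw : IsOsgoodField w)
    (hlip : ∀ T, ∃ M, 0 ≤ M ∧ ∀ t ∈ Icc (-T) T,
      (∀ x y, ‖w t x - w t y‖ ≤ M * ‖x - y‖) ∧ ∀ x, ‖w t x‖ ≤ M)
    (hdiv : ∀ t x, ∃ D : Plane →L[ℝ] Plane, HasFDerivAt (w t) D x ∧ planeTrace D = 0)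
    {φ : Plane → ℝ} (hφ : IsTestFunction φ) (s₁ t₁ : ℝ) :
    ∫ x, φ (hw.flow s₁ t₁ x) = ∫ x, φ x := by
  choose D hD hD0 using hdiv
  obtain ⟨K, C, R, hK, hC, hR, hφK, hφC, hφR⟩ := hφ.exists_bounds
  set T := max |s₁| |t₁| + 1
  obtain ⟨M, hM, H⟩ := hlip T
  have ht₁ : t₁ ∈ Ioo (-T) T := abs_lt.1 (by
    have := le_max_right |s₁| |t₁|
    simp only [T]; linarith)
  have hs₁ : s₁ ∈ Ioo (-T) T := abs_lt.1 (by
    have := le_max_left |s₁| |t₁|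
    simp only [T]; linarith)
  have hT : 0 ≤ T := by linarith [ht₁.1, ht₁.2]
  have hIcc : ∀ t ∈ Ioo (-T) T, t ∈ Icc (-T) T := fun t ht => ⟨ht.1.le, ht.2.le⟩
  set ψ : ℝ → Plane → ℝ := fun s x => φ (hw.flow s t₁ x)
  have hψc : ∀ s, Continuous (ψ s) := fun s => hφ.1.continuous.comp (hw.continuous_flow_right s t₁)
  set Λ := K * Real.exp (M * (2 * T))
  have hΛ : 0 ≤ Λ := by positivity
  have hψL : ∀ s ∈ Icc (-T) T, ∀ x y, |ψ s x - ψ s y| ≤ Λ * ‖x - y‖ := by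
    intro s hs x y
    refine (hφK _ _).trans ?_
    have := norm_sub_le_exp_of_lipschitz hM (fun t ht => (H t ht).1)
      (fun t => hw.hasDerivAt_flow s t x) (fun t => hw.hasDerivAt_flow s t y) hs (hIcc t₁ ht₁)
    simp only [hw.flow_self] at this
    calc _ ≤ K * (‖x - y‖ * Real.exp (M * (2 * T))) := by gcongr
      _ = _ := by ring
  set R' := R + M * (2 * T)
  have hψR : ∀ s ∈ Icc (-T) T, ∀ x, ψ s x ≠ 0 → ‖x‖ ≤ R' := by
    intro s hs x hx
    have h1 := hφR _ hx
    have h2 := hw.norm_flow_sub_le (fun t ht => (H t ht).2) hs (hIcc t₁ ht₁) x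
    have h3 : |t₁ - s| ≤ 2 * T := abs_le.2 ⟨by linarith [ht₁.1, hs.2], by linarith [ht₁.2, hs.1]⟩
    have h4 : ‖x‖ ≤ ‖hw.flow s t₁ x‖ + ‖hw.flow s t₁ x - x‖ := by
      have := norm_sub_norm_le x (hw.flow s t₁ x)
      rw [norm_sub_rev] at this
      linarith
    have h5 : M * |t₁ - s| ≤ M * (2 * T) := by gcongr
    linarith
  set g : ℝ → ℝ := fun s => ∫ x, ψ s x
  have hg : ∀ s ∈ Ioo (-T) T, HasDerivAt g 0 s := by
    intro s hs
    have hev : ∀ᶠ h in 𝓝[≠] (0 : ℝ), s + h ∈ Icc (-T) T ∧ |h| * M ≤ 1 / 2 ∧ |h| ≤ 1 ∧ h ≠ 0 := by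
      have h1 : ∀ᶠ h in 𝓝 (0 : ℝ), s + h ∈ Icc (-T) T := by
        have : Tendsto (fun h : ℝ => s + h) (𝓝 0) (𝓝 s) :=
          (continuous_const_add s).tendsto' 0 s (add_zero s)
        exact this.eventually (Icc_mem_nhds hs.1 hs.2)
      have h2 : ∀ᶠ h in 𝓝 (0 : ℝ), |h| * M < 1 / 2 := by
        have : ContinuousAt (fun h : ℝ => |h| * M) 0 := by fun_prop
        exact this.eventually (gt_mem_nhds (by simp))
      have h3 : ∀ᶠ h in 𝓝 (0 : ℝ), |h| < 1 := by
        have : ContinuousAt (fun h : ℝ => |h|) 0 := by fun_prop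
        exact this.eventually (gt_mem_nhds (by simp))
      filter_upwards [nhdsWithin_le_nhds h1, nhdsWithin_le_nhds h2, nhdsWithin_le_nhds h3,
        self_mem_nhdsWithin] with h a b c d
      exact ⟨a, b.le, c.le, d⟩
    have hsI := hIcc s hs
    set B := Metric.closedBall (0 : Plane) (R' + M)
    have hflowR : ∀ h, |h| ≤ 1 → s + h ∈ Icc (-T) T → ∀ x,
        ψ (s + h) (hw.flow s (s + h) x) ≠ 0 → ‖x‖ ≤ R' + M := by
      intro h hh hsh x hx
      have h1 := hψR _ hsh _ hx
      have h2 := hw.norm_flow_sub_le (fun t ht => (H t ht).2) hsI hsh x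
      rw [add_sub_cancel_left] at h2
      have h3 : M * |h| ≤ M := mul_le_of_le_one_right hM hh
      have h4 := norm_sub_norm_le x (hw.flow s (s + h) x)
      rw [norm_sub_rev] at h4
      linarith
    have heulR : ∀ h, |h| ≤ 1 → s + h ∈ Icc (-T) T → ∀ x,
        ψ (s + h) (x + h • w s x) ≠ 0 → ‖x‖ ≤ R' + M := by
      intro h hh hsh x hx
      have h1 := hψR _ hsh _ hx
      have h2 : ‖h • w s x‖ ≤ M := by
        rw [norm_smul, Real.norm_eq_abs]
        calc |h| * ‖w s x‖ ≤ 1 * M := by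
              gcongr
              exact (H s hsI).2 x
          _ = M := one_mul M
      have h4 := norm_sub_norm_le x (x + h • w s x)
      rw [sub_add_cancel_left, norm_neg] at h4
      linarith
    have hint : ∀ F : Plane → ℝ, Continuous F → (∀ x, F x ≠ 0 → ‖x‖ ≤ R' + M) → Integrable F := by
      intro F hF hFR
      refine hF.integrable_of_hasCompactSupport
        (HasCompactSupport.intro (isCompact_closedBall (0 : Plane) (R' + M)) fun x hx => ?_)
      by_contra hne
      exact hx (by simpa using hFR x hne)
    have hwc : Continuous (w s) := hw.continuous.comp (continuous_const.prodMk continuous_id)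
    rw [hasDerivAt_iff_tendsto_slope_zero]
    -- Flow against Euler step: since `ψ (s + h)` is `Λ`-Lipschitz, the integrand is at most `Λ`
    -- times the error of the difference quotient of the trajectory, and is dominated by `2ΛM` on a
    -- fixed ball.
    have t1 : Tendsto (fun h => ∫ x, h⁻¹ * (ψ (s + h) (hw.flow s (s + h) x) -
        ψ (s + h) (x + h • w s x))) (𝓝[≠] 0) (𝓝 (∫ _ : Plane, (0 : ℝ))) := by
      refine tendsto_integral_filter_of_dominated_convergence
        (B.indicator fun _ => Λ * (2 * M)) ?_ ?_ ?_ ?_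
      · refine Eventually.of_forall fun h => Continuous.aestronglyMeasurable ?_
        have := hψc (s + h)
        have := hw.continuous_flow_right s (s + h)
        fun_prop
      · filter_upwards [hev] with h hh
        refine Eventually.of_forall fun x => ?_
        by_cases hx : x ∈ B
        · rw [indicator_of_mem hx, norm_mul, norm_inv, Real.norm_eq_abs, Real.norm_eq_abs,
            inv_mul_le_iff₀ (abs_pos.2 hh.2.2.2)]
          refine (hψL _ hh.1 _ _).trans ?_
          have h2 := hw.norm_flow_sub_le (fun t ht => (H t ht).2) hsI hh.1 x
          rw [add_sub_cancel_left] at h2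
          have h3 : ‖h • w s x‖ ≤ M * |h| := by
            rw [norm_smul, Real.norm_eq_abs, mul_comm]
            gcongr
            exact (H s hsI).2 x
          have h4 : ‖hw.flow s (s + h) x - (x + h • w s x)‖ ≤ M * |h| + M * |h| := by
            rw [← sub_sub]
            exact (norm_sub_le _ _).trans (add_le_add h2 h3)
          calc _ ≤ Λ * (M * |h| + M * |h|) := by gcongr
            _ = _ := by ring
        · rw [indicator_of_notMem hx]
          have hx' : ¬ ‖x‖ ≤ R' + M := by simpa [B] using hx
          have z1 : ψ (s + h) (hw.flow s (s + h) x) = 0 := by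
            by_contra hne; exact hx' (hflowR h hh.2.2.1 hh.1 x hne)
          have z2 : ψ (s + h) (x + h • w s x) = 0 := by
            by_contra hne; exact hx' (heulR h hh.2.2.1 hh.1 x hne)
          rw [z1, z2]
          simp
      · rw [integrable_indicator_iff Metric.isClosed_closedBall.measurableSet]
        exact integrableOn_const measure_closedBall_lt_top.ne
      · refine Eventually.of_forall fun x => ?_
        have hd := hasDerivAt_iff_tendsto_slope_zero.1 (hw.hasDerivAt_flow s s x)
        simp only [hw.flow_self] at hd
        have hd2 : Tendsto (fun h : ℝ => Λ * ‖h⁻¹ • (hw.flow s (s + h) x - x) - w s x‖) (𝓝[≠] 0)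
            (𝓝 0) := by
          simpa using ((hd.sub_const (w s x)).norm).const_mul Λ
        refine squeeze_zero_norm' ?_ hd2
        filter_upwards [hev] with h hh
        rw [norm_mul, norm_inv, Real.norm_eq_abs, Real.norm_eq_abs]
        have e : hw.flow s (s + h) x - (x + h • w s x) =
            h • (h⁻¹ • (hw.flow s (s + h) x - x) - w s x) := by
          rw [smul_sub, smul_inv_smul₀ hh.2.2.2, sub_sub]
        have h5 := hψL _ hh.1 (hw.flow s (s + h) x) (x + h • w s x)
        rw [e, norm_smul, Real.norm_eq_abs] at h5
        rw [inv_mul_le_iff₀ (abs_pos.2 hh.2.2.2)]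
        linarith
    -- Euler step against identity: a second-order error divided by `h`.
    have t2 : Tendsto (fun h => h⁻¹ * ((∫ x, ψ (s + h) (x + h • w s x)) - ∫ x, ψ (s + h) x))
        (𝓝[≠] 0) (𝓝 0) := by
      set c := 2 * M ^ 2 * C * volume.real B
      have hlim : Tendsto (fun h : ℝ => |h| * c) (𝓝[≠] 0) (𝓝 0) := by
        have : Continuous fun h : ℝ => |h| * c := by fun_prop
        simpa using (this.tendsto 0).mono_left nhdsWithin_le_nhds
      refine squeeze_zero_norm' ?_ hlim
      filter_upwards [hev] with h hh
      have := abs_integral_comp_id_add_smul_sub_le (C := C) (R := R' + M) hM hh.2.1 (hD s)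
        (H s hsI).1 (hD0 s) (hψc (s + h)) (fun x => hφC _) (heulR h hh.2.2.1 hh.1)
      rw [norm_mul, norm_inv, Real.norm_eq_abs, Real.norm_eq_abs,
        inv_mul_le_iff₀ (abs_pos.2 hh.2.2.2)]
      refine this.trans_eq ?_
      rw [← sq_abs]
      simp only [c]
      ring
    have t3 := (t1.add t2).neg
    simp only [integral_zero, add_zero, neg_zero] at t3
    refine t3.congr' ?_
    filter_upwards [hev] with h hh
    -- The composition law of the flow rewrites `g s` at the later time `s + h`, so only a single
    -- short step has to be compared.
    have e1 : g s = ∫ x, ψ (s + h) (hw.flow s (s + h) x) := by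
      simp only [g, ψ, hw.flow_flow]
    have i1 : Integrable fun x => ψ (s + h) (hw.flow s (s + h) x) :=
      hint _ ((hψc _).comp (hw.continuous_flow_right s (s + h))) (hflowR h hh.2.2.1 hh.1)
    have i2 : Integrable fun x => ψ (s + h) (x + h • w s x) :=
      hint _ ((hψc _).comp (by fun_prop)) (heulR h hh.2.2.1 hh.1)
    rw [integral_const_mul, integral_sub i1 i2, ← e1, smul_eq_mul]
    simp only [g]
    ring
  have hconst : g s₁ = g t₁ := by
    refine (convex_Ioo (-T) T).is_const_of_fderivWithin_eq_zero (𝕜 := ℝ)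
      (fun s hs => (hg s hs).differentiableAt.differentiableWithinAt) (fun s hs => ?_) hs₁ ht₁
    have h0 : HasFDerivAt g (0 : ℝ →L[ℝ] ℝ) s := by
      have := (hg s hs).hasFDerivAt
      simpa using this
    exact h0.hasFDerivWithinAt.fderivWithin (isOpen_Ioo.uniqueDiffWithinAt hs)
  have e2 : g t₁ = ∫ x, φ x := by simp only [g, ψ, hw.flow_self]
  rw [← e2, ← hconst]

/-- Approximation of continuous functions with compact support by test functions. -/
theorem exists_testFunction_approx {f : Plane → ℝ} (hf : Continuous f) (hfc : HasCompactSupport f) :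
    ∃ R, ∀ ε > 0, ∃ g : Plane → ℝ, IsTestFunction g ∧ (∀ x, |g x - f x| ≤ ε) ∧
      ∀ x, R < ‖x‖ → g x = 0 ∧ f x = 0 := by
  obtain ⟨R, hR⟩ := hfc.isCompact.isBounded.exists_norm_le
  have hR' : ∀ x, R < ‖x‖ → f x = 0 := fun x hx => by
    by_contra hne
    exact absurd (hR x (subset_tsupport _ hne)) (not_le.2 hx)
  refine ⟨R + 1, fun ε hε => ?_⟩
  obtain ⟨δ, hδ, H⟩ := Metric.uniformContinuous_iff.1
    (hfc.uniformContinuous_of_continuous hf) ε hε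
  obtain ⟨g, hg, hgf⟩ := hf.exists_contDiff_dist_le_of_forall_mem_ball_dist_le (lt_min hδ one_pos)
  have hg0 : ∀ x, R + 1 < ‖x‖ → g x = 0 ∧ f x = 0 := by
    intro x hx
    have hfx : f x = 0 := hR' x (by linarith)
    refine ⟨?_, hfx⟩
    have := hgf x 0 fun y hy => ?_
    · rw [hfx] at this
      exact dist_le_zero.1 this
    · have h1 : dist y x < 1 := (Metric.mem_ball.1 hy).trans_le (min_le_right _ _)
      rw [dist_eq_norm, norm_sub_rev] at h1
      have h2 := norm_sub_norm_le x y
      rw [hfx, hR' y (by linarith), dist_self]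
  refine ⟨g, ⟨hg, ?_⟩, fun x => ?_, hg0⟩
  · refine HasCompactSupport.intro (isCompact_closedBall 0 (R + 1)) fun x hx => ?_
    exact (hg0 x (by simpa using hx)).1
  · exact hgf x ε fun y hy => (H ((Metric.mem_ball.1 hy).trans_le (min_le_left _ _))).le

theorem integrable_indicator_closedBall (R c : ℝ) :
    Integrable ((Metric.closedBall (0 : Plane) R).indicator fun _ => c) volume := by
  rw [integrable_indicator_iff Metric.isClosed_closedBall.measurableSet]
  exact integrableOn_const measure_closedBall_lt_top.ne

/-- Trajectories of the regularized fields are approximate solutions with defect `M ε`, so they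
converge to those of the true field; uniform speed bounds keep all supports in one ball, and
dominated convergence applies. -/
theorem integral_comp_flow_velocity {α : ℝ} (hα : 0 < α) {q : ℝ → RadonMeasure}
    (hq : IsWeakStarContinuous q) {φ : Plane → ℝ} (hφ : IsTestFunction φ) (s t : ℝ) :
    ∫ x, φ ((isOsgoodField_velocity hα hq).flow s t x) = ∫ x, φ x := by
  set hv := isOsgoodField_velocity hα hq
  have hA := blobConst_pos hα
  obtain ⟨K, C, R, hK, hC, hR, hφK, hφC, hφR⟩ := hφ.exists_bounds
  set T := max |s| |t|
  have hs : s ∈ Icc (-T) T := abs_le.1 (le_max_left _ _)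
  have ht : t ∈ Icc (-T) T := abs_le.1 (le_max_right _ _)
  have hT : 0 ≤ T := by linarith [hs.1, hs.2]
  obtain ⟨M₀, hM₀, hqM⟩ := hq.exists_pairingBound T
  obtain ⟨M₁, hM₁, hlog₁, -⟩ := hv.exists_logLipOn T
  obtain ⟨M, hM1, hM2⟩ : ∃ M, M₁ ≤ M ∧ 4 * M₀ * blobConst α ≤ M :=
    ⟨max M₁ (4 * M₀ * blobConst α), le_max_left _ _, le_max_right _ _⟩
  have hM : 0 ≤ M := hM₁.trans hM1
  have hMA : 0 ≤ M₀ * blobConst α := by positivity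
  have hlog : LogLipOn (fun t x => velocity (blobKernel α) (q t) x) M T :=
    fun t ht x y ε hε hε1 => by
      have hl := Real.log_nonpos hε.le hε1
      refine (hlog₁ t ht x y ε hε hε1).trans ?_
      gcongr
      have : 0 ≤ (1 - Real.log ε) * ‖x - y‖ := mul_nonneg (by linarith) (norm_nonneg _)
      linarith
  let ε : ℕ → ℝ := fun n => 1 / (n + 1)
  have hε : ∀ n, 0 < ε n := fun n => by positivity
  have hε1 : ∀ n, ε n ≤ 1 := fun n => (div_le_one (by positivity)).2 (by simp)
  have hε0 : Tendsto ε atTop (𝓝[>] 0) := by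
    rw [tendsto_nhdsWithin_iff]
    exact ⟨tendsto_one_div_add_atTop_nhds_zero_nat, Eventually.of_forall hε⟩
  have hw : ∀ n, IsOsgoodField fun t x => velocity (regKernel α (ε n)) (q t) x :=
    fun n => isOsgoodField_regVelocity hα (hε n) (hε1 n) hq
  have hwM : ∀ n, ∀ t ∈ Icc (-T) T, ∀ x, ‖velocity (regKernel α (ε n)) (q t) x‖ ≤ M := by
    intro n t ht x
    refine ((isKernel_regKernel hα (hε n)).norm_velocity_le (hqM t ht)
      (norm_regKernel_le hα (hε n)) x).trans ?_
    linarith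
  have hclose : ∀ n, ∀ t ∈ Icc (-T) T, ∀ x,
      ‖velocity (regKernel α (ε n)) (q t) x - velocity (blobKernel α) (q t) x‖ ≤ M * ε n := by
    intro n t ht x
    refine ((isKernel_regKernel hα (hε n)).norm_velocity_sub_le (isKernel_blobKernel hα) (hqM t ht)
      (C := 2 * blobConst α * ε n) fun z =>
        norm_regKernel_sub_blobKernel_le hα (hε n) _).trans ?_
    have := mul_le_mul_of_nonneg_right hM2 (hε n).le
    linarith
  have hconst : ∀ n, ∫ x, φ ((hw n).flow s t x) = ∫ x, φ x := fun n =>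
    integral_comp_flow_of_lipschitz (hw n) (exists_lipschitz_regVelocity hα (hε n) (hε1 n) hq)
      (fun t x => exists_hasFDerivAt_regVelocity hα (hε n) (hε1 n) (q t) x) hφ s t
  have hlim : Tendsto (fun n => ∫ x, φ ((hw n).flow s t x)) atTop (𝓝 (∫ x, φ (hv.flow s t x))) := by
    refine tendsto_integral_of_dominated_convergence
      ((Metric.closedBall (0 : Plane) (R + M * |t - s|)).indicator fun _ => C) ?_
      (integrable_indicator_closedBall _ _) ?_ ?_
    · exact fun n => (hφ.1.continuous.comp ((hw n).continuous_flow_right s t)).aestronglyMeasurable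
    · intro n
      refine Eventually.of_forall fun x => ?_
      by_cases hx : x ∈ Metric.closedBall (0 : Plane) (R + M * |t - s|)
      · rw [indicator_of_mem hx]
        exact hφC _
      · rw [indicator_of_notMem hx, norm_le_zero_iff]
        by_contra hne
        have h1 := hφR _ hne
        have h2 := (hw n).norm_flow_sub_le (hwM n) hs ht x
        have h3 := norm_sub_norm_le x ((hw n).flow s t x)
        rw [norm_sub_rev] at h3
        exact hx (by simpa using by linarith)
    · refine Eventually.of_forall fun x => ?_
      refine (hφ.1.continuous.tendsto _).comp ?_
      rw [tendsto_iff_norm_sub_tendsto_zero]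
      have hB := (tendsto_osgoodModulus (stabilityExponent M T)).comp hε0
      refine squeeze_zero' (Eventually.of_forall fun n => norm_nonneg _) ?_ hB
      filter_upwards [hB.eventually (ge_mem_nhds zero_lt_one)] with n hn
      refine hlog.norm_solution_sub_le hM hs (hε n) (hε1 n) hn
        (fun t _ => (hw n).hasDerivAt_flow s t x) (fun t _ => hv.hasDerivAt_flow s t x)
        (fun t ht => hclose n t ht _) (fun t ht => ?_) ?_ t ht
      · simpa using mul_nonneg hM (hε n).le
      · simpa using (hε n).le
  simp only [hconst] at hlim
  exact tendsto_nhds_unique hlim tendsto_const_nhds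

/-- Uniform approximation with supports in a common ball extends the identity to continuous
functions of compact support, which determine a regular measure. -/
theorem measurePreserving_of_integral_comp_eq (Φ : Plane ≃ₜ Plane)
    (h : ∀ φ : Plane → ℝ, IsTestFunction φ → ∫ x, φ (Φ x) = ∫ x, φ x) :
    MeasurePreserving Φ (volume : Measure Plane) volume := by
  refine ⟨Φ.continuous.measurable, ?_⟩
  have : (Measure.map Φ (volume : Measure Plane)).Regular := Measure.Regular.map Φ
  refine Measure.ext_of_integral_eq_on_compactlySupported fun f => ?_
  rw [Φ.measurableEmbedding.integral_map]
  have hfc : Continuous (f : Plane → ℝ) := f.continuous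
  obtain ⟨R, hR⟩ := exists_testFunction_approx hfc f.hasCompactSupport
  choose g hg hgf hg0 using fun n : ℕ => hR (1 / (n + 1)) (by positivity)
  obtain ⟨C, hC⟩ := f.hasCompactSupport.exists_bound_of_continuous hfc
  have hlim : ∀ x, Tendsto (fun n => g n x) atTop (𝓝 (f x)) := fun x => by
    rw [tendsto_iff_norm_sub_tendsto_zero]
    exact squeeze_zero (fun n => norm_nonneg _) (fun n => hgf n x)
      tendsto_one_div_add_atTop_nhds_zero_nat
  have hbd : ∀ n x, ‖g n x‖ ≤
      (Metric.closedBall (0 : Plane) R).indicator (fun _ => C + 1) x := by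
    intro n x
    by_cases hx : x ∈ Metric.closedBall (0 : Plane) R
    · rw [indicator_of_mem hx]
      have h1 := hgf n x
      have h2 : (1 : ℝ) / (n + 1) ≤ 1 := (div_le_one (by positivity)).2 (by simp)
      have h3 := norm_sub_norm_le (g n x) (f x)
      have h4 := hC x
      rw [← Real.norm_eq_abs] at h1
      linarith
    · rw [indicator_of_notMem hx, (hg0 n x (by simpa using hx)).1]
      simp
  have l1 : Tendsto (fun n => ∫ x, g n x) atTop (𝓝 (∫ x, f x)) :=
    tendsto_integral_of_dominated_convergence _
      (fun n => (hg n).1.continuous.aestronglyMeasurable) (integrable_indicator_closedBall R (C + 1))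
      (fun n => Eventually.of_forall (hbd n)) (Eventually.of_forall hlim)
  have l2 : Tendsto (fun n => ∫ x, g n (Φ x)) atTop (𝓝 (∫ x, f (Φ x))) := by
    have hcpt : IsCompact (Φ ⁻¹' Metric.closedBall (0 : Plane) R) :=
      Φ.isClosedEmbedding.isCompact_preimage (isCompact_closedBall 0 R)
    refine tendsto_integral_of_dominated_convergence
      ((Φ ⁻¹' Metric.closedBall (0 : Plane) R).indicator fun _ => C + 1)
      (fun n => ((hg n).1.continuous.comp Φ.continuous).aestronglyMeasurable) ?_
      (fun n => Eventually.of_forall fun x => hbd n (Φ x))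
      (Eventually.of_forall fun x => hlim (Φ x))
    rw [integrable_indicator_iff hcpt.isClosed.measurableSet]
    exact integrableOn_const hcpt.measure_lt_top.ne
  simp only [fun n => h _ (hg n)] at l2
  exact tendsto_nhds_unique l2 l1

theorem measurePreserving_flow {α : ℝ} (hα : 0 < α) {q : ℝ → RadonMeasure}
    (hq : IsWeakStarContinuous q) (s t : ℝ) :
    MeasurePreserving ((isOsgoodField_velocity hα hq).flowHomeo s t)
      (volume : Measure Plane) volume :=
  measurePreserving_of_integral_comp_eq _ fun _ hφ => integral_comp_flow_velocity hα hq hφ s t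

/-- The velocity is divergence-free, because its flow preserves the volume. -/
theorem isDivergenceFree_velocity {α : ℝ} (hα : 0 < α) (q : RadonMeasure) :
    IsDivergenceFree (velocity (blobKernel α) q) := by
  intro φ hφ
  -- The measure is frozen in time. Differentiating the constant `∫ φ ∘ flow` at time `0` then gives
  -- exactly the weak divergence.
  have hq : IsWeakStarContinuous fun _ : ℝ => q := fun f => continuous_const
  set hv := isOsgoodField_velocity hα hq
  obtain ⟨K, C, R, hK, hC, hR, hφK, hφC, hφR⟩ := hφ.exists_bounds
  obtain ⟨M, hM, -, hb⟩ := hv.exists_logLipOn 1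
  have h0 : (0 : ℝ) ∈ Icc (-1 : ℝ) 1 := ⟨by norm_num, by norm_num⟩
  have hev : ∀ᶠ h in 𝓝[≠] (0 : ℝ), h ∈ Icc (-1 : ℝ) 1 ∧ h ≠ 0 := by
    filter_upwards [nhdsWithin_le_nhds (Icc_mem_nhds (by norm_num : (-1 : ℝ) < 0) one_pos),
      self_mem_nhdsWithin] with h a b
    exact ⟨a, b⟩
  have hlim : Tendsto (fun h => ∫ x, h⁻¹ * (φ (hv.flow 0 h x) - φ x)) (𝓝[≠] 0)
      (𝓝 (∫ x, fderiv ℝ φ x (velocity (blobKernel α) q x))) := by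
    refine tendsto_integral_filter_of_dominated_convergence
      ((Metric.closedBall (0 : Plane) (R + M)).indicator fun _ => K * M) ?_ ?_
      (integrable_indicator_closedBall _ _) ?_
    · refine Eventually.of_forall fun h => Continuous.aestronglyMeasurable ?_
      have := hv.continuous_flow_right 0 h
      have := hφ.1.continuous
      fun_prop
    · filter_upwards [hev] with h hh
      refine Eventually.of_forall fun x => ?_
      have h2 := hv.norm_flow_sub_le hb h0 hh.1 x
      rw [sub_zero] at h2
      by_cases hx : x ∈ Metric.closedBall (0 : Plane) (R + M)
      · rw [indicator_of_mem hx, norm_mul, norm_inv, Real.norm_eq_abs, Real.norm_eq_abs,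
          inv_mul_le_iff₀ (abs_pos.2 hh.2)]
        refine (hφK _ _).trans ?_
        calc _ ≤ K * (M * |h|) := by gcongr
          _ = _ := by ring
      · rw [indicator_of_notMem hx]
        have hx' : ¬ ‖x‖ ≤ R + M := by simpa using hx
        have z1 : φ x = 0 := by
          by_contra hne
          exact hx' (by linarith [hφR x hne])
        have z2 : φ (hv.flow 0 h x) = 0 := by
          by_contra hne
          have h3 := norm_sub_norm_le x (hv.flow 0 h x)
          rw [norm_sub_rev] at h3
          have h4 : M * |h| ≤ M := mul_le_of_le_one_right hM (abs_le.2 hh.1)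
          exact hx' (by linarith [hφR _ hne])
        rw [z1, z2]
        simp
    · refine Eventually.of_forall fun x => ?_
      have hd : HasDerivAt (fun h => φ (hv.flow 0 h x))
          (fderiv ℝ φ (hv.flow 0 0 x) (velocity (blobKernel α) q (hv.flow 0 0 x))) 0 :=
        ((hφ.1.differentiable (by simp)).differentiableAt.hasFDerivAt).comp_hasDerivAt 0
          (hv.hasDerivAt_flow 0 0 x)
      have := hasDerivAt_iff_tendsto_slope_zero.1 hd
      simpa using this
  have hzero : ∀ h, ∫ x, h⁻¹ * (φ (hv.flow 0 h x) - φ x) = 0 := by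
    intro h
    have i1 : Integrable φ := hφ.1.continuous.integrable_of_hasCompactSupport hφ.2
    have i2 : Integrable fun x => φ (hv.flow 0 h x) :=
      (measurePreserving_flow hα hq 0 h).integrable_comp_of_integrable i1
    rw [integral_const_mul, integral_sub i2 i1, integral_comp_flow_velocity hα hq hφ, sub_self,
      mul_zero]
  simp only [hzero] at hlim
  exact tendsto_nhds_unique hlim tendsto_const_nhds

/-! ### The equation for the displacement -/

theorem vintegral_map {F : Type*} [NormedAddCommGroup F] [NormedSpace ℝ F]
    [SecondCountableTopology F] (q : RadonMeasure) {η : Plane → Plane} (hη : Continuous η)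
    {f : Plane → F} (hf : Continuous f) {C : ℝ} (hC : ∀ x, ‖f x‖ ≤ C) :
    ∫ᵛ x, f x ∂<•(VectorMeasure.map q η) = ∫ᵛ x, f (η x) ∂<•q :=
  VectorMeasure.integral_map hη.measurable hf.aestronglyMeasurable
    (integrable_of_continuous_of_bound q (hf.comp hη) fun x => hC (η x))

/-- The velocity of the particles, as a function of their displacement `w`. -/
def particleVelocity (k : Plane → Plane) (q : RadonMeasure) (w : Plane → Plane) (x : Plane) :
    Plane :=
  ∫ᵛ y, k ((x + w x) - (y + w y)) ∂<•q

namespace IsKernel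

variable {k k' : Plane → Plane}

theorem integrable_particle (hk : IsKernel k) (q : RadonMeasure) {w : Plane → Plane}
    (hw : Continuous w) (x : Plane) : q.Integrable fun y => k ((x + w x) - (y + w y)) := by
  obtain ⟨C, hC⟩ := hk.exists_bound
  exact integrable_of_continuous_of_bound q (hk.continuous.comp (by fun_prop)) fun y => hC _

theorem continuous_particleVelocity (hk : IsKernel k) (q : RadonMeasure) {w : Plane → Plane}
    (hw : Continuous w) : Continuous (particleVelocity k q w) := by
  obtain ⟨C, hC⟩ := hk.exists_bound
  have hkc := hk.continuous
  refine VectorMeasure.continuous_of_dominated (bound := fun _ => C) (fun x => ?_)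
    (fun x => Eventually.of_forall fun y => hC _) (integrable_const _)
    (Eventually.of_forall fun y => by fun_prop)
  exact Continuous.aestronglyMeasurable (by fun_prop)

theorem norm_particleVelocity_le {q : RadonMeasure} {C : ℝ}
    (hC : ∀ x, ‖k x‖ ≤ C) (w : Plane → Plane) (x : Plane) :
    ‖particleVelocity k q w x‖ ≤ totalMass q * C :=
  norm_vintegral_le q fun _ => hC _

theorem norm_particleVelocity_sub_le (hk : IsKernel k) (hk' : IsKernel k') {q : RadonMeasure}
    {w w' : Plane → Plane} (hw : Continuous w) (hw' : Continuous w') {x : Plane} {C : ℝ}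
    (hC : ∀ y, ‖k ((x + w x) - (y + w y)) - k' ((x + w' x) - (y + w' y))‖ ≤ C) :
    ‖particleVelocity k q w x - particleVelocity k' q w' x‖ ≤ totalMass q * C := by
  unfold particleVelocity
  rw [← VectorMeasure.integral_fun_sub (hk.integrable_particle q hw x)
    (hk'.integrable_particle q hw' x)]
  exact norm_vintegral_le q hC

/-- The velocity of the particles as a bounded continuous function. -/
def particleField (hk : IsKernel k) (q : RadonMeasure) (w : Plane →ᵇ Plane) : Plane →ᵇ Plane :=
  BoundedContinuousFunction.ofNormedAddCommGroup (particleVelocity k q w)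
    (hk.continuous_particleVelocity q w.continuous) (totalMass q * hk.exists_bound.choose)
    (norm_particleVelocity_le hk.exists_bound.choose_spec w)

@[simp] theorem particleField_apply (hk : IsKernel k) (q : RadonMeasure) (w : Plane →ᵇ Plane)
    (x : Plane) : hk.particleField q w x = particleVelocity k q w x := rfl

theorem norm_displacement_sub_le (w w' : Plane →ᵇ Plane) (x y : Plane) :
    ‖((x + w x) - (y + w y)) - ((x + w' x) - (y + w' y))‖ ≤ 2 * ‖w - w'‖ := by
  have e : ((x + w x) - (y + w y)) - ((x + w' x) - (y + w' y)) = (w - w') x - (w - w') y := by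
    simp only [BoundedContinuousFunction.sub_apply]
    abel
  rw [e]
  refine (norm_sub_le _ _).trans ?_
  linarith [(w - w').norm_coe_le_norm x, (w - w').norm_coe_le_norm y]

theorem continuous_particleField (hk : IsKernel k) (q : RadonMeasure) :
    Continuous (hk.particleField q) := by
  rw [Metric.continuous_iff]
  intro w ε hε
  have hN := totalMass_nonneg q
  obtain ⟨δ, hδ, H⟩ := Metric.uniformContinuous_iff.1 hk.uniformContinuous
    (ε / (2 * (totalMass q + 1))) (by positivity)
  refine ⟨δ / 2, half_pos hδ, fun w' hw' => ?_⟩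
  have hle : dist (hk.particleField q w') (hk.particleField q w) ≤
      totalMass q * (ε / (2 * (totalMass q + 1))) := by
    rw [BoundedContinuousFunction.dist_le (by positivity)]
    intro x
    rw [dist_eq_norm]
    refine hk.norm_particleVelocity_sub_le hk w'.continuous w.continuous fun y => ?_
    rw [← dist_eq_norm]
    refine (H ?_).le
    rw [dist_eq_norm]
    refine (norm_displacement_sub_le w' w x y).trans_lt ?_
    rw [dist_eq_norm] at hw'
    linarith
  refine hle.trans_lt ?_
  rw [mul_div_assoc', div_lt_iff₀ (by positivity)]
  nlinarith

end IsKernel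

/-- All bounds on the kernel are pointwise and uniform, so they pass to the supremum norm. The
factor `2` comes from the two displacements, at `x` and at `y`, in the argument of the kernel. -/
theorem isOsgoodField_particleField {α : ℝ} (hα : 0 < α) (q : RadonMeasure) :
    IsOsgoodField fun (_ : ℝ) w => (isKernel_blobKernel hα).particleField q w := by
  have hA := blobConst_pos hα
  have hk := isKernel_blobKernel hα
  have hN := totalMass_nonneg q
  have hNA : 0 ≤ totalMass q * blobConst α := by positivity
  refine ⟨(hk.continuous_particleField q).comp continuous_snd, fun T => ?_⟩
  refine ⟨6 * totalMass q * blobConst α, by positivity, fun ε hε hε1 =>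
    ⟨fun _ w => (isKernel_regKernel hα hε).particleField q w,
      ((isKernel_regKernel hα hε).continuous_particleField q).comp continuous_snd,
      fun t _ => ⟨fun w w' => ?_, fun w => ⟨?_, ?_⟩⟩⟩⟩
  · have hl := Real.log_nonpos hε.le hε1
    have hl' : 0 ≤ 1 - Real.log ε := by linarith
    rw [BoundedContinuousFunction.norm_le (by positivity)]
    intro x
    refine ((isKernel_regKernel hα hε).norm_particleVelocity_sub_le (isKernel_regKernel hα hε)
      w.continuous w'.continuous (C := 3 * blobConst α * (1 - Real.log ε) * (2 * ‖w - w'‖))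
      fun y => ?_).trans_eq (by ring)
    refine (norm_regKernel_sub_le hα hε hε1 _ _).trans ?_
    gcongr
    exact IsKernel.norm_displacement_sub_le w w' x y
  · rw [BoundedContinuousFunction.norm_le (by positivity)]
    intro x
    refine (IsKernel.norm_particleVelocity_le (norm_regKernel_le hα hε) w x).trans ?_
    linarith
  · rw [BoundedContinuousFunction.norm_le (by positivity)]
    intro x
    refine ((isKernel_regKernel hα hε).norm_particleVelocity_sub_le hk
      w.continuous w.continuous (C := 2 * blobConst α * ε) fun y =>
        norm_regKernel_sub_blobKernel_le hα hε _).trans ?_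
    have : 0 ≤ totalMass q * blobConst α * ε := by positivity
    linarith

/-! ### Transported measures -/

/-- If particles move along continuous curves, the transported measure is weakly continuous. -/
theorem isWeaklyContinuous_map {η : ℝ → Plane → Plane} (q₀ : RadonMeasure)
    (hη : ∀ t, Continuous (η t)) (hηt : ∀ x, Continuous fun t => η t x) :
    IsWeaklyContinuous fun t => VectorMeasure.map q₀ (η t) := by
  intro f
  simp only [fun t => vintegral_map q₀ (hη t) f.continuous f.norm_coe_le_norm]
  refine VectorMeasure.continuous_of_dominated (bound := fun _ => ‖f‖) (fun t => ?_)
    (fun t => Eventually.of_forall fun y => f.norm_coe_le_norm _) (integrable_const _)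
    (Eventually.of_forall fun y => f.continuous.comp (hηt y))
  exact (f.continuous.comp (hη t)).aestronglyMeasurable

theorem IsWeaklyContinuous.isWeakStarContinuous {q : ℝ → RadonMeasure}
    (hq : IsWeaklyContinuous q) : IsWeakStarContinuous q :=
  fun f => hq f.toBCF

theorem velocity_map {k : Plane → Plane} (hk : IsKernel k) (q₀ : RadonMeasure)
    {η : Plane → Plane} (hη : Continuous η) (x : Plane) :
    velocity k (VectorMeasure.map q₀ η) x = ∫ᵛ y, k (x - η y) ∂<•q₀ := by
  obtain ⟨C, hC⟩ := hk.exists_bound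
  exact vintegral_map q₀ hη (hk.continuous_sub x) fun y => hC _

/-- A measure transported by the flow of a bounded continuous field solves the transport
equation. -/
theorem weakCoadjoint_map_eq_zero {η u : ℝ → Plane → Plane} (q₀ : RadonMeasure)
    (hη : ∀ t, Continuous (η t)) (hu : Continuous (Function.uncurry u)) {M : ℝ}
    (hM : ∀ t x, ‖u t x‖ ≤ M) (hflow : ∀ t x, HasDerivAt (fun s => η s x) (u t (η t x)) t)
    {φ : ℝ × Plane → ℝ} (hφ : IsTestFunction φ) :
    weakCoadjoint u (fun t => VectorMeasure.map q₀ (η t)) φ = 0 := by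
  have hηt : ∀ x, Continuous fun t => η t x := fun x =>
    continuous_iff_continuousAt.2 fun t => (hflow t x).continuousAt
  have hφ' : Continuous (fderiv ℝ φ) := hφ.1.continuous_fderiv (by simp)
  obtain ⟨C, hC⟩ := (hφ.2.fderiv ℝ).exists_bound_of_continuous hφ'
  obtain ⟨C₀, hC₀⟩ := hφ.2.exists_bound_of_continuous hφ.1.continuous
  have hM0 : 0 ≤ M := (norm_nonneg _).trans (hM 0 0)
  have hC0 : 0 ≤ C := (norm_nonneg _).trans (hC 0)
  have hbd : ∀ t x, ‖fderiv ℝ φ (t, x) (1, u t x)‖ ≤ C * (1 + M) := by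
    intro t x
    refine ((fderiv ℝ φ (t, x)).le_opNorm _).trans ?_
    gcongr
    · exact hC _
    · refine max_le ?_ ?_
      · simpa using hM0
      · linarith [hM t x]
  have huc : ∀ t, Continuous (u t) := fun t => hu.comp (continuous_const.prodMk continuous_id)
  have hinner : ∀ t, Continuous fun x => fderiv ℝ φ (t, x) (1, u t x) := fun t => by
    have := huc t
    fun_prop
  have e : ∀ t, ∫ᵛ x, fderiv ℝ φ (t, x) (1, u t x) ∂<•(VectorMeasure.map q₀ (η t)) =
      ∫ᵛ x, fderiv ℝ φ (t, η t x) (1, u t (η t x)) ∂<•q₀ := fun t =>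
    vintegral_map q₀ (hη t) (hinner t) (hbd t)
  unfold weakCoadjoint
  simp only [e]
  set g : ℝ → ℝ := fun t => ∫ᵛ x, φ (t, η t x) ∂<•q₀
  set g' : ℝ → ℝ := fun t => ∫ᵛ x, fderiv ℝ φ (t, η t x) (1, u t (η t x)) ∂<•q₀
  have hcomp : ∀ t, Continuous fun x => φ (t, η t x) := fun t =>
    hφ.1.continuous.comp (continuous_const.prodMk (hη t))
  have hcomp' : ∀ t, Continuous fun x => fderiv ℝ φ (t, η t x) (1, u t (η t x)) := fun t =>
    (hinner t).comp (hη t)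
  have hpt : ∀ t x, HasDerivAt (fun s => φ (s, η s x))
      (fderiv ℝ φ (t, η t x) (1, u t (η t x))) t := fun t x =>
    ((hφ.1.differentiable (by simp)).differentiableAt.hasFDerivAt).comp_hasDerivAt t
      ((hasDerivAt_id t).prodMk (hflow t x))
  have hd : ∀ t, HasDerivAt g (g' t) t := by
    intro t
    have hμ : ∀ μ : Measure Plane, IsFiniteMeasure μ → HasDerivAt (fun t => ∫ x, φ (t, η t x) ∂μ)
        (∫ x, fderiv ℝ φ (t, η t x) (1, u t (η t x)) ∂μ) t := by
      intro μ _
      refine (hasDerivAt_integral_of_dominated_loc_of_deriv_le (s := univ)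
        (F := fun t x => φ (t, η t x))
        (F' := fun t x => fderiv ℝ φ (t, η t x) (1, u t (η t x)))
        (bound := fun _ => C * (1 + M)) univ_mem
        (Eventually.of_forall fun s => (hcomp s).aestronglyMeasurable)
        (Integrable.of_bound (hcomp t).aestronglyMeasurable C₀ (Eventually.of_forall fun x => hC₀ _))
        (hcomp' t).aestronglyMeasurable (Eventually.of_forall fun x s _ => hbd s _)
        (integrable_const _) (Eventually.of_forall fun x s _ => hpt s x)).2
    have e1 : g = fun t => ∫ x, φ (t, η t x) ∂q₀.toJordanDecomposition.posPart -
        ∫ x, φ (t, η t x) ∂q₀.toJordanDecomposition.negPart := funext fun t =>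
      vintegral_eq_sub q₀ (integrable_of_continuous_of_bound q₀ (hcomp t) fun x => hC₀ _)
    have e2 : g' t = _ :=
      vintegral_eq_sub q₀ (integrable_of_continuous_of_bound q₀ (hcomp' t) fun x => hbd t _)
    rw [e1, e2]
    exact (hμ _ inferInstance).sub (hμ _ inferInstance)
  obtain ⟨R, hR⟩ := hφ.2.isCompact.isBounded.exists_norm_le
  have hR' : ∀ t x, t ∉ Icc (-R) R → (t, x) ∉ tsupport φ := fun t x ht hmem => by
    have h1 := hR _ hmem
    have h2 : |t| ≤ ‖(t, x)‖ := le_max_left _ _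
    exact ht (abs_le.1 (h2.trans h1))
  have hgs : HasCompactSupport g := HasCompactSupport.intro (isCompact_Icc (a := -R) (b := R))
    fun t ht => by
      have : ∀ x, φ (t, η t x) = 0 := fun x => image_eq_zero_of_notMem_tsupport (hR' t _ ht)
      simp only [g, this, VectorMeasure.integral_zero]
  have hgs' : HasCompactSupport g' := HasCompactSupport.intro (isCompact_Icc (a := -R) (b := R))
    fun t ht => by
      have : ∀ x, fderiv ℝ φ (t, η t x) = 0 := fun x => by
        exact image_eq_zero_of_notMem_tsupport fun hmem =>
          hR' t (η t x) ht (tsupport_fderiv_subset ℝ hmem)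
      simp only [g', this, zero_apply, VectorMeasure.integral_zero]
  have hgc : Continuous g := continuous_iff_continuousAt.2 fun t => (hd t).continuousAt
  have hgc' : Continuous g' := by
    refine VectorMeasure.continuous_of_dominated (bound := fun _ => C * (1 + M))
      (fun t => (hcomp' t).aestronglyMeasurable) (fun t => Eventually.of_forall fun x => hbd t _)
      (integrable_const _) (Eventually.of_forall fun x => ?_)
    have h1 := hηt x
    have h2 : Continuous fun t => u t (η t x) := hu.comp (continuous_id.prodMk h1)
    fun_prop
  -- The test function has compact support in time, so the integral of the derivative of its pairing
  -- with the transported measure vanishes.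
  exact integral_eq_zero_of_hasDerivAt_of_integrable hd
    (hgc'.integrable_of_hasCompactSupport hgs') (hgc.integrable_of_hasCompactSupport hgs)

/-! ### The transport equation -/

theorem tendsto_cocompact_of_hasCompactSupport {f : Plane → ℝ} (hfc : HasCompactSupport f) :
    Tendsto f (cocompact Plane) (𝓝 0) := by
  refine tendsto_const_nhds.congr' ?_
  filter_upwards [hfc.isCompact.compl_mem_cocompact] with x hx
  exact (image_eq_zero_of_notMem_tsupport hx).symm

/-- Jointly continuous functions with locally uniformly compact support depend continuously on
the parameter in the supremum norm. -/
theorem eventually_abs_sub_le_of_support {F : ℝ → Plane → ℝ} {t₀ : ℝ}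
    (hF : Continuous (Function.uncurry F)) {K : Set Plane} (hK : IsCompact K)
    (h0 : ∀ᶠ t in 𝓝 t₀, ∀ x ∉ K, F t x = 0) :
    ∀ ε > 0, ∀ᶠ t in 𝓝 t₀, ∀ y, |F t y - F t₀ y| ≤ ε := by
  intro ε hε
  obtain ⟨V, hV, H⟩ := hK.mem_uniformity_of_prod (s := univ) (q := t₀) (f := F) hF.continuousOn
    (mem_univ _) (Metric.dist_mem_uniformity hε)
  rw [nhdsWithin_univ] at hV
  filter_upwards [h0, hV] with t h1 h2 y
  by_cases hy : y ∈ K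
  · exact (H t h2 y hy).le
  · rw [h1 y hy, h0.self_of_nhds y hy]
    simpa using hε.le

/-- A continuous function whose weak derivative is continuous is differentiable. -/
theorem hasDerivAt_of_forall_integral_eq_zero {a b : ℝ → ℝ} (ha : Continuous a) (hb : Continuous b)
    (h : ∀ χ : ℝ → ℝ, IsTestFunction χ → ∫ t, (deriv χ t * a t + χ t * b t) = 0) (t : ℝ) :
    HasDerivAt a (b t) t := by
  set B : ℝ → ℝ := fun t => ∫ s in (0 : ℝ)..t, b s
  have hB : ∀ t, HasDerivAt B (b t) t := fun t => hb.integral_hasStrictDerivAt 0 t |>.hasDerivAt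
  have hBc : Continuous B := continuous_iff_continuousAt.2 fun t => (hB t).continuousAt
  set d : ℝ → ℝ := fun t => a t - B t with hd
  have hdc : Continuous d := ha.sub hBc
  have hχ' : ∀ χ : ℝ → ℝ, IsTestFunction χ → Continuous (deriv χ) := fun χ hχ =>
    hχ.1.continuous_deriv (by simp)
  have key : ∀ χ : ℝ → ℝ, IsTestFunction χ → ∫ t, deriv χ t * d t = 0 := by
    intro χ hχ
    have i1 : Integrable fun t => deriv χ t * a t + χ t * b t :=
      (((hχ' χ hχ).mul ha).integrable_of_hasCompactSupport hχ.2.deriv.mul_right).add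
        ((hχ.1.continuous.mul hb).integrable_of_hasCompactSupport hχ.2.mul_right)
    have i2 : Integrable fun t => deriv χ t * B t + χ t * b t :=
      (((hχ' χ hχ).mul hBc).integrable_of_hasCompactSupport hχ.2.deriv.mul_right).add
        ((hχ.1.continuous.mul hb).integrable_of_hasCompactSupport hχ.2.mul_right)
    have h2 : ∫ t, (deriv χ t * B t + χ t * b t) = 0 :=
      integral_eq_zero_of_hasDerivAt_of_integrable (f := fun t => χ t * B t)
        (fun t => ((hχ.1.differentiable (by simp) t).hasDerivAt).mul (hB t)) i2
        ((hχ.1.continuous.mul hBc).integrable_of_hasCompactSupport hχ.2.mul_right)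
    have h3 := integral_sub i1 i2
    rw [h χ hχ, h2, sub_zero] at h3
    rw [← h3]
    congr 1; ext t; simp only [hd]; ring
  -- The du Bois-Reymond lemma by translation: `p ↦ ∫ d(s + p) θ(s) ds` is a convolution of `d` with
  -- the reflection of `θ`; its derivative pairs `d` with the derivative of a test function, hence
  -- is zero.
  have hconst : ∀ s r, d (s + r) = d s := by
    intro s r
    have hae : (fun s => d (s + r) - d s) =ᵐ[volume] 0 := by
      refine ae_eq_zero_of_integral_contDiff_smul_eq_zero
        ((hdc.comp (by fun_prop)).sub hdc).locallyIntegrable fun θ hθ hθc => ?_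
      have hθt : IsTestFunction θ := ⟨hθ, hθc⟩
      have hF : ∀ p, HasDerivAt (fun p => ∫ s, d (s + p) * θ s) 0 p := by
        intro p
        set θ' : ℝ → ℝ := fun x => θ (-x)
        have hθ' : IsTestFunction θ' := ⟨hθ.comp contDiff_neg, hθc.comp_homeomorph (.neg ℝ)⟩
        have e1 : (fun p => ∫ s, d (s + p) * θ s) =
            convolution d θ' (ContinuousLinearMap.mul ℝ ℝ) volume := by
          ext p
          rw [convolution_def]
          refine Eq.trans ?_ (integral_add_right_eq_self
            (fun r => ContinuousLinearMap.mul ℝ ℝ (d r) (θ' (p - r))) p)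
          congr 1; ext s
          simp [θ']
        have h1 := hθ'.2.hasDerivAt_convolution_right (ContinuousLinearMap.mul ℝ ℝ)
          (hdc.locallyIntegrable (μ := volume)) (hθ'.1.of_le (by simp)) p
        rw [e1]
        refine h1.congr_deriv ?_
        have h2 := key (fun s => θ' (p - s)) ⟨hθ'.1.comp (contDiff_const.sub contDiff_id),
          hθ'.2.comp_homeomorph (.subLeft p)⟩
        rw [convolution_def, ← neg_eq_zero, ← integral_neg, ← h2]
        congr 1; ext s
        rw [deriv_comp_const_sub]
        simp [mul_comm]
      have e := is_const_of_deriv_eq_zero (fun p => (hF p).differentiableAt)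
        (fun p => (hF p).deriv) r 0
      have j : ∀ p, Integrable fun s => d (s + p) * θ s := fun p =>
        ((hdc.comp (by fun_prop)).mul hθ.continuous).integrable_of_hasCompactSupport hθc.mul_left
      have e2 := integral_sub (j r) (j 0)
      simp only [add_zero] at e e2
      rw [e, sub_self] at e2
      rw [← e2]
      congr 1; ext s; simp only [smul_eq_mul]; ring
    have := Continuous.ae_eq_iff_eq volume ((hdc.comp (by fun_prop : Continuous fun s => s + r)).sub hdc)
      continuous_const |>.1 hae
    exact sub_eq_zero.1 (congrFun this s)
  have e : a = fun t => B t + d 0 := by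
    ext t
    have := hconst 0 t
    rw [zero_add] at this
    rw [← this]; simp [hd]
  rw [e]
  exact (hB t).add_const _

theorem IsTestFunction.mul_prod {χ : ℝ → ℝ} {f : Plane → ℝ} (hχ : IsTestFunction χ)
    (hf : IsTestFunction f) : IsTestFunction fun p : ℝ × Plane => χ p.1 * f p.2 := by
  refine ⟨(hχ.1.comp contDiff_fst).mul (hf.1.comp contDiff_snd),
    HasCompactSupport.intro (hχ.2.isCompact.prod hf.2.isCompact) fun p hp => ?_⟩
  rw [mem_prod, not_and_or] at hp
  rcases hp with h | h <;> simp [image_eq_zero_of_notMem_tsupport h]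

/-- The transport equation, tested with a fixed function of space. -/
theorem hasDerivAt_vintegral_testFunction {q : ℝ → RadonMeasure} (hq : IsWeakStarContinuous q)
    {u : ℝ → Plane → Plane} (hu : Continuous (Function.uncurry u))
    (h : ∀ φ : ℝ × Plane → ℝ, IsTestFunction φ → weakCoadjoint u q φ = 0)
    {f : Plane → ℝ} (hf : IsTestFunction f) (t : ℝ) :
    HasDerivAt (fun t => ∫ᵛ x, f x ∂<•(q t)) (∫ᵛ x, fderiv ℝ f x (u t x) ∂<•(q t)) t := by
  have hf' : Continuous (fderiv ℝ f) := hf.1.continuous_fderiv (by simp)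
  have hc : Continuous (Function.uncurry fun t x => fderiv ℝ f x (u t x)) := by
    have : Continuous fun p : ℝ × Plane => fderiv ℝ f p.2 (Function.uncurry u p) := by fun_prop
    exact this
  have h0 : ∀ t, ∀ x ∉ tsupport f, fderiv ℝ f x (u t x) = 0 := fun t x hx => by
    rw [image_eq_zero_of_notMem_tsupport (f := fderiv ℝ f)
      fun hmem => hx (tsupport_fderiv_subset ℝ hmem), zero_apply]
  have hcx : ∀ t, Continuous fun x => fderiv ℝ f x (u t x) := fun t =>
    hc.comp (continuous_const.prodMk continuous_id)
  have hcs : ∀ t, HasCompactSupport fun x => fderiv ℝ f x (u t x) := fun t =>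
    HasCompactSupport.intro hf.2.isCompact (h0 t)
  have hint : ∀ (p : RadonMeasure) {g : Plane → ℝ}, Continuous g → HasCompactSupport g →
      p.Integrable g := fun p g hg hgc =>
    have ⟨C, hC⟩ := hgc.exists_bound_of_continuous hg
    integrable_of_continuous_of_bound p hg hC
  refine hasDerivAt_of_forall_integral_eq_zero
    (hq ⟨⟨f, hf.1.continuous⟩, tendsto_cocompact_of_hasCompactSupport hf.2⟩)
    (continuous_iff_continuousAt.2 fun t => hq.continuousAt_vintegral (τ := id)
      (F := fun t x => fderiv ℝ f x (u t x)) continuousAt_id hcx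
      (fun t => tendsto_cocompact_of_hasCompactSupport (hcs t))
      (eventually_abs_sub_le_of_support hc hf.2.isCompact (Eventually.of_forall h0))) ?_ t
  -- Space-time test functions of product form `χ(t) f(x)` turn the weak equation into the weak
  -- derivative of `t ↦ ∫ f dq(t)`.
  intro χ hχ
  rw [← h _ (hχ.mul_prod hf)]
  unfold weakCoadjoint
  congr 1; ext t
  have e : ∀ x, fderiv ℝ (fun p : ℝ × Plane => χ p.1 * f p.2) (t, x) (1, u t x) =
      deriv χ t • f x + χ t • fderiv ℝ f x (u t x) := by
    intro x
    have h1 : HasFDerivAt (fun p : ℝ × Plane => χ p.1)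
        ((fderiv ℝ χ t).comp (ContinuousLinearMap.fst ℝ ℝ Plane)) (t, x) :=
      ((hχ.1.differentiable (by simp) t).hasFDerivAt).comp (t, x) hasFDerivAt_fst
    have h2 : HasFDerivAt (fun p : ℝ × Plane => f p.2)
        ((fderiv ℝ f x).comp (ContinuousLinearMap.snd ℝ ℝ Plane)) (t, x) :=
      ((hf.1.differentiable (by simp) x).hasFDerivAt).comp (t, x) hasFDerivAt_snd
    have h3 : HasFDerivAt (fun p : ℝ × Plane => χ p.1 * f p.2) _ (t, x) := h1.mul h2
    rw [h3.fderiv]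
    simp [mul_comm, add_comm]
  simp only [e]
  have h1 := VectorMeasure.integral_fun_add (B := (ContinuousLinearMap.lsmul ℝ ℝ (E := ℝ)).flip)
    ((hint (q t) hf.1.continuous hf.2).smul (deriv χ t))
    ((hint (q t) (hcx t) (hcs t)).smul (χ t))
  simp only [Pi.smul_apply] at h1
  rw [h1, VectorMeasure.integral_fun_smul, VectorMeasure.integral_fun_smul]
  rfl

/-- Differentiation of the integral of a time-dependent function against a time-dependent
measure. -/
theorem hasDerivAt_vintegral_param {q : ℝ → RadonMeasure} (hq : IsWeakStarContinuous q)
    {ψ ψ' : ℝ → Plane → ℝ} {t₀ b : ℝ} (hψ : ∀ t, Continuous (ψ t))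
    (hψ0 : ∀ t, HasCompactSupport (ψ t)) (hψ' : Continuous (ψ' t₀))
    (hψ0' : HasCompactSupport (ψ' t₀)) (hd : ∀ t x, HasDerivAt (fun t => ψ t x) (ψ' t x) t)
    (hu : ∀ ε > 0, ∀ᶠ t in 𝓝 t₀, ∀ y, |ψ' t y - ψ' t₀ y| ≤ ε)
    (hb : HasDerivAt (fun t => ∫ᵛ x, ψ t₀ x ∂<•(q t)) b t₀) :
    HasDerivAt (fun t => ∫ᵛ x, ψ t x ∂<•(q t)) (∫ᵛ x, ψ' t₀ x ∂<•(q t₀) + b) t₀ := by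
  -- A product rule: `∫ ψ t dq(t) = (t - t₀) ∫ F t dq(t) + ∫ ψ t₀ dq(t)`, where `F` is the slope in
  -- time, extended by the derivative at `t₀`. Only continuity of `∫ F t dq(t)` at `t₀` is needed.
  set F : ℝ → Plane → ℝ := fun t x => dslope (fun s => ψ s x) t₀ t with hF
  have hF0 : F t₀ = ψ' t₀ := funext fun x => by simp [hF, dslope_same, (hd t₀ x).deriv]
  have hF1 : ∀ t, t ≠ t₀ → F t = fun x => (t - t₀)⁻¹ • (ψ t x - ψ t₀ x) := fun t ht =>
    funext fun x => by simp [hF, dslope_of_ne _ ht, slope_def_module]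
  have hFc : ∀ t, Continuous (F t) := fun t => by
    rcases eq_or_ne t t₀ with rfl | ht
    · rwa [hF0]
    · rw [hF1 t ht]; exact ((hψ t).sub (hψ t₀)).const_smul (t - t₀)⁻¹
  have hFs : ∀ t, Tendsto (F t) (cocompact Plane) (𝓝 0) := fun t => by
    rcases eq_or_ne t t₀ with rfl | ht
    · rw [hF0]; exact tendsto_cocompact_of_hasCompactSupport hψ0'
    · rw [hF1 t ht]
      simpa using ((tendsto_cocompact_of_hasCompactSupport (hψ0 t)).sub
        (tendsto_cocompact_of_hasCompactSupport (hψ0 t₀))).const_smul ((t - t₀)⁻¹)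
  have hint : ∀ s t, (q s).Integrable (ψ t) := fun s t =>
    have ⟨C, hC⟩ := (hψ0 t).exists_bound_of_continuous (hψ t)
    integrable_of_continuous_of_bound (q s) (hψ t) hC
  have hcont : ContinuousAt (fun t => ∫ᵛ x, F t x ∂<•(q t)) t₀ := by
    refine hq.continuousAt_vintegral (τ := id) continuousAt_id hFc hFs fun ε hε => ?_
    obtain ⟨δ, hδ, H⟩ := Metric.eventually_nhds_iff_ball.1 (hu ε hε)
    filter_upwards [Metric.ball_mem_nhds t₀ hδ] with t ht y
    rcases eq_or_ne t t₀ with rfl | hne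
    · simpa using hε.le
    rw [hF0]
    have hb := (convex_ball t₀ δ).norm_image_sub_le_of_norm_hasDerivWithin_le
      (f := fun s => ψ s y - s * ψ' t₀ y) (f' := fun s => ψ' s y - ψ' t₀ y) (C := ε)
      (fun s _ => ((hd s y).sub (hasDerivAt_mul_const _)).hasDerivWithinAt)
      (fun s hs => H s hs y) (Metric.mem_ball_self hδ) ht
    have hpos : 0 < |t - t₀| := abs_pos.2 (sub_ne_zero.2 hne)
    have e : F t y - ψ' t₀ y =
        (t - t₀)⁻¹ * (ψ t y - t * ψ' t₀ y - (ψ t₀ y - t₀ * ψ' t₀ y)) := by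
      have := sub_ne_zero.2 hne
      rw [hF1 t hne]
      simp only [smul_eq_mul]
      field_simp
      ring
    rw [e, abs_mul, abs_inv, inv_mul_le_iff₀ hpos, mul_comm |t - t₀|]
    exact hb
  have h1 : HasDerivAt (fun t => (t - t₀) * ∫ᵛ x, F t x ∂<•(q t)) (∫ᵛ x, F t₀ x ∂<•(q t₀)) t₀ := by
    rw [hasDerivAt_iff_tendsto_slope]
    refine (hcont.tendsto.mono_left nhdsWithin_le_nhds).congr' ?_
    filter_upwards [self_mem_nhdsWithin] with t ht
    have := sub_ne_zero.2 (show t ≠ t₀ from ht)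
    rw [slope_def_field]
    field_simp
    simp
  rw [hF0] at h1
  refine (h1.add hb).congr_of_eventuallyEq (Eventually.of_forall fun t => ?_)
  simp only [Pi.add_apply]
  rcases eq_or_ne t t₀ with rfl | ht
  · simp
  · rw [hF1 t ht, VectorMeasure.integral_fun_smul,
      VectorMeasure.integral_fun_sub (hint t t) (hint t t₀), smul_eq_mul,
      mul_inv_cancel_left₀ (sub_ne_zero.2 ht)]
    ring

/-! ### Mollified functions carried by the flow. -/

namespace IsOsgoodField

variable {v : ℝ → Plane → Plane}

/-- The mollification, with kernel `g`, of a function transported by the flow of a field. -/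
def transported (hv : IsOsgoodField v) (φ g : Plane → ℝ) (t : ℝ) (x : Plane) : ℝ :=
  ∫ z, φ z * g (x - hv.flow 0 t z)

/-- The time derivative of a transported function. -/
def transportedDeriv (hv : IsOsgoodField v) (φ g : Plane → ℝ) (t : ℝ) (x : Plane) : ℝ :=
  ∫ z, φ z * -(fderiv ℝ g (x - hv.flow 0 t z) (v t (hv.flow 0 t z)))

variable {φ g : Plane → ℝ}

theorem continuous_transportedDeriv (hv : IsOsgoodField v) (hφ : IsTestFunction φ)
    (hg : IsTestFunction g) : Continuous (Function.uncurry (hv.transportedDeriv φ g)) := by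
  have hφc := hφ.1.continuous
  have hg' : Continuous (fderiv ℝ g) := hg.1.continuous_fderiv (by simp)
  have h1 : Continuous fun p : (ℝ × Plane) × Plane => hv.flow 0 p.1.1 p.2 :=
    (hv.continuous_flow 0).comp (f := fun p : (ℝ × Plane) × Plane => (p.1.1, p.2)) (by fun_prop)
  have h2 : Continuous fun p : (ℝ × Plane) × Plane => v p.1.1 (hv.flow 0 p.1.1 p.2) :=
    hv.continuous.comp (f := fun p : (ℝ × Plane) × Plane => (p.1.1, hv.flow 0 p.1.1 p.2))
      (by fun_prop)
  have h4 : Continuous fun p : (ℝ × Plane) × Plane => fderiv ℝ g (p.1.2 - hv.flow 0 p.1.1 p.2) :=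
    hg'.comp (by fun_prop)
  have h3 := continuous_parametric_integral_of_continuous (μ := (volume : Measure Plane))
    (f := fun (p : ℝ × Plane) z =>
      φ z * -(fderiv ℝ g (p.2 - hv.flow 0 p.1 z) (v p.1 (hv.flow 0 p.1 z))))
    ((hφc.comp continuous_snd).mul (h4.clm_apply h2).neg) hφ.2.isCompact
  refine h3.congr fun p => setIntegral_eq_integral_of_forall_compl_eq_zero fun z hz => ?_
  rw [image_eq_zero_of_notMem_tsupport hz, zero_mul]

/-- In the label variable `z`, time enters only through the trajectory inside the smooth `g`, so the
low regularity of the flow in space does no harm. -/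
theorem hasDerivAt_transported (hv : IsOsgoodField v) (hφ : IsTestFunction φ)
    (hg : IsTestFunction g) (t : ℝ) (x : Plane) :
    HasDerivAt (fun t => hv.transported φ g t x) (hv.transportedDeriv φ g t x) t := by
  have hφc := hφ.1.continuous
  have hgc := hg.1.continuous
  have hg' : Continuous (fderiv ℝ g) := hg.1.continuous_fderiv (by simp)
  obtain ⟨C, hC⟩ := (hg.2.fderiv ℝ).exists_bound_of_continuous hg'
  obtain ⟨M, hM, -, hb⟩ := hv.exists_logLipOn (|t| + 1)
  have hC0 : 0 ≤ C := (norm_nonneg _).trans (hC 0)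
  have hf := hv.continuous_flow_right 0
  have hvc : ∀ s, Continuous (v s) := fun s =>
    hv.continuous.comp (continuous_const.prodMk continuous_id)
  have hc : ∀ s, Continuous fun z => φ z * g (x - hv.flow 0 s z) := fun s => by
    have := hf s; fun_prop
  have hc' : ∀ s, Continuous fun z =>
      φ z * -(fderiv ℝ g (x - hv.flow 0 s z) (v s (hv.flow 0 s z))) := fun s => by
    have := hf s; have := hvc s; fun_prop
  refine (hasDerivAt_integral_of_dominated_loc_of_deriv_le (s := Metric.ball t 1)
    (F := fun t z => φ z * g (x - hv.flow 0 t z))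
    (F' := fun t z => φ z * -(fderiv ℝ g (x - hv.flow 0 t z) (v t (hv.flow 0 t z))))
    (bound := fun z => ‖φ z‖ * (C * M)) (Metric.ball_mem_nhds t one_pos)
    (Eventually.of_forall fun s => (hc s).aestronglyMeasurable)
    ((hc t).integrable_of_hasCompactSupport hφ.2.mul_right)
    (hc' t).aestronglyMeasurable (Eventually.of_forall fun z s hs => ?_)
    ((hφc.norm.mul continuous_const).integrable_of_hasCompactSupport hφ.2.norm.mul_right)
    (Eventually.of_forall fun z s _ => ?_)).2
  · rw [norm_mul, norm_neg]
    have hs' : s ∈ Icc (-(|t| + 1)) (|t| + 1) := by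
      rw [Metric.mem_ball, Real.dist_eq] at hs
      have := abs_sub_abs_le_abs_sub s t
      exact abs_le.1 (by linarith)
    gcongr
    refine ((fderiv ℝ g _).le_opNorm _).trans ?_
    gcongr
    · exact hC _
    · exact hb s hs' _
  · have h1 : HasDerivAt (fun s => x - hv.flow 0 s z) (-v s (hv.flow 0 s z)) s :=
      (hv.hasDerivAt_flow 0 s z).const_sub x
    have h2 := ((hg.1.differentiable (by simp)
      (x - hv.flow 0 s z)).hasFDerivAt.comp_hasDerivAt s h1).const_mul (φ z)
    refine h2.congr_deriv ?_
    rw [map_neg]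

theorem hasFDerivAt_transported (hv : IsOsgoodField v) (hφ : IsTestFunction φ)
    (hg : IsTestFunction g) (t : ℝ) (x : Plane) :
    HasFDerivAt (hv.transported φ g t) (∫ z, φ z • fderiv ℝ g (x - hv.flow 0 t z)) x := by
  have hφc := hφ.1.continuous
  have hgc := hg.1.continuous
  have hg' : Continuous (fderiv ℝ g) := hg.1.continuous_fderiv (by simp)
  obtain ⟨C, hC⟩ := (hg.2.fderiv ℝ).exists_bound_of_continuous hg'
  have hf := hv.continuous_flow_right 0 t
  have hc : ∀ y, Continuous fun z => φ z * g (y - hv.flow 0 t z) := fun y => by fun_prop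
  have hc' : Continuous fun z => φ z • fderiv ℝ g (x - hv.flow 0 t z) := by fun_prop
  refine hasFDerivAt_integral_of_dominated_of_fderiv_le (s := univ)
    (F := fun y z => φ z * g (y - hv.flow 0 t z))
    (F' := fun y z => φ z • fderiv ℝ g (y - hv.flow 0 t z))
    (bound := fun z => ‖φ z‖ * C) univ_mem
    (Eventually.of_forall fun y => (hc y).aestronglyMeasurable)
    ((hc x).integrable_of_hasCompactSupport hφ.2.mul_right)
    hc'.aestronglyMeasurable (Eventually.of_forall fun z y _ => ?_)
    ((hφc.norm.mul continuous_const).integrable_of_hasCompactSupport hφ.2.norm.mul_right)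
    (Eventually.of_forall fun z y _ => ?_)
  · rw [norm_smul]
    gcongr
    exact hC _
  · exact ((hasFDerivAt_comp_sub (f := g) (hv.flow 0 t z)).2
      (hg.1.differentiable (by simp) (y - hv.flow 0 t z)).hasFDerivAt).const_mul (φ z)

theorem fderiv_transported_apply (hv : IsOsgoodField v) (hφ : IsTestFunction φ)
    (hg : IsTestFunction g) (t : ℝ) (x w : Plane) :
    fderiv ℝ (hv.transported φ g t) x w = ∫ z, φ z * fderiv ℝ g (x - hv.flow 0 t z) w := by
  have hφc := hφ.1.continuous
  have hg' : Continuous (fderiv ℝ g) := hg.1.continuous_fderiv (by simp)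
  have hf := hv.continuous_flow_right 0 t
  rw [(hv.hasFDerivAt_transported hφ hg t x).fderiv, ContinuousLinearMap.integral_apply]
  · rfl
  · exact Continuous.integrable_of_hasCompactSupport (by fun_prop) hφ.2.smul_right

/-- Transported functions vanish outside of a ball, locally uniformly in time. -/
theorem exists_radius_transported (hv : IsOsgoodField v) (hφ : IsTestFunction φ)
    (hg : HasCompactSupport g) {T : ℝ} (hT : 0 ≤ T) : ∃ R, ∀ t ∈ Icc (-T) T, ∀ x, R < ‖x‖ →
      ∀ z, φ z ≠ 0 → x - hv.flow 0 t z ∉ tsupport g := by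
  obtain ⟨M, hM, -, hb⟩ := hv.exists_logLipOn T
  obtain ⟨R₁, h1⟩ := hφ.2.isCompact.isBounded.exists_norm_le
  obtain ⟨R₂, h2⟩ := hg.isCompact.isBounded.exists_norm_le
  refine ⟨R₁ + R₂ + M * T, fun t ht x hx z hz hmem => not_lt.2 ?_ hx⟩
  have h3 := hv.norm_flow_sub_le hb (s := 0) ⟨by linarith, hT⟩ ht z
  have h4 : M * |t - 0| ≤ M * T := by
    gcongr
    rw [sub_zero]
    exact abs_le.2 ht
  have e : x = z + (x - hv.flow 0 t z) + (hv.flow 0 t z - z) := by abel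
  rw [e]
  refine (norm_add₃_le).trans ?_
  linarith [h1 z (subset_tsupport _ hz), h2 _ hmem]

theorem eventually_transportedDeriv (hv : IsOsgoodField v) (hφ : IsTestFunction φ)
    (hg : IsTestFunction g) (t₀ : ℝ) : ∃ K : Set Plane, IsCompact K ∧
      ∀ᶠ t in 𝓝 t₀, ∀ x ∉ K, hv.transportedDeriv φ g t x = 0 := by
  have hT : (0 : ℝ) ≤ |t₀| + 1 := by positivity
  obtain ⟨R, hR⟩ := hv.exists_radius_transported hφ hg.2 hT
  refine ⟨Metric.closedBall 0 R, isCompact_closedBall _ _, ?_⟩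
  have : Ioo (-(|t₀| + 1)) (|t₀| + 1) ∈ 𝓝 t₀ :=
    isOpen_Ioo.mem_nhds (abs_lt.1 (by linarith))
  filter_upwards [this] with t ht x hx
  rw [mem_closedBall_zero_iff, not_le] at hx
  refine integral_eq_zero_of_ae (Eventually.of_forall fun z => ?_)
  by_cases hz : φ z = 0
  · simp [hz]
  · have := hR t (Ioo_subset_Icc_self ht) x hx z hz
    simp [image_eq_zero_of_notMem_tsupport (f := fderiv ℝ g)
      fun hmem => this (tsupport_fderiv_subset ℝ hmem)]

/-- Since the flow preserves area, passing from labels to positions shows this to be the convolution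
of the continuous function `φ ∘ flow t 0` with the smooth `g`. -/
theorem isTestFunction_transported (hv : IsOsgoodField v)
    (hmp : ∀ t, MeasurePreserving (hv.flowHomeo 0 t) (volume : Measure Plane) volume)
    (hφ : IsTestFunction φ) (hg : IsTestFunction g) (t : ℝ) :
    IsTestFunction (hv.transported φ g t) := by
  have hφc := hφ.1.continuous
  have e : hv.transported φ g t = convolution (fun y => φ (hv.flow t 0 y)) g
      (ContinuousLinearMap.mul ℝ ℝ) volume := by
    ext x
    rw [convolution_def, ← (hmp t).integral_comp (hv.flowHomeo 0 t).measurableEmbedding]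
    refine integral_congr_ae (Eventually.of_forall fun z => ?_)
    simp [flowHomeo]
  have hc : Continuous fun y => φ (hv.flow t 0 y) := hφc.comp (hv.continuous_flow_right t 0)
  have hs : HasCompactSupport fun y => φ (hv.flow t 0 y) :=
    hφ.2.comp_homeomorph (hv.flowHomeo t 0)
  rw [e]
  exact ⟨hg.2.contDiff_convolution_right _ (hc.locallyIntegrable) hg.1, hs.convolution _ hg.2⟩

end IsOsgoodField

theorem isDivergenceFree_const (w : Plane) : IsDivergenceFree fun _ => w := by
  intro φ hφ
  have hφ' : Continuous (fderiv ℝ φ) := hφ.1.continuous_fderiv (by simp)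
  have h := integral_mul_fderiv_eq_neg_fderiv_mul_of_integrable (μ := (volume : Measure Plane))
    (f := fun _ => (1 : ℝ)) (g := φ) (v := w) (by simp)
    (by
      simp only [one_mul]
      exact Continuous.integrable_of_hasCompactSupport (by fun_prop)
        ((hφ.2.fderiv ℝ).mono fun x hx h => hx (by simp [h])))
    (by simpa using hφ.1.continuous.integrable_of_hasCompactSupport hφ.2)
    (fun _ _ => by fun_prop) fun x _ => hφ.1.differentiable (by simp) x
  simpa using h

/-- Mollifiers with a uniform gradient bound. -/
theorem exists_mollifier : ∃ G, 0 ≤ G ∧ ∀ r > 0, ∃ g : Plane → ℝ, IsTestFunction g ∧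
    (∀ x, 0 ≤ g x) ∧ ∫ x, g x = 1 ∧ tsupport g ⊆ Metric.closedBall 0 r ∧
    ∀ x, ‖fderiv ℝ g x‖ ≤ G / r ^ 3 := by
  let β : ContDiffBump (0 : Plane) := ⟨1 / 2, 1, by norm_num, by norm_num⟩
  set ρ : Plane → ℝ := β.normed volume
  have hρ : IsTestFunction ρ := ⟨β.contDiff_normed, β.hasCompactSupport_normed⟩
  have hρ' : Continuous (fderiv ℝ ρ) := hρ.1.continuous_fderiv (by simp)
  obtain ⟨G, hG⟩ := (hρ.2.fderiv ℝ).exists_bound_of_continuous hρ'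
  refine ⟨G, (norm_nonneg _).trans (hG 0), fun r hr => ?_⟩
  have hs : tsupport (fun x => (r ^ 2)⁻¹ * ρ (r⁻¹ • x)) ⊆ Metric.closedBall 0 r := by
    refine closure_minimal (fun x hx => ?_) Metric.isClosed_closedBall
    have h1 : r⁻¹ • x ∈ Function.support ρ := fun h => hx (by simp [h])
    rw [β.support_normed_eq, mem_ball_zero_iff, norm_smul, norm_inv, Real.norm_of_nonneg hr.le,
      inv_mul_lt_iff₀ hr] at h1
    rw [mem_closedBall_zero_iff]
    simpa [β] using h1.le
  -- The factor `r⁻²` keeps the mass equal to one in dimension two; the gradient gains another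
  -- `r⁻¹`.
  refine ⟨fun x => (r ^ 2)⁻¹ * ρ (r⁻¹ • x), ⟨?_, ?_⟩, fun x => ?_, ?_, hs, fun x => ?_⟩
  · exact contDiff_const.mul (hρ.1.comp (contDiff_const_smul _))
  · exact (isCompact_closedBall _ _).of_isClosed_subset (isClosed_tsupport _) hs
  · exact mul_nonneg (by positivity) (β.nonneg_normed _)
  · rw [integral_const_mul, Measure.integral_comp_inv_smul_of_nonneg _ _ hr.le, β.integral_normed]
    simp [hr.ne']
  · have h1 : HasFDerivAt (fun x => ρ (r⁻¹ • x))
        ((fderiv ℝ ρ (r⁻¹ • x)).comp (r⁻¹ • ContinuousLinearMap.id ℝ Plane)) x :=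
      ((hρ.1.differentiable (by simp) _).hasFDerivAt).comp x ((hasFDerivAt_id x).const_smul r⁻¹)
    rw [(h1.const_mul ((r ^ 2)⁻¹)).fderiv, ContinuousLinearMap.comp_smul,
      ContinuousLinearMap.comp_id, norm_smul, norm_smul, norm_inv, norm_inv, norm_pow,
      Real.norm_of_nonneg hr.le]
    have := hG (r⁻¹ • x)
    calc (r ^ 2)⁻¹ * (r⁻¹ * ‖fderiv ℝ ρ (r⁻¹ • x)‖) ≤ (r ^ 2)⁻¹ * (r⁻¹ * G) := by gcongr
      _ = G / r ^ 3 := by field_simp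

/-! ### The commutator estimate and transport of weak solutions by the flow. -/

namespace IsOsgoodField

variable {v : ℝ → Plane → Plane} {φ g : Plane → ℝ}

theorem integral_mul_comp_flow (hv : IsOsgoodField v)
    (hmp : ∀ t, MeasurePreserving (hv.flowHomeo 0 t) (volume : Measure Plane) volume)
    (φ f : Plane → ℝ) (t : ℝ) :
    ∫ z, φ z * f (hv.flow 0 t z) = ∫ y, φ (hv.flow t 0 y) * f y := by
  have h := (hmp t).integral_comp (hv.flowHomeo 0 t).measurableEmbedding
    fun y => φ (hv.flow t 0 y) * f y
  simpa [flowHomeo] using h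

/-- The mollification of a transported function solves the transport equation up to a
commutator. -/
theorem transportedDeriv_add_fderiv (hv : IsOsgoodField v)
    (hmp : ∀ t, MeasurePreserving (hv.flowHomeo 0 t) (volume : Measure Plane) volume)
    (hdiv : ∀ t, IsDivergenceFree (v t)) (hφ : IsTestFunction φ) (hg : IsTestFunction g)
    (t : ℝ) (x : Plane) :
    hv.transportedDeriv φ g t x + fderiv ℝ (hv.transported φ g t) x (v t x) =
      ∫ y, (φ (hv.flow t 0 y) - φ (hv.flow t 0 x)) * fderiv ℝ g (x - y) (v t x - v t y) := by
  have hφc := hφ.1.continuous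
  have hg' : Continuous (fderiv ℝ g) := hg.1.continuous_fderiv (by simp)
  have hf := hv.continuous_flow_right 0 t
  have hf0 := hv.continuous_flow_right t 0
  have hvc : Continuous (v t) := hv.continuous.comp (continuous_const.prodMk continuous_id)
  have hsx : HasCompactSupport fun y => fderiv ℝ g (x - y) :=
    (hg.2.fderiv ℝ).comp_homeomorph (.subLeft x)
  have hs : HasCompactSupport fun y => fderiv ℝ g (x - y) (v t x - v t y) :=
    hsx.mono fun y hy h => hy (by simp [h])
  have hγ : IsTestFunction fun y => g (x - y) :=
    ⟨hg.1.comp (contDiff_const.sub contDiff_id), hg.2.comp_homeomorph (.subLeft x)⟩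
  have hγ' : ∀ y w, fderiv ℝ (fun y => g (x - y)) y w = -fderiv ℝ g (x - y) w := fun y w => by
    have h1 : HasFDerivAt (fun y => g (x - y))
        ((fderiv ℝ g (x - y)).comp (-ContinuousLinearMap.id ℝ Plane)) y :=
      (hg.1.differentiable (by simp) (x - y)).hasFDerivAt.comp y ((hasFDerivAt_id y).const_sub x)
    rw [h1.fderiv]
    simp
  -- Because `v t` and constant fields are divergence-free, the kernel of the commutator has zero
  -- mean. This allows the value of the carried function at `x` to be subtracted, so that only its
  -- oscillation remains.
  have e0 : ∫ y, fderiv ℝ g (x - y) (v t x - v t y) = 0 := by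
    have h1 := isDivergenceFree_const (v t x) _ hγ
    have h2 := hdiv t _ hγ
    simp only [hγ', integral_neg, neg_eq_zero] at h1 h2
    simp only [map_sub]
    rw [integral_sub, h1, h2, sub_zero]
    · exact Continuous.integrable_of_hasCompactSupport (by fun_prop)
        (hsx.mono fun y hy h => hy (by simp [h]))
    · exact Continuous.integrable_of_hasCompactSupport (by fun_prop)
        (hsx.mono fun y hy h => hy (by simp [h]))
  have e1 : hv.transportedDeriv φ g t x + fderiv ℝ (hv.transported φ g t) x (v t x) =
      ∫ z, φ z * fderiv ℝ g (x - hv.flow 0 t z) (v t x - v t (hv.flow 0 t z)) := by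
    rw [hv.fderiv_transported_apply hφ hg, transportedDeriv, ← integral_add]
    · congr 1; ext z; rw [map_sub]; ring
    · exact Continuous.integrable_of_hasCompactSupport (by fun_prop) hφ.2.mul_right
    · exact Continuous.integrable_of_hasCompactSupport (by fun_prop) hφ.2.mul_right
  have e2 : ∫ z, φ z * fderiv ℝ g (x - hv.flow 0 t z) (v t x - v t (hv.flow 0 t z)) =
      ∫ y, φ (hv.flow t 0 y) * fderiv ℝ g (x - y) (v t x - v t y) :=
    hv.integral_mul_comp_flow hmp φ (fun y => fderiv ℝ g (x - y) (v t x - v t y)) t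
  rw [e1, e2]
  simp only [sub_mul]
  rw [integral_sub, integral_const_mul, e0, mul_zero, sub_zero]
  · exact Continuous.integrable_of_hasCompactSupport (by fun_prop) hs.mul_left
  · exact Continuous.integrable_of_hasCompactSupport (by fun_prop) hs.mul_left

/-- The powers of `r` cancel: the mollifier's gradient costs `r⁻³`, the velocity difference gains
`2M (1 - log r) r`, and the area of the ball gains `r²`. What remains is `(1 - log r)` times the
oscillation of `φ ∘ flow`, which vanishes as `r → 0`. -/
theorem abs_transportedDeriv_add_fderiv_le (hv : IsOsgoodField v)
    (hmp : ∀ t, MeasurePreserving (hv.flowHomeo 0 t) (volume : Measure Plane) volume)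
    (hdiv : ∀ t, IsDivergenceFree (v t)) (hφ : IsTestFunction φ) (hg : IsTestFunction g)
    {K M G T r t : ℝ} (hK : 0 ≤ K) (hφK : ∀ x y, |φ x - φ y| ≤ K * ‖x - y‖) (hM : 0 ≤ M)
    (hlog : LogLipOn v M T) (hr : 0 < r) (hr1 : r ≤ 1)
    (hB : osgoodModulus (stabilityExponent M T) r ≤ 1) (hT : 0 ≤ T) (ht : t ∈ Icc (-T) T)
    (hgr : tsupport g ⊆ Metric.closedBall 0 r) (hG : ∀ x, ‖fderiv ℝ g x‖ ≤ G / r ^ 3)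
    (x : Plane) :
    |hv.transportedDeriv φ g t x + fderiv ℝ (hv.transported φ g t) x (v t x)| ≤
      2 * K * G * M * volume.real (Metric.closedBall (0 : Plane) 1) *
        ((1 - Real.log r) * osgoodModulus (stabilityExponent M T) r) := by
  rw [hv.transportedDeriv_add_fderiv hmp hdiv hφ hg]
  set κ := osgoodModulus (stabilityExponent M T) r
  have hκ : 0 < κ := osgoodModulus_pos _ _
  have hl : 1 ≤ 1 - Real.log r := by linarith [Real.log_nonpos hr.le hr1]
  have hG0 : 0 ≤ G / r ^ 3 := (norm_nonneg _).trans (hG 0)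
  rw [← setIntegral_eq_integral_of_forall_compl_eq_zero (s := Metric.closedBall x r)
    (fun y hy => ?_)]
  · have h1 : ∀ y ∈ Metric.closedBall x r,
        ‖(φ (hv.flow t 0 y) - φ (hv.flow t 0 x)) * fderiv ℝ g (x - y) (v t x - v t y)‖ ≤
          K * κ * (G / r ^ 3 * (M * (2 * (1 - Real.log r) * r))) := by
      intro y hy
      rw [Metric.mem_closedBall, dist_eq_norm] at hy
      rw [norm_mul]
      gcongr
      · refine (hφK _ _).trans ?_
        gcongr
        exact hv.norm_flow_sub_flow_le_osgoodModulus hM hlog ht ⟨by linarith, hT⟩ hr hr1 hB hy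
      · refine ((fderiv ℝ g _).le_opNorm _).trans ?_
        gcongr
        · exact hG _
        · refine (hlog t ht x y r hr hr1).trans ?_
          gcongr
          rw [norm_sub_rev] at hy
          nlinarith
    have h2 := norm_setIntegral_le_of_norm_le_const (μ := (volume : Measure Plane))
      measure_closedBall_lt_top h1
    refine h2.trans (le_of_eq ?_)
    rw [Measure.addHaar_real_closedBall' _ _ hr.le, finrank_euclideanSpace_fin]
    field_simp
  · have : fderiv ℝ g (x - y) = 0 := by
      refine image_eq_zero_of_notMem_tsupport fun hmem => hy ?_
      have := hgr (tsupport_fderiv_subset ℝ hmem)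
      rwa [mem_closedBall_zero_iff, norm_sub_rev, ← dist_eq_norm] at this
    rw [this, zero_apply, mul_zero]

/-- Mollification is an average over a ball of radius `r`, on which `φ ∘ flow` oscillates by at most
its Lipschitz constant times the modulus of the flow. -/
theorem abs_transported_sub_le (hv : IsOsgoodField v)
    (hmp : ∀ t, MeasurePreserving (hv.flowHomeo 0 t) (volume : Measure Plane) volume)
    (hφ : IsTestFunction φ) (hg : IsTestFunction g)
    {K M T r t : ℝ} (hK : 0 ≤ K) (hφK : ∀ x y, |φ x - φ y| ≤ K * ‖x - y‖) (hM : 0 ≤ M)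
    (hlog : LogLipOn v M T) (hr : 0 < r) (hr1 : r ≤ 1)
    (hB : osgoodModulus (stabilityExponent M T) r ≤ 1) (hT : 0 ≤ T) (ht : t ∈ Icc (-T) T)
    (hgr : tsupport g ⊆ Metric.closedBall 0 r) (hg0 : ∀ x, 0 ≤ g x) (hg1 : ∫ x, g x = 1)
    (x : Plane) :
    |hv.transported φ g t x - φ (hv.flow t 0 x)| ≤
      K * osgoodModulus (stabilityExponent M T) r := by
  set κ := osgoodModulus (stabilityExponent M T) r
  have hφc := hφ.1.continuous
  have hgc := hg.1.continuous
  have hf0 := hv.continuous_flow_right t 0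
  have hgx : HasCompactSupport fun y => g (x - y) := hg.2.comp_homeomorph (.subLeft x)
  have e1 : hv.transported φ g t x = ∫ y, φ (hv.flow t 0 y) * g (x - y) :=
    hv.integral_mul_comp_flow hmp φ (fun y => g (x - y)) t
  have hgx1 : ∫ y, g (x - y) = 1 := by rw [integral_sub_left_eq_self, hg1]
  have e2 : φ (hv.flow t 0 x) = ∫ y, φ (hv.flow t 0 x) * g (x - y) := by
    rw [integral_const_mul, hgx1, mul_one]
  have e3 : K * κ = ∫ y, K * κ * g (x - y) := by rw [integral_const_mul, hgx1, mul_one]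
  have i : ∀ f : Plane → ℝ, Continuous f → Integrable fun y => f y * g (x - y) := fun f hf =>
    Continuous.integrable_of_hasCompactSupport (by fun_prop) hgx.mul_left
  rw [e1, e2, ← integral_sub (i (fun y => φ (hv.flow t 0 y)) (by fun_prop))
    (i (fun _ => φ (hv.flow t 0 x)) continuous_const), e3]
  rw [← Real.norm_eq_abs]
  refine norm_integral_le_of_norm_le (i (fun _ => K * κ) continuous_const) (Eventually.of_forall fun y => ?_)
  rw [← sub_mul, norm_mul, Real.norm_of_nonneg (hg0 _)]
  by_cases hy : ‖y - x‖ ≤ r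
  · have := hg0 (x - y)
    gcongr
    refine (hφK _ _).trans ?_
    gcongr
    exact hv.norm_flow_sub_flow_le_osgoodModulus hM hlog ht ⟨by linarith, hT⟩ hr hr1 hB hy
  · have : g (x - y) = 0 := image_eq_zero_of_notMem_tsupport fun hmem => hy (by
      have := hgr hmem
      rwa [mem_closedBall_zero_iff, norm_sub_rev] at this)
    simp [this]

/-- Solutions of the transport equation are constant along the flow, tested with smooth
functions. -/
theorem vintegral_comp_flow_of_isTestFunction (hv : IsOsgoodField v)
    (hmp : ∀ t, MeasurePreserving (hv.flowHomeo 0 t) (volume : Measure Plane) volume)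
    (hdiv : ∀ t, IsDivergenceFree (v t)) {q : ℝ → RadonMeasure} (hq : IsWeakStarContinuous q)
    (h : ∀ φ : ℝ × Plane → ℝ, IsTestFunction φ → weakCoadjoint v q φ = 0)
    (hφ : IsTestFunction φ) (t : ℝ) :
    ∫ᵛ x, φ (hv.flow t 0 x) ∂<•(q t) = ∫ᵛ x, φ x ∂<•(q 0) := by
  obtain ⟨K, -, -, hK, -, -, hφK, -, -⟩ := hφ.exists_bounds
  set T := |t|
  have hT : 0 ≤ T := abs_nonneg t
  have h0T : (0 : ℝ) ∈ Icc (-T) T := ⟨by linarith, hT⟩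
  have htT : t ∈ Icc (-T) T := abs_le.1 le_rfl
  obtain ⟨M, hM, hlog, -⟩ := hv.exists_logLipOn T
  obtain ⟨P, hP, hqP⟩ := hq.exists_pairingBound T
  obtain ⟨G, hG, H⟩ := exists_mollifier
  set A := 2 * K * G * M * volume.real (Metric.closedBall (0 : Plane) 1)
  set m := osgoodModulus (stabilityExponent M T)
  have hint : ∀ (p : RadonMeasure) {f : Plane → ℝ}, Continuous f → HasCompactSupport f →
      p.Integrable f := fun p f hf hfc =>
    have ⟨C, hC⟩ := hfc.exists_bound_of_continuous hf
    integrable_of_continuous_of_bound p hf hC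
  have hφt : ∀ s, Continuous fun x => φ (hv.flow s 0 x) := fun s =>
    hφ.1.continuous.comp (hv.continuous_flow_right s 0)
  have hφs : ∀ s, HasCompactSupport fun x => φ (hv.flow s 0 x) := fun s =>
    hφ.2.comp_homeomorph (hv.flowHomeo s 0)
  -- The error at scale `r` is made of the two mollification errors, at times `t` and `0`, and the
  -- commutator integrated over the time interval.
  have key : ∀ r, 0 < r → r ≤ 1 → m r ≤ 1 →
      |∫ᵛ x, φ (hv.flow t 0 x) ∂<•(q t) - ∫ᵛ x, φ x ∂<•(q 0)| ≤
        2 * (P * (K * m r)) + P * (A * ((1 - Real.log r) * m r)) * T := by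
    intro r hr hr1 hB
    obtain ⟨g, hg, hg0, hg1, hgr, hgG⟩ := H r hr
    have hψ := hv.isTestFunction_transported hmp hφ hg
    have happrox : ∀ s ∈ Icc (-T) T, |∫ᵛ x, hv.transported φ g s x ∂<•(q s) -
        ∫ᵛ x, φ (hv.flow s 0 x) ∂<•(q s)| ≤ P * (K * m r) := by
      intro s hs
      rw [← VectorMeasure.integral_fun_sub (hint (q s) (hψ s).1.continuous (hψ s).2)
        (hint (q s) (hφt s) (hφs s))]
      refine hqP s hs _ ((hψ s).1.continuous.sub (hφt s)) ?_ _ fun x =>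
        hv.abs_transported_sub_le hmp hφ hg hK hφK hM hlog hr hr1 hB hT hs hgr hg0 hg1 x
      simpa [Pi.sub_def, Pi.add_def] using (tendsto_cocompact_of_hasCompactSupport (hψ s).2).sub
        (tendsto_cocompact_of_hasCompactSupport (hφs s))
    have hc' := hv.continuous_transportedDeriv hφ hg
    have hcs : ∀ s, Continuous (hv.transportedDeriv φ g s) := fun s =>
      hc'.comp (continuous_const.prodMk continuous_id)
    have hss : ∀ s, HasCompactSupport (hv.transportedDeriv φ g s) := fun s => by
      obtain ⟨L, hL, hL0⟩ := hv.eventually_transportedDeriv hφ hg s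
      exact HasCompactSupport.intro hL hL0.self_of_nhds
    have hvs : ∀ s, Continuous (v s) := fun s =>
      hv.continuous.comp (continuous_const.prodMk continuous_id)
    have hfc : ∀ s, Continuous fun x => fderiv ℝ (hv.transported φ g s) x (v s x) := fun s =>
      ((hψ s).1.continuous_fderiv (by simp)).clm_apply (hvs s)
    have hfs : ∀ s, HasCompactSupport fun x => fderiv ℝ (hv.transported φ g s) x (v s x) :=
      fun s => ((hψ s).2.fderiv ℝ).mono fun x hx h => hx (by simp [h])
    have hd : ∀ s, HasDerivAt (fun s => ∫ᵛ x, hv.transported φ g s x ∂<•(q s))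
        (∫ᵛ x, (hv.transportedDeriv φ g s x + fderiv ℝ (hv.transported φ g s) x (v s x))
          ∂<•(q s)) s := by
      intro s
      obtain ⟨L, hL, hL0⟩ := hv.eventually_transportedDeriv hφ hg s
      rw [VectorMeasure.integral_fun_add (hint (q s) (hcs s) (hss s))
        (hint (q s) (hfc s) (hfs s))]
      exact hasDerivAt_vintegral_param hq (fun s => (hψ s).1.continuous) (fun s => (hψ s).2)
        (hcs s) (hss s) (hv.hasDerivAt_transported hφ hg)
        (eventually_abs_sub_le_of_support hc' hL hL0)
        (hasDerivAt_vintegral_testFunction hq hv.continuous h (hψ s) s)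
    have hbd : ∀ s ∈ Icc (-T) T, ‖∫ᵛ x, (hv.transportedDeriv φ g s x +
        fderiv ℝ (hv.transported φ g s) x (v s x)) ∂<•(q s)‖ ≤
          P * (A * ((1 - Real.log r) * m r)) := by
      intro s hs
      refine hqP s hs _ ((hcs s).add (hfc s)) ?_ _ fun x =>
        hv.abs_transportedDeriv_add_fderiv_le hmp hdiv hφ hg hK hφK hM hlog hr hr1 hB hT hs hgr
          hgG x
      simpa [Pi.sub_def, Pi.add_def] using (tendsto_cocompact_of_hasCompactSupport (hss s)).add
        (tendsto_cocompact_of_hasCompactSupport (hfs s))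
    have h1 := (convex_Icc (-T) T).norm_image_sub_le_of_norm_hasDerivWithin_le
      (fun s _ => (hd s).hasDerivWithinAt) hbd h0T htT
    have h2 := happrox t htT
    have h3 := happrox 0 h0T
    simp only [flow_self] at h3
    rw [sub_zero, Real.norm_eq_abs, Real.norm_eq_abs] at h1
    rw [abs_le] at h1 h2 h3 ⊢
    constructor <;> linarith [h1.1, h1.2, h2.1, h2.2, h3.1, h3.2]
  have hlim : Tendsto (fun r => 2 * (P * (K * m r)) + P * (A * ((1 - Real.log r) * m r)) * T)
      (𝓝[>] 0) (𝓝 0) := by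
    have h1 := (((tendsto_osgoodModulus (stabilityExponent M T)).const_mul K).const_mul P).const_mul 2
    have h2 := (((tendsto_log_mul_osgoodModulus (stabilityExponent M T)).const_mul A).const_mul
      P).mul_const T
    simpa using h1.add h2
  have hev : ∀ᶠ r in 𝓝[>] (0 : ℝ), m r ≤ 1 ∧ r ∈ Ioo (0 : ℝ) 1 :=
    ((tendsto_osgoodModulus (stabilityExponent M T)).eventually
      (ge_mem_nhds zero_lt_one)).and (Ioo_mem_nhdsGT zero_lt_one)
  have := ge_of_tendsto hlim (hev.mono fun r hr => key r hr.2.1 hr.2.2.le hr.1)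
  exact sub_eq_zero.1 (abs_nonpos_iff.1 this)

/-- Solutions of the transport equation are transported by the flow. -/
theorem eq_map_flow (hv : IsOsgoodField v)
    (hmp : ∀ t, MeasurePreserving (hv.flowHomeo 0 t) (volume : Measure Plane) volume)
    (hdiv : ∀ t, IsDivergenceFree (v t)) {q : ℝ → RadonMeasure} (hq : IsWeakStarContinuous q)
    (h : ∀ φ : ℝ × Plane → ℝ, IsTestFunction φ → weakCoadjoint v q φ = 0) (t : ℝ) :
    q t = VectorMeasure.map (q 0) (hv.flow 0 t) := by
  have hf := hv.continuous_flow_right 0 t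
  refine ext_of_vintegral_eq fun f hfc hfs => ?_
  obtain ⟨C, hC⟩ := hfs.exists_bound_of_continuous hfc
  rw [vintegral_map (q 0) hf hfc hC]
  have hfs' : HasCompactSupport fun x => f (hv.flow 0 t x) :=
    hfs.comp_homeomorph (hv.flowHomeo 0 t)
  -- The smooth function to be transported approximates `f ∘ flow 0 t`; carried forward by the flow
  -- it approximates `f`.
  obtain ⟨_, HR⟩ := exists_testFunction_approx (hfc.comp hf) hfs'
  have key : ∀ ε > 0, |∫ᵛ x, f x ∂<•(q t) - ∫ᵛ x, f (hv.flow 0 t x) ∂<•(q 0)| ≤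
      (totalMass (q t) + totalMass (q 0)) * ε := by
    intro ε hε
    obtain ⟨g, hg, hgf, -⟩ := HR ε hε
    have e := hv.vintegral_comp_flow_of_isTestFunction hmp hdiv hq h hg t
    obtain ⟨D, hD⟩ := hg.2.exists_bound_of_continuous hg.1.continuous
    have i1 := integrable_of_continuous_of_bound (q t) hfc hC
    have i2 := integrable_of_continuous_of_bound (q t) (f := fun x => g (hv.flow t 0 x))
      (hg.1.continuous.comp (hv.continuous_flow_right t 0)) fun x => hD _
    have i3 := integrable_of_continuous_of_bound (q 0) hg.1.continuous hD
    have i4 := integrable_of_continuous_of_bound (q 0) (f := fun x => f (hv.flow 0 t x))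
      (hfc.comp hf) fun x => hC _
    have h1 := norm_vintegral_le (q t) (f := fun x => g (hv.flow t 0 x) - f x) (C := ε) fun x => by
      simpa using hgf (hv.flow t 0 x)
    have h2 := norm_vintegral_le (q 0) (f := fun x => g x - f (hv.flow 0 t x)) (C := ε) hgf
    rw [VectorMeasure.integral_fun_sub i2 i1, Real.norm_eq_abs] at h1
    rw [VectorMeasure.integral_fun_sub i3 i4, Real.norm_eq_abs] at h2
    rw [e] at h1
    rw [abs_le] at h1 h2 ⊢
    constructor <;> linarith [h1.1, h1.2, h2.1, h2.2]
  have hlim : Tendsto (fun ε => (totalMass (q t) + totalMass (q 0)) * ε) (𝓝[>] 0) (𝓝 0) := by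
    have : Tendsto (fun ε : ℝ => ε) (𝓝[>] 0) (𝓝 0) := tendsto_nhdsWithin_of_tendsto_nhds tendsto_id
    simpa using this.const_mul (totalMass (q t) + totalMass (q 0))
  have := ge_of_tendsto hlim (eventually_mem_nhdsWithin.mono fun ε hε => key ε hε)
  exact sub_eq_zero.1 (abs_nonpos_iff.1 this)

end IsOsgoodField

/-! ### Existence and uniqueness -/

namespace IsKernel

variable {k : Plane → Plane}

/-- The velocity of a measure `q` transported by the displacement `w`, as a bounded continuous
function. -/
def displacedVelocity (hk : IsKernel k) (q : RadonMeasure) (w : Plane →ᵇ Plane) : Plane →ᵇ Plane :=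
  BoundedContinuousFunction.ofNormedAddCommGroup (fun x => ∫ᵛ y, k (x - (y + w y)) ∂<•q)
    (by
      obtain ⟨C, hC⟩ := hk.exists_bound
      have hkc := hk.continuous
      refine VectorMeasure.continuous_of_dominated (bound := fun _ => C) (fun x => ?_)
        (fun x => Eventually.of_forall fun y => hC _) (integrable_const _)
        (Eventually.of_forall fun y => by fun_prop)
      exact Continuous.aestronglyMeasurable (by fun_prop))
    (totalMass q * hk.exists_bound.choose)
    (fun _ => norm_vintegral_le q fun _ => hk.exists_bound.choose_spec _)

theorem displacedVelocity_apply (hk : IsKernel k) (q : RadonMeasure) (w : Plane →ᵇ Plane)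
    (x : Plane) : hk.displacedVelocity q w x =
      velocity k (VectorMeasure.map q fun y => y + w y) x :=
  (velocity_map hk q (by fun_prop) x).symm

theorem continuous_displacedVelocity (hk : IsKernel k) (q : RadonMeasure) :
    Continuous (hk.displacedVelocity q) := by
  rw [Metric.continuous_iff]
  intro w ε hε
  have hN := totalMass_nonneg q
  obtain ⟨C, hC⟩ := hk.exists_bound
  have hkc := hk.continuous
  have hint : ∀ (w : Plane →ᵇ Plane) x, q.Integrable fun y => k (x - (y + w y)) := fun w x =>
    integrable_of_continuous_of_bound q (by fun_prop) fun y => hC _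
  obtain ⟨δ, hδ, H⟩ := Metric.uniformContinuous_iff.1 hk.uniformContinuous
    (ε / (2 * (totalMass q + 1))) (by positivity)
  refine ⟨δ, hδ, fun w' hw' => ?_⟩
  have hle : dist (hk.displacedVelocity q w') (hk.displacedVelocity q w) ≤
      totalMass q * (ε / (2 * (totalMass q + 1))) := by
    rw [BoundedContinuousFunction.dist_le (by positivity)]
    intro x
    rw [dist_eq_norm]
    change ‖∫ᵛ y, k (x - (y + w' y)) ∂<•q - ∫ᵛ y, k (x - (y + w y)) ∂<•q‖ ≤ _
    rw [← VectorMeasure.integral_fun_sub (hint w' x) (hint w x)]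
    refine norm_vintegral_le q fun y => ?_
    rw [← dist_eq_norm]
    refine (H ?_).le
    rw [dist_sub_left, dist_add_left]
    exact (BoundedContinuousFunction.dist_coe_le_dist y).trans_lt hw'
  refine hle.trans_lt ?_
  rw [mul_div_assoc', div_lt_iff₀ (by positivity)]
  nlinarith

theorem particleVelocity_eq (hk : IsKernel k) (q : RadonMeasure) {w : Plane → Plane}
    (hw : Continuous w) (x : Plane) :
    particleVelocity k q w x = velocity k (VectorMeasure.map q fun y => y + w y) (x + w x) :=
  (velocity_map hk q (by fun_prop) _).symm

end IsKernel

/-- The particles of a weak solution solve an ordinary differential equation in the space of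
bounded continuous displacements. -/
theorem IsWeakSolution.exists_displacement {α : ℝ} (hα : 0 < α) {q₀ : RadonMeasure}
    {η u : ℝ → Plane → Plane} {q : ℝ → RadonMeasure} (h : IsWeakSolution α q₀ η u q) :
    ∃ W : ℝ → Plane →ᵇ Plane, W 0 = 0 ∧
      (∀ t, HasDerivAt W ((isKernel_blobKernel hα).particleField q₀ (W t)) t) ∧
      (∀ t x, η t x = x + W t x) ∧ ∀ t, q t = VectorMeasure.map q₀ fun x => x + W t x := by
  have hk := isKernel_blobKernel hα
  have hq : IsWeakStarContinuous q := h.continuous_weakStar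
  set hv := isOsgoodField_velocity hα hq
  have hu : u = fun t x => EulerAlpha.velocity (blobKernel α) (q t) x := funext₂ h.velocity
  have hη : ∀ t x, η t x = hv.flow 0 t x := fun t x => by
    have := hv.flow_eq (y := fun s => η s x) (fun s => (h.flow s x).congr_deriv (by rw [hu])) 0 t
    rw [h.flow_initial] at this
    exact this.symm
  have hqt : ∀ t, q t = VectorMeasure.map q₀ (hv.flow 0 t) := fun t => by
    have htr := h.transport
    rw [hu] at htr
    rw [← h.initial]
    exact hv.eq_map_flow (fun t => measurePreserving_flow hα hq 0 t)
      (fun t => isDivergenceFree_velocity hα (q t)) hq htr t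
  have hbd : ∀ t, ∃ C, ∀ x, ‖hv.flow 0 t x - x‖ ≤ C := fun t => by
    obtain ⟨M, hM, -, hb⟩ := hv.exists_logLipOn |t|
    exact ⟨_, fun x => hv.norm_flow_sub_le hb (abs_le.1 (by simp)) (abs_le.1 le_rfl) x⟩
  choose C hC using hbd
  let W : ℝ → Plane →ᵇ Plane := fun t => BoundedContinuousFunction.ofNormedAddCommGroup
    (fun x => hv.flow 0 t x - x) ((hv.continuous_flow_right 0 t).sub continuous_id) (C t) (hC t)
  have hW : ∀ t x, hv.flow 0 t x = x + W t x := fun t x => by simp [W]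
  have hWc : Continuous W := by
    rw [continuous_iff_continuousAt]
    intro t₀
    obtain ⟨M, hM, -, hb⟩ := hv.exists_logLipOn (|t₀| + 1)
    have hmem : Icc (-(|t₀| + 1)) (|t₀| + 1) ∈ 𝓝 t₀ :=
      Icc_mem_nhds (by linarith [neg_abs_le t₀]) (by linarith [le_abs_self t₀])
    rw [ContinuousAt, tendsto_iff_norm_sub_tendsto_zero]
    have hlim : Tendsto (fun t => M * |t - t₀|) (𝓝 t₀) (𝓝 0) := by
      have : Continuous fun t : ℝ => M * |t - t₀| := by fun_prop
      simpa using this.tendsto t₀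
    refine squeeze_zero' (Eventually.of_forall fun t => norm_nonneg _) ?_ hlim
    filter_upwards [hmem] with t ht
    rw [BoundedContinuousFunction.norm_le (by positivity)]
    intro x
    have := hv.norm_flow_sub_flow_le hb 0 (mem_of_mem_nhds hmem) ht x
    simpa [W] using this
  have hqW : ∀ t, q t = VectorMeasure.map q₀ fun x => x + W t x := fun t => by
    rw [hqt t]
    exact congrArg _ (funext (hW t))
  -- The displacement is so far differentiable in time only for each particle. Since `F` is
  -- continuous in the supremum norm, `W` is its primitive, evaluated pointwise, and therefore
  -- differentiable in the Banach space.
  set F : ℝ → Plane →ᵇ Plane := fun t => hk.particleField q₀ (W t)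
  have hF : Continuous F := (hk.continuous_particleField q₀).comp hWc
  have hWd : ∀ t x, HasDerivAt (fun s => W s x) (F t x) t := fun t x => by
    have h1 := (hv.hasDerivAt_flow 0 t x).sub_const x
    refine h1.congr_deriv ?_
    simp only [F, IsKernel.particleField_apply]
    rw [hk.particleVelocity_eq q₀ (W t).continuous, ← hqW t, ← hW t x]
  have hW0 : W 0 = 0 := by ext1 x; simp [W]
  have hZ : ∀ t, HasDerivAt (fun t => ∫ s in (0 : ℝ)..t, F s) (F t) t := fun t =>
    (hF.integral_hasStrictDerivAt 0 t).hasDerivAt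
  have hWZ : W = fun t => ∫ s in (0 : ℝ)..t, F s := by
    ext1 t
    ext1 x
    have hd : ∀ t, HasDerivAt (fun t => W t x - (∫ s in (0 : ℝ)..t, F s) x) 0 t := fun t => by
      have h1 := (BoundedContinuousFunction.evalCLM ℝ x).hasFDerivAt.comp_hasDerivAt t (hZ t)
      exact ((hWd t x).sub h1).congr_deriv (sub_self _)
    have := is_const_of_deriv_eq_zero (fun t => (hd t).differentiableAt)
      (fun t => (hd t).deriv) t 0
    simp only [hW0, intervalIntegral.integral_same, sub_self] at this
    exact sub_eq_zero.1 this
  refine ⟨W, hW0, fun t => ?_, fun t x => (hη t x).trans (hW t x), hqW⟩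
  have := hZ t
  rwa [← hWZ] at this

end EulerAlpha

end

/-! ### Assembly of the theorem. -/

open EulerAlpha
theorem mainTheorem1 (α : ℝ) (hα : 0 < α) (q₀ : RadonMeasure) :
    ∃ (η : ℝ → MeasurePreservingHomeo) (u : ℝ → BoundedContinuousFunction Plane Plane)
      (q : ℝ → RadonMeasure),
      IsWeakSolution α q₀ (fun t => (η t).1) (fun t => u t) q ∧
      IsC1Curve η ∧
      (Continuous u ∧ ∀ t, IsDivergenceFree (u t)) ∧
      IsWeaklyContinuous q ∧
      (∀ (η' : ℝ → Plane → Plane) (u' : ℝ → Plane → Plane) (q' : ℝ → RadonMeasure),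
        IsWeakSolution α q₀ η' u' q' →
          (∀ t x, η' t x = (η t).1 x) ∧ (∀ t x, u' t x = u t x) ∧ ∀ t, q' t = q t) ∧
      (∀ t, coAdjoint (η t) (q t) = q₀) ∧
      (∀ φ : ℝ × Plane → ℝ, IsTestFunction φ → weakCoadjoint (fun t => u t) q φ = 0) := by
  have hk := isKernel_blobKernel hα
  obtain ⟨W, hW0, hW⟩ := (isOsgoodField_particleField hα q₀).exists_solution 0 0
  have hWc : Continuous W := continuous_iff_continuousAt.2 fun t => (hW t).continuousAt
  let Φ : ℝ → Plane → Plane := fun t x => x + W t x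
  have hΦ : ∀ t, Continuous (Φ t) := fun t => continuous_id.add (W t).continuous
  let q : ℝ → RadonMeasure := fun t => VectorMeasure.map q₀ (Φ t)
  let u : ℝ → Plane →ᵇ Plane := fun t => hk.displacedVelocity q₀ (W t)
  have hu : ∀ t x, u t x = velocity (blobKernel α) (q t) x := fun t x =>
    hk.displacedVelocity_apply q₀ (W t) x
  have hflow : ∀ t x, HasDerivAt (fun s => Φ s x) (u t (Φ t x)) t := fun t x => by
    have h1 := (BoundedContinuousFunction.evalCLM ℝ x).hasFDerivAt.comp_hasDerivAt t (hW t)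
    refine (h1.const_add x).congr_deriv ?_
    rw [hu]
    exact hk.particleVelocity_eq q₀ (W t).continuous x
  have hq : IsWeaklyContinuous q := isWeaklyContinuous_map q₀ hΦ fun x =>
    continuous_iff_continuousAt.2 fun t => (hflow t x).continuousAt
  have hq' := hq.isWeakStarContinuous
  set hv := isOsgoodField_velocity hα hq'
  have hΦ0 : ∀ x, Φ 0 x = x := fun x => by simp [Φ, hW0]
  have hΦv : ∀ t x, hv.flow 0 t x = Φ t x := fun t x => by
    have := hv.flow_eq (y := fun s => Φ s x) (fun s => (hflow s x).congr_deriv (hu s _)) 0 t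
    rwa [hΦ0] at this
  -- The particle map of the displacement equation is identified with the flow of its own velocity,
  -- and inherits from it invertibility and preservation of area.
  let η : ℝ → MeasurePreservingHomeo := fun t =>
    ⟨hv.flowHomeo 0 t, measurePreserving_flow hα hq' 0 t⟩
  have hη : ∀ t x, (η t).1 x = Φ t x := hΦv
  have hη' : (fun t => ((η t).1 : Plane → Plane)) = Φ := funext₂ hη
  have hq0 : q 0 = q₀ := by
    simp only [q, show Φ 0 = id from funext hΦ0, VectorMeasure.map_id]
  have htr : ∀ φ : ℝ × Plane → ℝ, IsTestFunction φ → weakCoadjoint (fun t => u t) q φ = 0 := by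
    intro φ hφ
    refine weakCoadjoint_map_eq_zero (u := fun t => u t) (M := totalMass q₀ * blobConst α)
      q₀ hΦ ?_ (fun t x => ?_) hflow hφ
    · have : (fun t => (u t : Plane → Plane)) = fun t x => velocity (blobKernel α) (q t) x :=
        funext₂ hu
      rw [this]
      exact hv.continuous
    · exact norm_vintegral_le q₀ fun y => norm_blobKernel_le hα _
  refine ⟨η, u, q, ?_, ?_, ⟨?_, fun t => ?_⟩, hq, ?_, fun t => ?_, htr⟩
  · rw [hη']
    exact ⟨hq', hq0, hu, htr, hΦ0, hflow⟩
  · refine ⟨W, ?_, fun t x => ?_⟩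
    · rw [contDiff_one_iff_deriv]
      refine ⟨fun t => (hW t).differentiableAt, ?_⟩
      rw [show deriv W = fun t => hk.particleField q₀ (W t) from funext fun t => (hW t).deriv]
      exact (hk.continuous_particleField q₀).comp hWc
    · rw [hη, hη, hΦ0]
  · exact (hk.continuous_displacedVelocity q₀).comp hWc
  · rw [show (u t : Plane → Plane) = velocity (blobKernel α) (q t) from funext (hu t)]
    exact isDivergenceFree_velocity hα (q t)
  · intro η' u' q' h
    -- Any competitor has a displacement solving the same equation with the same initial value;
    -- equality of displacements forces equality of the particles, the measures and hence the
    -- velocities.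
    obtain ⟨W', hW'0, hW', hη1, hq1⟩ := h.exists_displacement hα
    have e : W' = W := funext fun t =>
      (isOsgoodField_particleField hα q₀).unique hW' hW (hW'0.trans hW0.symm) t
    subst e
    refine ⟨fun t x => (hη1 t x).trans (hη t x).symm, fun t x => ?_, hq1⟩
    rw [h.velocity, hu, hq1 t]
    rfl
  -- The measure `q t` is the image of `q₀` under the very map that the co-Adjoint action undoes.
  · have e1 : ((η t).1 : Plane → Plane) = Φ t := funext (hη t)
    have hm : Measurable (Φ t) := (hΦ t).measurable
    have hm' : Measurable (η t).1.symm := (η t).1.symm.continuous.measurable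
    ext A hA
    rw [coAdjoint, VectorMeasure.map_apply _ hm' hA, VectorMeasure.map_apply _ hm (hm' hA),
      ← e1, ← preimage_comp, Homeomorph.symm_comp_self, preimage_id]
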